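/- Setting. Let $\mathbf P$ be a renewal measure on $\{0,1\}^{\{0,1,2,\dots\}}$, i.e. a probability measure such that the coordinates $\Delta_n$ satisfy, with $u_n=\mathbf P[\Delta_n=1]$, $$\mathbf P[\Delta_{n(0)}=1,\Delta_{n(1)}=1,\dots,\Delta_{n(m)}=1]=\prod_{i=1}^m u_{n(i)-n(i-1)}\qquad\text{for all } 0=n(0)<n(1)<\dots<n(m).$$ Let $U_n=\sum_{k=0}^n u_k$, let $S_0=0$, $S_k=\inf\{m>S_{k-1}:\Delta_m=1\}$ be the renewal times and $T_k=S_k-S_{k-1}$ the inter-arrival times. For $\theta\in[0,1]$ let $Y_n$ ($n\ge 0$) be fair coin tosses on $\{-1,1\}$, $Z_n$ ($n\ge 0$) coin tosses on $\{-1,1\}$ with mean $\theta$, all independent of each other and of $\Delta$; let $\mathbf Q_\theta$ be the joint law, and let $X_n=(1-\Delta_n)Y_n+\Delta_nZ_n$ be the observations. Put $\varphi=\log_2(1+\theta)$, $$R_n=\sup\{m\ge 0: X_{n+1}=\dots=X_{n+m}=1\},\qquad \widehat R(X)=\limsup_{n\to\infty}\frac{R_n}{\log_2 n},$$ $$\Lambda^*(a)=\lim_{m\to\infty}\frac{-\log_2\mathbf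 P[T_1+\dots+T_m\le ma]}{m}\in[0,\infty]\quad(a\ge1),\qquad \psi(\varphi)=\sup_{0<\xi\le1}\xi\bigl(\varphi-\Lambda^*(\xi^{-1})\bigr).$$ Write $a_n\asymp b_n$ if there are constants $0<C_1,C_2<\infty$ with $C_1\le a_n/b_n\le C_2$ for all $n\ge1$. Theorem. Suppose that $\tfrac12<\gamma<1$, that $\ell$ is slowly varying at infinity, and that $U_n\asymp n^{1-\gamma}\ell(n)$. Then: (a) The limit defining $\Lambda^*(a)$ exists in $[0,\infty]$ for every $a\ge1$; $\psi$ is finite on $[0,\infty)$ and is a strictly increasing bijection from $[0,\infty)$ onto $[0,\infty)$ (with inverse $\psi^{-1}$); and $\psi(\log_2(1+\theta))<1$ for $0\le\theta\le1$. (b) For every $\theta\in[0,1]$, $\mathbf Q_\theta$-almost surely $$\widehat R(X)=\max\Bigl\{\frac{1-\gamma}{1-\psi(\varphi)},\,1\Bigr\}.$$ (c) The function $x\mapsto\psi^{-1}\bigl(1-(1-\gamma)/\widehat R(x)\bigr)$ of the observed sequence (with any fixed value where it is undefined) is measurable, it does not depend on $\theta$, and for every $\theta\in[0,1]$ with $\varphi\ge\psi^{-1}(\gamma)$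 (equivalently, $\theta\ge2^{\psi^{-1}(\gamma)}-1$) one has, $\mathbf Q_\theta$-almost surely, $$\varphi=\psi^{-1}\Bigl(1-\frac{1-\gamma}{\widehat R(X)}\Bigr),\qquad \theta=2^{\psi^{-1}(1-(1-\gamma)/\widehat R(X))}-1 .$$ (d) If $u_1=\max\{u_i:i\ge1\}$, then this threshold is strictly smaller than $2^\gamma/\max\{u_i:i\ge1\}-1$: $$2^{\psi^{-1}(\gamma)}-1<\frac{2^\gamma}{u_1}-1 .$$ (e) In general there is a measurable function $g$ on $\mathbf R^{\{0,1,2,\dots\}}$ such that for every $\theta\in[0,1]$ with $\theta>2^\gamma/\sup\{u_i:i\ge1\}-1$, one has $\theta=g(X)$ $\mathbf Q_\theta$-almost surely. -/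

import Mathlib

open MeasureTheory Filter Topology Set
open scoped ENNReal NNReal

noncomputable section

namespace RandomCoin

/-! ### Renewal measures -/

/-- The space `{0,1}^∞` of binary sequences; `δ n = true` means that there is a renewal at time `n`.
It carries the product sigma-field. -/
abbrev BinSeq : Type := ℕ → Bool

/-- The event `Δ_n = 1`. -/
def renewalAt (n : ℕ) : Set BinSeq := {δ | δ n = true}

/-- `u_n = P[Δ_n = 1]`. -/
def u (P : Measure BinSeq) (n : ℕ) : ℝ := P.real (renewalAt n)

/-- `U_n = u_0 + ... + u_n`. -/
def U (P : Measure BinSeq) (n : ℕ) : ℝ := ∑ k ∈ Finset.range (n + 1), u P k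

/-- `P` is a renewal measure: a probability measure on `{0,1}^∞` such that, for all
`0 = t 0 < t 1 < ... < t m`,
`P[Δ_{t 0} = 1, ..., Δ_{t m} = 1] = ∏_{i=1}^m u_{t i - t (i-1)}`. -/
structure IsRenewalMeasure (P : Measure BinSeq) : Prop where
  isProbabilityMeasure : IsProbabilityMeasure P
  renewal : ∀ (m : ℕ) (t : ℕ → ℕ), t 0 = 0 → StrictMono t →
    P.real (⋂ i ∈ Finset.range (m + 1), renewalAt (t i)) =
      ∏ i ∈ Finset.range m, u P (t (i + 1) - t i)

/-- The time `S_k` of the `k`-th renewal: `S_0 = 0` and `S_{k+1}` is the infimum of the renewal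
times after `S_k` (`⊤` if there are none). -/
def S (δ : BinSeq) : ℕ → ℕ∞
  | 0 => 0
  | k + 1 => ⨅ (m : ℕ) (_ : S δ k < (m : ℕ∞) ∧ δ m = true), (m : ℕ∞)

/-- The inter-arrival times `T_k = S_k - S_{k-1}`, `k ≥ 1`. -/
def T (δ : BinSeq) (k : ℕ) : ℕ∞ := S δ k - S δ (k - 1)

/-! ### The rate function and `ψ` -/

/-- `-log₂ P[T_1 + ... + T_m ≤ m a] / m`, an extended real (`⊤` if the probability is `0`). -/
def rateSeq (P : Measure BinSeq) (a : ℝ) (m : ℕ) : EReal :=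
  -ENNReal.log (P {δ | ((∑ k ∈ Finset.Icc 1 m, T δ k : ℕ∞) : ℝ≥0∞) ≤ ENNReal.ofReal (m * a)})
    / (((m : ℝ) * Real.log 2 : ℝ) : EReal)

/-- The rate `Λ*(a) = lim_m -log₂ P[T_1 + ... + T_m ≤ m a] / m`. It is written as a `limsup`, which
is the limit whenever the limit exists. -/
def rate (P : Measure BinSeq) (a : ℝ) : EReal := limsup (rateSeq P a) atTop

/-- `ψ̂(φ, ξ) = ξ (φ - Λ*(1/ξ))`. -/
def psiHat (P : Measure BinSeq) (φ ξ : ℝ) : EReal :=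
  (ξ : EReal) * ((φ : EReal) - rate P ξ⁻¹)

/-- `ψ(φ) = sup_{0 < ξ ≤ 1} ψ̂(φ, ξ)` as an extended real. -/
def psiExt (P : Measure BinSeq) (φ : ℝ) : EReal := ⨆ ξ ∈ Ioc (0 : ℝ) 1, psiHat P φ ξ

/-- `ψ(φ)` as a real number. -/
def psi (P : Measure BinSeq) (φ : ℝ) : ℝ := (psiExt P φ).toReal

/-- The inverse of `ψ : [0,∞) → [0,∞)`. -/
def psiInv (P : Measure BinSeq) : ℝ → ℝ := Function.invFunOn (psi P) (Ici 0)

/-! ### Coin tosses -/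

/-- A coin toss with bias `θ`: the law on `{-1, 1}` with mean `θ`. -/
def coin (θ : ℝ) : Measure ℝ :=
  ENNReal.ofReal ((1 + θ) / 2) • Measure.dirac 1 + ENNReal.ofReal ((1 - θ) / 2) • Measure.dirac (-1)

theorem isProbabilityMeasure_coin {θ : ℝ} (h : θ ∈ Icc (-1 : ℝ) 1) :
    IsProbabilityMeasure (coin θ) := by
  constructor
  have h1 : (0 : ℝ) ≤ (1 + θ) / 2 := by linarith [h.1]
  have h2 : (0 : ℝ) ≤ (1 - θ) / 2 := by linarith [h.2]
  have h3 : (1 + θ) / 2 + (1 - θ) / 2 = 1 := by ring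
  simp [coin, ← ENNReal.ofReal_add h1 h2, h3]

/-- The sample space of `(y, z, δ)`. -/
abbrev Sample : Type := (ℕ → ℝ) × (ℕ → ℝ) × BinSeq

/-- `Q_θ`: fair coins `Y_n`, coins `Z_n` of bias `θ`, and a renewal process with law `P`, all
independent. -/
def Q (P : Measure BinSeq) (θ : ℝ) : Measure Sample :=
  (Measure.infinitePi fun _ : ℕ => coin 0).prod ((Measure.infinitePi fun _ : ℕ => coin θ).prod P)

/-- The observations `X_n = (1 - Δ_n) Y_n + Δ_n Z_n`. -/
def X (ω : Sample) (n : ℕ) : ℝ := if ω.2.2 n = true then ω.2.1 n else ω.1 n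

/-- `R_n = sup {m : x_{n+1} = ... = x_{n+m} = 1}`, the length of the run of heads starting at
time `n + 1`. -/
def R (x : ℕ → ℝ) (n : ℕ) : ℕ∞ := ⨆ (m : ℕ) (_ : ∀ j ∈ Finset.Icc 1 m, x (n + j) = 1), (m : ℕ∞)

/-- `R̂(x) = limsup_n R_n / log₂ n`. -/
def Rhat (x : ℕ → ℝ) : ℝ≥0∞ :=
  limsup (fun n : ℕ => ((R x n : ℕ∞) : ℝ≥0∞) / ENNReal.ofReal (Real.logb 2 n)) atTop

/-- `ψ⁻¹(1 - (1 - γ) / R̂(x))`, the estimator of `φ = log₂ (1 + θ)`. -/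
def phiEstimator (P : Measure BinSeq) (γ : ℝ) (x : ℕ → ℝ) : ℝ :=
  psiInv P (1 - (1 - γ) / (Rhat x).toReal)

/-! ### Growth conditions -/

/-- `a_n ≍ b_n`. -/
def Asymp (a b : ℕ → ℝ) : Prop :=
  ∃ C₁ C₂ : ℝ, 0 < C₁ ∧ 0 < C₂ ∧ ∀ n : ℕ, 1 ≤ n → C₁ ≤ a n / b n ∧ a n / b n ≤ C₂

/-- Slow variation at infinity. -/
structure SlowlyVarying (ℓ : ℝ → ℝ) : Prop where
  measurable : Measurable ℓ
  pos : ∀ᶠ t in atTop, 0 < ℓ t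
  tendsto : ∀ c : ℝ, 0 < c → Tendsto (fun t => ℓ (c * t) / ℓ t) atTop (𝓝 1)

end RandomCoin

end

/-!
# Longest runs of heads and the bias of coins tossed at renewals

Write `φ = log₂ (1 + θ)`, `S_k` for the renewal times and `T_1 = S_1`. The only consequence of the
growth hypothesis that matters is `U_n = n^{1-γ+o(1)}` (`HasIndex`); in particular `U_n → ∞`, so
that the process is recurrent.

*The function `ψ`.* By regeneration, `P[S_k ≤ a] P[S_l ≤ b] ≤ P[S_{k+l} ≤ a + b]`, so Fekete's lemma
gives the existence of `Λ*(a)` (`tendsto_rateSeq_and_le`). Then `ψ` is the inverse function of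
`Φ(s) = -log₂ E[2^{-s T_1}]`, a continuous increasing bijection of `[0,∞)` (`psiExt_logGen`): the
Chernoff bound gives `ψ(Φ(s)) ≤ s`, while `2^{φ k} P[S_k ≤ n] ≤ 2^{w n}` for all `k ≤ n` would make
the series `∑_k (2^φ E[2^{-s T_1}])^k` converge for every `s > w` (`mul_gen_lt_one`). All the
properties of `ψ` can be read off from `Φ`: `ψ(φ) < 1` for `φ ≤ 1` because `Φ(1) > 1`, and
`2^{ψ⁻¹(γ)} = 1 / E[2^{-γ T_1}] < 2^γ / u_1`, both since `T_1` is not identically `1`.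

*Longest runs.* Given the renewals, a window of length `m` with `N` of them is a run of heads with
probability `2^{-m} (1+θ)^N`.

* Upper bound (`ae_Rhat_le`): `E[(1+θ)^N] ≤ (m + 1) 2^{ψ(φ) m}` for a window that starts at a
  renewal, and there are on average `U_n` renewals up to time `n`. Hence about
  `n 2^{-m} + U_n 2^{-(1-ψ(φ)) m}` runs of length `m` are expected before time `n`, and
  Borel–Cantelli along powers of two applies.
* Lower bound (`ae_le_Rhat`, `ae_le_Rhat_of_lt_one`): the windows of length `m` starting at every
  `m`-th renewal are disjoint and independent, and each succeeds with probability at least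
  `C 2^{-(1-w) m}` for any `w < ψ(φ)` (`exists_rpow_le_rpow_mul_cum`). Enough of them start before
  time `n` because `P[S_k > n] ≤ 4 k / U_n` (`one_sub_cum_le`). Ordinary windows give `R̂ ≥ 1`.

*Reconstruction.* It follows that the estimator of `φ` is almost surely equal to `max(φ, ψ⁻¹(γ))`
(`ae_phiEstimator_eq`), hence to `φ` above the threshold. For the last claim, observe the process at
the multiples of `d`, for each `d` with `u_d > 0`. This is a renewal process with the same index `γ`
(`hasIndex_map_decimate`), whose threshold is less than `2^γ / u_d - 1`. Each of these estimators is
almost surely at least `φ`, and one of them equals `φ` if `θ > 2^γ / sup u - 1`; so their infimum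
recovers `φ`.
-/

noncomputable section

namespace RandomCoin

/-! ### The regeneration property -/

/-- The process seen from time `n` on. -/
def shift (n : ℕ) (δ : BinSeq) : BinSeq := fun i => δ (n + i)

/-- The process up to time `n`: all later renewals are erased, so that an event or functional
depends only on the times `≤ n` exactly when it is unchanged by `trunc n`. -/
def trunc (n : ℕ) (δ : BinSeq) : BinSeq := fun i => δ i && decide (i ≤ n)

/-- The event that there is a renewal at each time in `F`. These events form a π-system generating
the product sigma-field. -/
def onesOn (F : Finset ℕ) : Set BinSeq := {δ | ∀ i ∈ F, δ i = true}

theorem measurable_shift (n : ℕ) : Measurable (shift n) :=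
  measurable_pi_lambda _ fun i => measurable_pi_apply (n + i)

theorem measurable_trunc (n : ℕ) : Measurable (trunc n) :=
  measurable_pi_lambda _ fun i =>
    (measurable_of_countable fun b : Bool => b && decide (i ≤ n)).comp (measurable_pi_apply i)

theorem measurableSet_renewalAt (n : ℕ) : MeasurableSet (renewalAt n) :=
  (measurable_pi_apply (X := fun _ : ℕ => Bool) n) (measurableSet_singleton true)

theorem onesOn_eq_biInter (F : Finset ℕ) : onesOn F = ⋂ i ∈ F, renewalAt i := by
  ext δ; simp [onesOn, renewalAt]

theorem measurableSet_onesOn (F : Finset ℕ) : MeasurableSet (onesOn F) := by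
  rw [onesOn_eq_biInter]
  exact F.measurableSet_biInter fun i _ => measurableSet_renewalAt i

theorem onesOn_inter (F G : Finset ℕ) : onesOn F ∩ onesOn G = onesOn (F ∪ G) := by
  ext δ
  simp only [onesOn, mem_inter_iff, mem_ofPred_eq, Finset.mem_union]
  exact ⟨fun h i hi => hi.elim (h.1 i) (h.2 i), fun h => ⟨fun i hi => h i (.inl hi),
    fun i hi => h i (.inr hi)⟩⟩

theorem isPiSystem_onesOn : IsPiSystem (range onesOn) := by
  rintro _ ⟨F, rfl⟩ _ ⟨G, rfl⟩ -
  exact ⟨F ∪ G, (onesOn_inter F G).symm⟩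

theorem generateFrom_onesOn :
    (MeasurableSpace.pi : MeasurableSpace BinSeq) = MeasurableSpace.generateFrom (range onesOn) := by
  apply le_antisymm
  · refine iSup_le fun i => ?_
    rw [← measurable_iff_comap_le]
    refine @measurable_to_bool _ (MeasurableSpace.generateFrom (range onesOn)) _ ?_
    refine MeasurableSpace.measurableSet_generateFrom ⟨{i}, ?_⟩
    ext δ; simp [onesOn]
  · refine MeasurableSpace.generateFrom_le ?_
    rintro _ ⟨F, rfl⟩
    exact measurableSet_onesOn F

/-- A finite set of times containing `0` is the initial segment of a strictly increasing
sequence. -/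
theorem exists_strictMono_image (F : Finset ℕ) (h0 : 0 ∈ F) :
    ∃ (m : ℕ) (t : ℕ → ℕ), t 0 = 0 ∧ StrictMono t ∧ F = (Finset.range (m + 1)).image t := by
  induction F using Finset.induction_on_max with
  | empty => simp at h0
  | insert a F ha ih =>
    by_cases hF : 0 ∈ F
    · obtain ⟨m, t, ht0, ht, rfl⟩ := ih hF
      have hm : t m < a := ha _ (Finset.mem_image_of_mem _ (by simp))
      refine ⟨m + 1, fun i => if i ≤ m then t i else a + (i - m - 1), by simp [ht0], ?_, ?_⟩
      · refine strictMono_nat_of_lt_succ fun i => ?_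
        rcases lt_trichotomy i m with h | h | h
        · have h1 : i + 1 ≤ m := h
          simpa [h.le, h1] using ht (Nat.lt_succ_self i)
        · subst h; simpa using hm
        · have h1 : ¬ i ≤ m := by omega
          have h2 : ¬ i + 1 ≤ m := by omega
          simp only [h1, h2, if_false]; omega
      · rw [Finset.range_add_one (n := m + 1), Finset.image_insert]
        refine congrArg₂ _ ?_ ?_
        · simp
        · refine Finset.image_congr fun i hi => ?_
          have : i ≤ m := by simpa [Nat.lt_succ_iff] using hi
          simp [this]
    · have ha0 : a = 0 := by
        rcases Finset.mem_insert.1 h0 with h | h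
        · exact h.symm
        · exact absurd h hF
      have : F = ∅ := Finset.eq_empty_of_forall_notMem fun x hx => by
        have := ha x hx; omega
      subst this ha0
      exact ⟨0, id, rfl, strictMono_id, by simp⟩

section

variable {P : Measure BinSeq}

theorem IsRenewalMeasure.real_onesOn_image (hP : IsRenewalMeasure P) {m : ℕ} {t : ℕ → ℕ}
    (h0 : t 0 = 0) (ht : StrictMono t) :
    P.real (onesOn ((Finset.range (m + 1)).image t)) =
      ∏ i ∈ Finset.range m, u P (t (i + 1) - t i) := by
  rw [← hP.renewal m t h0 ht]
  congr 1
  ext δ; simp [onesOn, renewalAt]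

theorem IsRenewalMeasure.ae_zero (hP : IsRenewalMeasure P) : ∀ᵐ δ ∂P, δ 0 = true := by
  have := hP.isProbabilityMeasure
  have h := hP.real_onesOn_image (m := 0) (t := id) rfl strictMono_id
  have h1 : P (renewalAt 0) = 1 := by
    have h2 : P.real (renewalAt 0) = 1 := by simpa [onesOn, renewalAt] using h
    rw [measureReal_def] at h2
    rw [← ENNReal.ofReal_toReal (measure_ne_top P _), h2, ENNReal.ofReal_one]
  exact (prob_compl_eq_zero_iff (measurableSet_renewalAt 0)).2 h1

theorem IsRenewalMeasure.onesOn_insert_zero (hP : IsRenewalMeasure P) (F : Finset ℕ) :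
    P (onesOn (insert 0 F)) = P (onesOn F) := by
  refine measure_congr ?_
  filter_upwards [hP.ae_zero] with δ hδ
  apply propext
  change (∀ i ∈ insert 0 F, δ i = true) ↔ (∀ i ∈ F, δ i = true)
  simp [hδ]

/-- Regeneration for cylinder events: the defining product over the joined sequence of times
factorizes at the time `n`. -/
theorem IsRenewalMeasure.onesOn_regeneration_aux (hP : IsRenewalMeasure P) {n : ℕ}
    {F G : Finset ℕ} (hF0 : 0 ∈ F) (hFn : n ∈ F) (hF : ∀ i ∈ F, i ≤ n) (hG : 0 ∈ G) :
    P (onesOn (F ∪ G.image (n + ·))) = P (onesOn F) * P (onesOn G) := by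
  have := hP.isProbabilityMeasure
  obtain ⟨m, t, ht0, ht, rfl⟩ := exists_strictMono_image F hF0
  obtain ⟨l, s, hs0, hs, rfl⟩ := exists_strictMono_image G hG
  have hm : t m = n := by
    apply le_antisymm (hF _ (Finset.mem_image_of_mem _ (by simp)))
    obtain ⟨i, hi, rfl⟩ := Finset.mem_image.1 hFn
    exact ht.monotone (by simpa [Nat.lt_succ_iff] using hi)
  set r : ℕ → ℕ := fun i => if i ≤ m then t i else n + s (i - m) with hr
  have hr1 : ∀ i, i ≤ m → r i = t i := fun i hi => by simp [hr, hi]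
  have hr2 : ∀ i, r (m + i) = n + s i := fun i => by
    rcases Nat.eq_zero_or_pos i with h | h
    · subst h; simp [hr, hs0, hm]
    · have : ¬ m + i ≤ m := by omega
      simp [hr, this]
  have hr0 : r 0 = 0 := by simp [hr, ht0]
  have hrm : StrictMono r := by
    refine strictMono_nat_of_lt_succ fun i => ?_
    rcases lt_or_ge i m with h | h
    · rw [hr1 _ h.le, hr1 _ h]; exact ht (Nat.lt_succ_self i)
    · obtain ⟨j, rfl⟩ := Nat.exists_eq_add_of_le h
      rw [hr2, add_assoc, hr2]
      have : s j < s (j + 1) := hs (Nat.lt_succ_self j)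
      omega
  have himg : (Finset.range (m + 1)).image t ∪ ((Finset.range (l + 1)).image s).image (n + ·)
      = (Finset.range (m + l + 1)).image r := by
    ext x
    simp only [Finset.mem_union, Finset.mem_image, Finset.mem_range, exists_exists_and_eq_and]
    constructor
    · rintro (⟨i, hi, rfl⟩ | ⟨i, hi, rfl⟩)
      · exact ⟨i, by omega, hr1 i (by omega)⟩
      · exact ⟨m + i, by omega, hr2 i⟩
    · rintro ⟨i, hi, rfl⟩
      rcases le_or_gt i m with h | h
      · exact .inl ⟨i, by omega, (hr1 i h).symm⟩
      · obtain ⟨j, rfl⟩ := Nat.exists_eq_add_of_le h.le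
        exact .inr ⟨j, by omega, (hr2 j).symm⟩
  have key : P.real (onesOn ((Finset.range (m + 1)).image t ∪
      ((Finset.range (l + 1)).image s).image (n + ·))) =
      P.real (onesOn ((Finset.range (m + 1)).image t)) *
      P.real (onesOn ((Finset.range (l + 1)).image s)) := by
    rw [himg, hP.real_onesOn_image hr0 hrm, hP.real_onesOn_image ht0 ht,
      hP.real_onesOn_image hs0 hs, Finset.prod_range_add]
    congr 1
    · refine Finset.prod_congr rfl fun i hi => ?_
      have := Finset.mem_range.1 hi
      rw [hr1 _ this, hr1 _ this.le]
    · refine Finset.prod_congr rfl fun i _ => ?_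
      rw [add_assoc, hr2, hr2, Nat.add_sub_add_left]
  simp only [measureReal_def, ← ENNReal.toReal_mul] at key
  exact (ENNReal.toReal_eq_toReal_iff' (measure_ne_top _ _)
    (ENNReal.mul_ne_top (measure_ne_top _ _) (measure_ne_top _ _))).1 key

theorem IsRenewalMeasure.onesOn_regeneration (hP : IsRenewalMeasure P) {n : ℕ}
    {F : Finset ℕ} (G : Finset ℕ) (hF : ∀ i ∈ F, i ≤ n) :
    P (onesOn F ∩ renewalAt n ∩ shift n ⁻¹' onesOn G) =
      P (onesOn F ∩ renewalAt n) * P (onesOn G) := by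
  have h1 : onesOn F ∩ renewalAt n ∩ shift n ⁻¹' onesOn G =
      onesOn (insert n F ∪ (insert 0 G).image (n + ·)) := by
    ext δ
    simp only [onesOn, renewalAt, shift, mem_inter_iff, mem_ofPred_eq, mem_preimage,
      Finset.mem_union, Finset.mem_insert, Finset.mem_image]
    constructor
    · rintro ⟨⟨h1, h2⟩, h3⟩ i ((rfl | h) | ⟨j, (rfl | hj), rfl⟩)
      · exact h2
      · exact h1 i h
      · exact h2
      · exact h3 j hj
    · intro h
      exact ⟨⟨fun i hi => h i (.inl (.inr hi)), h n (.inl (.inl rfl))⟩,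
        fun j hj => h _ (.inr ⟨j, .inr hj, rfl⟩)⟩
  have h2 : onesOn F ∩ renewalAt n = onesOn (insert n F) := by
    ext δ; simp [onesOn, renewalAt, and_comm]
  rw [h1, h2, ← hP.onesOn_insert_zero, ← hP.onesOn_insert_zero (insert n F),
    ← hP.onesOn_insert_zero G, ← Finset.insert_union]
  refine hP.onesOn_regeneration_aux (by simp) (by simp) ?_ (by simp)
  intro i hi
  simp only [Finset.mem_insert] at hi
  rcases hi with rfl | rfl | h
  · exact Nat.zero_le _
  · exact le_rfl
  · exact hF i h

/-- Regeneration: on the event of a renewal at time `n`, the process up to time `n` is independent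
of the process from time `n` on, and the latter has law `P`. -/
theorem IsRenewalMeasure.map_trunc_shift (hP : IsRenewalMeasure P) (n : ℕ) :
    (P.restrict (renewalAt n)).map (fun δ => (trunc n δ, shift n δ)) =
      ((P.restrict (renewalAt n)).map (trunc n)).prod P := by
  have := hP.isProbabilityMeasure
  have hm : IsFiniteMeasure ((P.restrict (renewalAt n)).map (trunc n)) :=
    Measure.isFiniteMeasure_map _ _
  have huniv : onesOn ∅ = univ := by ext; simp [onesOn]
  have hspan : ∀ (μ : Measure BinSeq) [IsFiniteMeasure μ], μ.FiniteSpanningSetsIn (range onesOn) :=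
    fun μ _ => ⟨fun _ => univ, fun _ => ⟨∅, huniv⟩, fun _ => measure_lt_top _ _, iUnion_const _⟩
  refine (Measure.prod_eq_generateFrom generateFrom_onesOn.symm generateFrom_onesOn.symm
    isPiSystem_onesOn isPiSystem_onesOn (hspan _) (hspan _) ?_).symm
  rintro _ ⟨F, rfl⟩ _ ⟨G, rfl⟩
  have hmeas : Measurable fun δ : BinSeq => (trunc n δ, shift n δ) :=
    (measurable_trunc n).prodMk (measurable_shift n)
  rw [Measure.map_apply hmeas ((measurableSet_onesOn F).prod (measurableSet_onesOn G)),
    Measure.map_apply (measurable_trunc n) (measurableSet_onesOn F),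
    Measure.restrict_apply (hmeas ((measurableSet_onesOn F).prod (measurableSet_onesOn G))),
    Measure.restrict_apply (measurable_trunc n (measurableSet_onesOn F))]
  by_cases hF : ∀ i ∈ F, i ≤ n
  · have h1 : trunc n ⁻¹' onesOn F = onesOn F := by
      ext δ
      simp only [trunc, onesOn, mem_preimage, mem_ofPred_eq, Bool.and_eq_true, decide_eq_true_eq]
      exact ⟨fun h i hi => (h i hi).1, fun h i hi => ⟨h i hi, hF i hi⟩⟩
    rw [h1, ← hP.onesOn_regeneration G hF]
    congr 1
    ext δ
    have h2 : trunc n δ ∈ onesOn F ↔ δ ∈ onesOn F := by rw [← mem_preimage, h1]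
    simp only [mem_inter_iff, mem_preimage, mem_prod, h2]
    tauto
  · push Not at hF
    obtain ⟨i, hi, hin⟩ := hF
    have h1 : trunc n ⁻¹' onesOn F = ∅ := by
      ext δ
      simp only [trunc, onesOn, mem_preimage, mem_ofPred_eq, Bool.and_eq_true, decide_eq_true_eq,
        mem_empty_iff_false, iff_false]
      intro h
      have := (h i hi).2
      omega
    have h2 : (fun δ => (trunc n δ, shift n δ)) ⁻¹' onesOn F ×ˢ onesOn G = ∅ := by
      ext δ
      have : trunc n δ ∉ onesOn F := fun h => by
        have : δ ∈ trunc n ⁻¹' onesOn F := h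
        simp [h1] at this
      simp [this]
    simp [h1, h2]

/-- Regeneration at time `n`, for functionals of the past and of the future. -/
theorem IsRenewalMeasure.lintegral_regeneration (hP : IsRenewalMeasure P) (n : ℕ)
    {a g : BinSeq → ℝ≥0∞} (ha : Measurable a) (hg : Measurable g)
    (han : ∀ δ, a (trunc n δ) = a δ) :
    ∫⁻ δ in renewalAt n, a δ * g (shift n δ) ∂P = (∫⁻ δ in renewalAt n, a δ ∂P) * ∫⁻ δ, g δ ∂P := by
  have := hP.isProbabilityMeasure
  have hm : IsFiniteMeasure ((P.restrict (renewalAt n)).map (trunc n)) :=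
    Measure.isFiniteMeasure_map _ _
  have h := lintegral_prod_mul (μ := (P.restrict (renewalAt n)).map (trunc n)) (ν := P)
    ha.aemeasurable hg.aemeasurable
  have h1 : Measurable fun z : BinSeq × BinSeq => a z.1 * g z.2 := by fun_prop
  rw [← hP.map_trunc_shift n, lintegral_map h1
    ((measurable_trunc n).prodMk (measurable_shift n)), lintegral_map ha (measurable_trunc n)] at h
  simpa only [han] using h

theorem IsRenewalMeasure.regeneration (hP : IsRenewalMeasure P) (n : ℕ)
    {A B : Set BinSeq} (hA : MeasurableSet A) (hB : MeasurableSet B)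
    (hAn : ∀ δ, trunc n δ ∈ A ↔ δ ∈ A) :
    P (A ∩ renewalAt n ∩ shift n ⁻¹' B) = P (A ∩ renewalAt n) * P B := by
  have h := hP.lintegral_regeneration n (a := A.indicator 1) (g := B.indicator 1)
    (measurable_one.indicator hA) (measurable_one.indicator hB) (fun δ => by
      by_cases h : δ ∈ A <;> simp [indicator, hAn, h])
  rw [lintegral_indicator_one hB, lintegral_indicator_one hA, Measure.restrict_apply hA] at h
  rw [← h, ← lintegral_indicator_one ((hA.inter (measurableSet_renewalAt n)).inter
    (measurable_shift n hB)), ← lintegral_indicator (measurableSet_renewalAt n)]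
  refine lintegral_congr fun δ => ?_
  simp only [indicator, mem_inter_iff, mem_preimage, Pi.one_apply]
  split_ifs <;> simp_all

end

/-! ### Counting renewals -/

/-- The number of renewals in `[1, n]`. -/
def cnt (δ : BinSeq) (n : ℕ) : ℕ := Nat.count (fun i => δ (i + 1) = true) n

@[simp] theorem cnt_zero (δ : BinSeq) : cnt δ 0 = 0 := Nat.count_zero _

theorem cnt_succ (δ : BinSeq) (n : ℕ) :
    cnt δ (n + 1) = cnt δ n + if δ (n + 1) = true then 1 else 0 := Nat.count_succ _ _

theorem cnt_mono (δ : BinSeq) : Monotone (cnt δ) := Nat.count_monotone _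

theorem cnt_le (δ : BinSeq) (n : ℕ) : cnt δ n ≤ n := Nat.count_le _

theorem cnt_add (δ : BinSeq) (n j : ℕ) : cnt δ (n + j) = cnt δ n + cnt (shift n δ) j :=
  Nat.count_add _ _ _

theorem cnt_trunc (δ : BinSeq) {n j : ℕ} (h : j ≤ n) : cnt (trunc n δ) j = cnt δ j := by
  induction j with
  | zero => simp
  | succ j ih => rw [cnt_succ, cnt_succ, ih (by omega)]; simp [trunc, h]

theorem measurable_cnt (n : ℕ) : Measurable fun δ => cnt δ n := by
  induction n with
  | zero => simp only [cnt_zero]; exact measurable_const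
  | succ n ih =>
    simp only [cnt_succ]
    exact ih.add (Measurable.ite (measurableSet_renewalAt (n + 1)) measurable_const
      measurable_const)

theorem cnt_lt_cnt {δ : BinSeq} {i j : ℕ} (h : i < j) (hj : δ j = true) : cnt δ i < cnt δ j := by
  obtain ⟨j, rfl⟩ : ∃ l, j = l + 1 := ⟨j - 1, by omega⟩
  rw [cnt_succ, if_pos hj]
  exact Nat.lt_succ_of_le (cnt_mono δ (by omega))

theorem exists_cnt_eq {δ : BinSeq} {k n : ℕ} (h0 : k = 0 → δ 0 = true) (h : k ≤ cnt δ n) :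
    ∃ i ≤ n, cnt δ i = k ∧ δ i = true := by
  induction n with
  | zero => exact ⟨0, le_rfl, by simp at h; simp [h], h0 (by simpa using h)⟩
  | succ n ih =>
    by_cases hk : k ≤ cnt δ n
    · obtain ⟨i, hi, h1⟩ := ih hk
      exact ⟨i, by omega, h1⟩
    · rw [cnt_succ] at h
      by_cases hd : δ (n + 1) = true
      · exact ⟨n + 1, le_rfl, by rw [cnt_succ]; simp only [hd, if_true] at h ⊢; omega, hd⟩
      · simp [hd] at h; omega

/-- The `k`-th renewal time is at most `n` exactly when there are at least `k` renewals in `[1, n]`;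
this turns all statements about renewal times into statements about counts. -/
theorem S_le_iff (δ : BinSeq) (k n : ℕ) : S δ k ≤ (n : ℕ∞) ↔ k ≤ cnt δ n := by
  induction k generalizing n with
  | zero => simp [S]
  | succ k ih =>
    have h1 : S δ (k + 1) ≤ (n : ℕ∞) ↔ ∃ m ≤ n, S δ k < (m : ℕ∞) ∧ δ m = true := by
      rw [S]
      constructor
      · intro h
        by_contra hc
        push Not at hc
        have : ((n + 1 : ℕ) : ℕ∞) ≤ ⨅ (m : ℕ) (_ : S δ k < (m : ℕ∞) ∧ δ m = true), (m : ℕ∞) := by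
          refine le_iInf₂ fun m hm => ?_
          rw [Nat.cast_le]
          by_contra hmn
          exact hc m (by omega) hm.1 hm.2
        have := this.trans h
        rw [Nat.cast_le] at this
        omega
      · rintro ⟨m, hm, h⟩
        exact (iInf₂_le m h).trans (by exact_mod_cast hm)
    have h2 : ∀ m : ℕ, S δ k < ((m + 1 : ℕ) : ℕ∞) ↔ k ≤ cnt δ m := fun m => by
      rw [← ih, Nat.cast_add, Nat.cast_one, ENat.lt_natCast_add_one_iff]
    rw [h1]
    constructor
    · rintro ⟨m, hm, hS, hd⟩
      obtain ⟨m, rfl⟩ : ∃ l, m = l + 1 := ⟨m - 1, by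
        have : m ≠ 0 := by rintro rfl; simp at hS
        omega⟩
      rw [h2] at hS
      exact lt_of_le_of_lt hS (lt_of_lt_of_le (cnt_lt_cnt (Nat.lt_succ_self m) hd)
        (cnt_mono δ hm))
    · intro h
      clear h1
      induction n with
      | zero => simp at h
      | succ n ihn =>
        by_cases hk : k + 1 ≤ cnt δ n
        · obtain ⟨m, hm, h⟩ := ihn hk
          exact ⟨m, by omega, h⟩
        · rw [cnt_succ] at h
          by_cases hd : δ (n + 1) = true
          · refine ⟨n + 1, le_rfl, (h2 n).2 ?_, hd⟩
            simp only [hd, if_true] at h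
            omega
          · simp [hd] at h; omega

theorem S_eq_iff {δ : BinSeq} (h0 : δ 0 = true) (k n : ℕ) :
    S δ k = (n : ℕ∞) ↔ cnt δ n = k ∧ δ n = true := by
  have h1 : S δ k = (n : ℕ∞) ↔ k ≤ cnt δ n ∧ ∀ j < n, cnt δ j < k := by
    rw [← S_le_iff]
    constructor
    · intro h
      refine ⟨h.le, fun j hj => ?_⟩
      by_contra hc
      rw [not_lt, ← S_le_iff, h, Nat.cast_le] at hc
      omega
    · rintro ⟨h, h'⟩
      refine le_antisymm h ?_
      by_contra hc
      rw [not_le] at hc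
      obtain ⟨j, hj⟩ := ENat.ne_top_iff_exists.1 (hc.trans_le le_top).ne
      rw [← hj, Nat.cast_lt] at hc
      have := h' j hc
      rw [← not_le, ← S_le_iff, hj] at this
      exact this le_rfl
  rw [h1]
  constructor
  · rintro ⟨h, h'⟩
    obtain ⟨i, hi, h2, h3⟩ := exists_cnt_eq (fun _ => h0) h
    rcases hi.lt_or_eq with hi | rfl
    · exact absurd h2 (h' i hi).ne
    · exact ⟨h2, h3⟩
  · rintro ⟨rfl, h⟩
    exact ⟨le_rfl, fun j hj => cnt_lt_cnt hj h⟩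

/-- The event that there is a renewal at time `n`, the `k`-th one. -/
def hit (k n : ℕ) : Set BinSeq := {δ | cnt δ n = k} ∩ renewalAt n

theorem measurableSet_cnt_eq (k n : ℕ) : MeasurableSet {δ : BinSeq | cnt δ n = k} :=
  measurable_cnt n (measurableSet_singleton k)

theorem measurableSet_hit (k n : ℕ) : MeasurableSet (hit k n) :=
  (measurableSet_cnt_eq k n).inter (measurableSet_renewalAt n)

theorem measurableSet_le_cnt (k n : ℕ) : MeasurableSet {δ : BinSeq | k ≤ cnt δ n} :=
  measurable_cnt n measurableSet_Ici

theorem disjoint_hit (k : ℕ) {i j : ℕ} (h : i ≠ j) : Disjoint (hit k i) (hit k j) := by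
  rw [Set.disjoint_left]
  rintro δ ⟨h1, h2⟩ ⟨h3, h4⟩
  rcases h.lt_or_gt with h | h
  · exact absurd (h1.trans h3.symm) (cnt_lt_cnt h h4).ne
  · exact absurd (h3.trans h1.symm) (cnt_lt_cnt h h2).ne

/-- `P[S_k = n]`. -/
def pr (P : Measure BinSeq) (k n : ℕ) : ℝ := P.real (hit k n)

/-- `P[S_k ≤ n]`. -/
def cum (P : Measure BinSeq) (k n : ℕ) : ℝ := P.real {δ | k ≤ cnt δ n}

section

variable {P : Measure BinSeq}

theorem pr_nonneg (k n : ℕ) : 0 ≤ pr P k n := measureReal_nonneg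

theorem cum_nonneg (k n : ℕ) : 0 ≤ cum P k n := measureReal_nonneg

theorem pr_eq_zero_of_lt {k n : ℕ} (h : n < k) : pr P k n = 0 := by
  have : hit k n = ∅ := by
    ext δ
    simp only [hit, mem_inter_iff, mem_ofPred_eq, mem_empty_iff_false, iff_false, not_and]
    intro h1
    have := cnt_le δ n
    omega
  simp [pr, this]

namespace IsRenewalMeasure

theorem cum_le_one (hP : IsRenewalMeasure P) (k n : ℕ) : cum P k n ≤ 1 := by
  have := hP.isProbabilityMeasure
  exact measureReal_le_one

theorem cum_mono (hP : IsRenewalMeasure P) (k : ℕ) {n n' : ℕ} (h : n ≤ n') :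
    cum P k n ≤ cum P k n' := by
  have := hP.isProbabilityMeasure
  exact measureReal_mono fun δ (hδ : k ≤ cnt δ n) => hδ.trans (cnt_mono δ h)

/-- Regeneration at the `k`-th renewal time. -/
theorem real_hit_inter (hP : IsRenewalMeasure P) (k i : ℕ) {B : Set BinSeq}
    (hB : MeasurableSet B) : P.real (hit k i ∩ shift i ⁻¹' B) = pr P k i * P.real B := by
  rw [pr, measureReal_def, measureReal_def, measureReal_def, ← ENNReal.toReal_mul, hit,
    hP.regeneration i (measurableSet_cnt_eq k i) hB fun δ => by
      simp [cnt_trunc]]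

theorem real_biUnion_hit_inter (hP : IsRenewalMeasure P) (k : ℕ) (s : Finset ℕ)
    {B : ℕ → Set BinSeq} (hB : ∀ i, MeasurableSet (B i)) :
    P.real (⋃ i ∈ s, (hit k i ∩ shift i ⁻¹' B i)) = ∑ i ∈ s, pr P k i * P.real (B i) := by
  have := hP.isProbabilityMeasure
  rw [measureReal_biUnion_finset]
  · exact Finset.sum_congr rfl fun i _ => hP.real_hit_inter k i (hB i)
  · intro i _ j _ hij
    exact (disjoint_hit k hij).mono inter_subset_left inter_subset_left
  · exact fun i _ => (measurableSet_hit k i).inter (measurable_shift i (hB i))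

/-- The law of `S_{k+l}` is the convolution of those of `S_k` and `S_l`. -/
theorem pr_add (hP : IsRenewalMeasure P) (k l n : ℕ) :
    pr P (k + l) n = ∑ i ∈ Finset.range (n + 1), pr P k i * pr P l (n - i) := by
  rw [show (∑ i ∈ Finset.range (n + 1), pr P k i * pr P l (n - i)) =
    ∑ i ∈ Finset.range (n + 1), pr P k i * P.real (hit l (n - i)) from rfl,
    ← hP.real_biUnion_hit_inter k _ fun i => measurableSet_hit l (n - i), pr]
  refine measureReal_congr ?_
  filter_upwards [hP.ae_zero] with δ h0
  apply propext
  change δ ∈ hit (k + l) n ↔ δ ∈ ⋃ i ∈ Finset.range (n + 1), (hit k i ∩ shift i ⁻¹' hit l (n - i))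
  have key : ∀ i ≤ n, (shift i δ ∈ hit l (n - i) ↔ cnt δ n = cnt δ i + l ∧ δ n = true) := by
    intro i hi
    have h1 := cnt_add δ i (n - i)
    rw [Nat.add_sub_cancel' hi] at h1
    have h2 : shift i δ (n - i) = δ n := by simp [shift, Nat.add_sub_cancel' hi]
    change cnt (shift i δ) (n - i) = l ∧ shift i δ (n - i) = true ↔ _
    rw [h2, h1]
    constructor
    · rintro ⟨h, h'⟩; exact ⟨by omega, h'⟩
    · rintro ⟨h, h'⟩; exact ⟨by omega, h'⟩
  simp only [mem_iUnion, Finset.mem_range, Nat.lt_succ_iff, mem_inter_iff, mem_preimage]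
  constructor
  · rintro ⟨h1, h2⟩
    have h1 : cnt δ n = k + l := h1
    obtain ⟨i, hi, h3, h4⟩ := exists_cnt_eq (n := n) (fun _ => h0) (show k ≤ cnt δ n by omega)
    exact ⟨i, hi, ⟨h3, h4⟩, (key i hi).2 ⟨by omega, h2⟩⟩
  · rintro ⟨i, hi, ⟨h3, h4⟩, h5⟩
    have h3 : cnt δ i = k := h3
    have := (key i hi).1 h5
    exact ⟨show cnt δ n = k + l by omega, this.2⟩

theorem cum_eq_sum (hP : IsRenewalMeasure P) (k n : ℕ) :
    cum P k n = ∑ i ∈ Finset.range (n + 1), pr P k i := by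
  have := hP.isProbabilityMeasure
  have h := hP.real_biUnion_hit_inter k (Finset.range (n + 1)) (B := fun _ => univ)
    fun _ => MeasurableSet.univ
  simp only [preimage_univ, inter_univ, probReal_univ, mul_one] at h
  rw [← h, cum]
  refine measureReal_congr ?_
  filter_upwards [hP.ae_zero] with δ h0
  apply propext
  change k ≤ cnt δ n ↔ δ ∈ ⋃ i ∈ Finset.range (n + 1), hit k i
  simp only [mem_iUnion, Finset.mem_range, Nat.lt_succ_iff]
  constructor
  · intro h
    obtain ⟨i, hi, h3, h4⟩ := exists_cnt_eq (fun _ => h0) h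
    exact ⟨i, hi, h3, h4⟩
  · rintro ⟨i, hi, h3, -⟩
    have h3 : cnt δ i = k := h3
    exact h3 ▸ cnt_mono δ hi

/-- Supermultiplicativity of `P[S_k ≤ n]`, the input of Fekete's lemma. -/
theorem cum_mul_cum_le (hP : IsRenewalMeasure P) (k l a b : ℕ) :
    cum P k a * cum P l b ≤ cum P (k + l) (a + b) := by
  have := hP.isProbabilityMeasure
  rw [hP.cum_eq_sum k a, Finset.sum_mul, show (∑ i ∈ Finset.range (a + 1), pr P k i * cum P l b) =
    ∑ i ∈ Finset.range (a + 1), pr P k i * P.real {δ | l ≤ cnt δ b} from rfl,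
    ← hP.real_biUnion_hit_inter k _ fun i => measurableSet_le_cnt l b]
  refine measureReal_mono ?_
  simp only [iUnion_subset_iff, Finset.mem_range, Nat.lt_succ_iff]
  rintro i hi δ ⟨⟨h1, -⟩, h2⟩
  have h1 : cnt δ i = k := h1
  have h2 : l ≤ cnt (shift i δ) b := h2
  change k + l ≤ cnt δ (a + b)
  calc k + l ≤ cnt δ i + cnt (shift i δ) b := by omega
    _ = cnt δ (i + b) := (cnt_add _ _ _).symm
    _ ≤ _ := cnt_mono δ (by omega)

theorem pr_zero (hP : IsRenewalMeasure P) (n : ℕ) : pr P 0 n = if n = 0 then 1 else 0 := by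
  have := hP.isProbabilityMeasure
  split_ifs with h
  · subst h
    rw [pr, ← probReal_univ (μ := P)]
    refine measureReal_congr ?_
    filter_upwards [hP.ae_zero] with δ h0
    apply propext
    change (cnt δ 0 = 0 ∧ δ 0 = true) ↔ True
    simp [h0]
  · have : hit 0 n = ∅ := by
      ext δ
      simp only [hit, mem_inter_iff, mem_ofPred_eq, mem_empty_iff_false, iff_false, not_and]
      intro h1 h2
      have := cnt_lt_cnt (Nat.pos_of_ne_zero h) h2
      omega
    simp [pr, this]

theorem u_eq_sum (hP : IsRenewalMeasure P) {n N : ℕ} (h : n ≤ N) :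
    u P n = ∑ k ∈ Finset.range (N + 1), pr P k n := by
  have := hP.isProbabilityMeasure
  have h1 : renewalAt n = ⋃ k ∈ Finset.range (N + 1), hit k n := by
    ext δ
    simp only [hit, mem_iUnion, Finset.mem_range, Nat.lt_succ_iff, mem_inter_iff, mem_ofPred_eq]
    exact ⟨fun h' => ⟨cnt δ n, (cnt_le δ n).trans h, rfl, h'⟩, fun ⟨k, _, _, h'⟩ => h'⟩
  rw [u, h1, measureReal_biUnion_finset]
  · rfl
  · intro k _ l _ hkl
    refine Set.disjoint_left.2 ?_
    rintro δ ⟨h2, -⟩ ⟨h3, -⟩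
    exact hkl (h2.symm.trans h3)
  · exact fun k _ => measurableSet_hit k n

theorem u_zero (hP : IsRenewalMeasure P) : u P 0 = 1 := by
  rw [hP.u_eq_sum le_rfl]; simp [hP.pr_zero]

theorem u_one (hP : IsRenewalMeasure P) : u P 1 = pr P 1 1 := by
  rw [hP.u_eq_sum le_rfl]; simp [Finset.sum_range_succ, hP.pr_zero]

end IsRenewalMeasure

theorem u_nonneg (n : ℕ) : 0 ≤ u P n := measureReal_nonneg

theorem U_mono {m n : ℕ} (h : m ≤ n) : U P m ≤ U P n :=
  Finset.sum_le_sum_of_subset_of_nonneg (Finset.range_mono (by omega)) fun _ _ _ => u_nonneg _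

theorem IsRenewalMeasure.one_le_U (hP : IsRenewalMeasure P) (n : ℕ) : 1 ≤ U P n := by
  have : U P 0 ≤ U P n := U_mono (Nat.zero_le n)
  simpa [U, hP.u_zero] using this

end

/-! ### The generating function of the inter-arrival law -/

/-- The generating function `E[x ^ T_1]` of the inter-arrival time. -/
def gen (P : Measure BinSeq) (x : ℝ) : ℝ := ∑' n, pr P 1 n * x ^ n

section

variable {P : Measure BinSeq}

namespace IsRenewalMeasure

theorem summable_pr (hP : IsRenewalMeasure P) (k : ℕ) : Summable (pr P k) := by
  refine summable_of_sum_range_le (c := 1) (pr_nonneg k) fun n => ?_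
  rcases n with _ | n
  · simp
  · rw [← hP.cum_eq_sum]; exact hP.cum_le_one k n

theorem tsum_pr_le_one (hP : IsRenewalMeasure P) (k : ℕ) : ∑' n, pr P k n ≤ 1 := by
  refine Real.tsum_le_of_sum_range_le (pr_nonneg k) fun n => ?_
  rcases n with _ | n
  · simp
  · rw [← hP.cum_eq_sum]; exact hP.cum_le_one k n

theorem pr_mul_pow_le {x : ℝ} (h0 : 0 ≤ x) (h1 : x ≤ 1) (k n : ℕ) :
    pr P k n * x ^ n ≤ pr P k n :=
  mul_le_of_le_one_right (pr_nonneg k n) (pow_le_one₀ h0 h1)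

theorem summable_pr_mul_pow (hP : IsRenewalMeasure P) {x : ℝ} (h0 : 0 ≤ x) (h1 : x ≤ 1) (k : ℕ) :
    Summable fun n => pr P k n * x ^ n :=
  (hP.summable_pr k).of_nonneg_of_le (fun n => mul_nonneg (pr_nonneg k n) (pow_nonneg h0 n))
    (pr_mul_pow_le h0 h1 k)

/-- `E[x ^ S_k] = E[x ^ T_1] ^ k`. -/
theorem hasSum_pr_mul_pow (hP : IsRenewalMeasure P) {x : ℝ} (h0 : 0 ≤ x) (h1 : x ≤ 1) (k : ℕ) :
    HasSum (fun n => pr P k n * x ^ n) (gen P x ^ k) := by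
  refine (hP.summable_pr_mul_pow h0 h1 k).hasSum_iff.2 ?_
  induction k with
  | zero =>
    rw [tsum_eq_single 0 fun n hn => by simp [hP.pr_zero, hn]]
    simp [hP.pr_zero]
  | succ k ih =>
    have hn : ∀ k, Summable fun n => ‖pr P k n * x ^ n‖ := fun k => by
      simpa only [Real.norm_eq_abs] using (hP.summable_pr_mul_pow h0 h1 k).abs
    rw [pow_succ, ← ih, gen, tsum_mul_tsum_eq_tsum_sum_range_of_summable_norm (hn k) (hn 1)]
    refine tsum_congr fun n => ?_
    rw [hP.pr_add, Finset.sum_mul]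
    refine Finset.sum_congr rfl fun i hi => ?_
    have : i ≤ n := by simpa [Nat.lt_succ_iff] using hi
    rw [show x ^ n = x ^ i * x ^ (n - i) by rw [← pow_add, Nat.add_sub_cancel' this]]
    ring

theorem gen_nonneg {x : ℝ} (h0 : 0 ≤ x) : 0 ≤ gen P x :=
  tsum_nonneg fun n => mul_nonneg (pr_nonneg 1 n) (pow_nonneg h0 n)

theorem gen_le (hP : IsRenewalMeasure P) {x : ℝ} (h0 : 0 ≤ x) (h1 : x ≤ 1) : gen P x ≤ x := by
  calc gen P x ≤ ∑' n, pr P 1 n * x := by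
        refine (hP.summable_pr_mul_pow h0 h1 1).tsum_le_tsum (fun n => ?_)
          ((hP.summable_pr 1).mul_right x)
        rcases n with _ | n
        · simp [pr_eq_zero_of_lt]
        · refine mul_le_mul_of_nonneg_left ?_ (pr_nonneg 1 _)
          exact pow_le_of_le_one h0 h1 (by simp)
    _ = (∑' n, pr P 1 n) * x := tsum_mul_right
    _ ≤ x := mul_le_of_le_one_left h0 (hP.tsum_pr_le_one 1)

/-- The Chernoff bound. -/
theorem cum_mul_pow_le (hP : IsRenewalMeasure P) {x : ℝ} (h0 : 0 ≤ x) (h1 : x ≤ 1) (k n : ℕ) :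
    cum P k n * x ^ n ≤ gen P x ^ k := by
  rw [hP.cum_eq_sum, Finset.sum_mul]
  calc ∑ i ∈ Finset.range (n + 1), pr P k i * x ^ n
      ≤ ∑ i ∈ Finset.range (n + 1), pr P k i * x ^ i := by
        refine Finset.sum_le_sum fun i hi => mul_le_mul_of_nonneg_left ?_ (pr_nonneg k i)
        exact pow_le_pow_of_le_one h0 h1 (by simpa [Nat.lt_succ_iff] using hi)
    _ ≤ gen P x ^ k := sum_le_hasSum _ (fun i _ => mul_nonneg (pr_nonneg k i) (pow_nonneg h0 i))
        (hP.hasSum_pr_mul_pow h0 h1 k)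

/-- From the renewal equation `∑ u_n x^n = ∑_k E[x ^ T_1] ^ k`, a truncated form of
`∑ u_n x^n (1 - E[x ^ T_1]) = 1`. -/
theorem pow_mul_U_le (hP : IsRenewalMeasure P) {x : ℝ} (h0 : 0 ≤ x) (h1 : x ≤ 1) (N : ℕ) :
    x ^ N * U P N * (1 - gen P x) ≤ 1 := by
  have hg0 := gen_nonneg (P := P) h0
  have hg1 : gen P x ≤ 1 := (hP.gen_le h0 h1).trans h1
  have h2 : x ^ N * U P N ≤ ∑ k ∈ Finset.range (N + 1), gen P x ^ k := by
    calc x ^ N * U P N = ∑ n ∈ Finset.range (N + 1), u P n * x ^ N := by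
          rw [U, mul_comm, Finset.sum_mul]
      _ ≤ ∑ n ∈ Finset.range (N + 1), u P n * x ^ n := by
          refine Finset.sum_le_sum fun i hi => mul_le_mul_of_nonneg_left ?_ (u_nonneg i)
          exact pow_le_pow_of_le_one h0 h1 (by simpa [Nat.lt_succ_iff] using hi)
      _ = ∑ k ∈ Finset.range (N + 1), ∑ n ∈ Finset.range (N + 1), pr P k n * x ^ n := by
          rw [Finset.sum_comm]
          refine Finset.sum_congr rfl fun n hn => ?_
          rw [hP.u_eq_sum (Nat.lt_succ_iff.1 (Finset.mem_range.1 hn)), Finset.sum_mul]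
      _ ≤ _ := Finset.sum_le_sum fun k _ => sum_le_hasSum _
          (fun i _ => mul_nonneg (pr_nonneg k i) (pow_nonneg h0 i)) (hP.hasSum_pr_mul_pow h0 h1 k)
  calc x ^ N * U P N * (1 - gen P x)
      ≤ (∑ k ∈ Finset.range (N + 1), gen P x ^ k) * (1 - gen P x) :=
        mul_le_mul_of_nonneg_right h2 (by linarith)
    _ = 1 - gen P x ^ (N + 1) := geom_sum_mul_neg _ _
    _ ≤ 1 := by linarith [pow_nonneg hg0 (N + 1)]

/-- Markov's inequality for `1 - x ^ S_k`. -/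
theorem one_sub_cum_mul_le (hP : IsRenewalMeasure P) {x : ℝ} (h0 : 0 ≤ x) (h1 : x ≤ 1)
    (k n : ℕ) : (1 - cum P k n) * (1 - x ^ n) ≤ 1 - gen P x ^ k := by
  have h2 : gen P x ^ k ≤ cum P k n + x ^ n * (1 - cum P k n) := by
    rw [← (hP.hasSum_pr_mul_pow h0 h1 k).tsum_eq,
      ← (hP.summable_pr_mul_pow h0 h1 k).sum_add_tsum_nat_add (n + 1)]
    have h3 : ∑ i ∈ Finset.range (n + 1), pr P k i * x ^ i ≤ cum P k n := by
      rw [hP.cum_eq_sum]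
      exact Finset.sum_le_sum fun i _ => pr_mul_pow_le h0 h1 k i
    have h4 : ∑' i, pr P k (i + (n + 1)) * x ^ (i + (n + 1)) ≤ x ^ n * (1 - cum P k n) := by
      have hs1 : Summable fun i => pr P k (i + (n + 1)) * x ^ (i + (n + 1)) :=
        (hP.summable_pr_mul_pow h0 h1 k).comp_injective (add_left_injective (n + 1))
      have hs2 : Summable fun i => x ^ n * pr P k (i + (n + 1)) :=
        ((hP.summable_pr k).comp_injective (add_left_injective (n + 1))).mul_left _
      have hle : ∀ i, pr P k (i + (n + 1)) * x ^ (i + (n + 1)) ≤ x ^ n * pr P k (i + (n + 1)) := by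
        intro i
        have h5 : x ^ (i + (n + 1)) ≤ x ^ n := pow_le_pow_of_le_one h0 h1 (by omega)
        rw [mul_comm]
        exact mul_le_mul_of_nonneg_right h5 (pr_nonneg _ _)
      have h6 := (hP.summable_pr k).sum_add_tsum_nat_add (n + 1)
      rw [← hP.cum_eq_sum] at h6
      have h7 := hs1.tsum_le_tsum hle hs2
      rw [tsum_mul_left] at h7
      refine h7.trans (mul_le_mul_of_nonneg_left ?_ (pow_nonneg h0 n))
      linarith [hP.tsum_pr_le_one k]
    linarith
  linarith

/-- The `k`-th renewal time exceeds `n` with probability at most `4 k / U_n`. -/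
theorem one_sub_cum_le (hP : IsRenewalMeasure P) (k : ℕ) {n : ℕ} (hn : n ≠ 0) :
    1 - cum P k n ≤ 4 * k / U P n := by
  -- choose `x` with `x ^ n = 1 / 2`, which balances the two bounds below
  set x : ℝ := (1 / 2 : ℝ) ^ (1 / (n : ℝ)) with hx
  have h0 : 0 ≤ x := by positivity
  have h1 : x ≤ 1 := Real.rpow_le_one (by norm_num) (by norm_num) (by positivity)
  have hxn : x ^ n = 1 / 2 := by
    rw [hx, ← Real.rpow_natCast, ← Real.rpow_mul (by norm_num), one_div_mul_cancel
      (by exact_mod_cast hn), Real.rpow_one]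
  have hU : 0 < U P n := by linarith [hP.one_le_U n]
  have hA := hP.pow_mul_U_le h0 h1 n
  have hB := hP.one_sub_cum_mul_le h0 h1 k n
  have hg0 := gen_nonneg (P := P) h0
  have hC : 1 - k * (1 - gen P x) ≤ gen P x ^ k := by
    have := one_add_mul_le_pow (a := gen P x - 1) (by linarith) k
    rw [show 1 + (gen P x - 1) = gen P x by ring] at this
    linarith
  rw [hxn] at hA hB
  rw [le_div_iff₀ hU]
  have h5 : (1 - cum P k n) ≤ 2 * k * (1 - gen P x) := by linarith
  calc (1 - cum P k n) * U P n ≤ 2 * k * (1 - gen P x) * U P n :=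
        mul_le_mul_of_nonneg_right h5 hU.le
    _ = 4 * k * (1 / 2 * U P n * (1 - gen P x)) := by ring
    _ ≤ 4 * k * 1 := mul_le_mul_of_nonneg_left hA (by positivity)
    _ = 4 * k := by ring

theorem tendsto_cum (hP : IsRenewalMeasure P) (hU : Tendsto (U P) atTop atTop) (k : ℕ) :
    Tendsto (cum P k) atTop (𝓝 1) := by
  have h1 : Tendsto (fun n => 1 - 4 * (k : ℝ) / U P n) atTop (𝓝 1) := by
    simpa using tendsto_const_nhds.sub (hU.const_div_atTop (4 * (k : ℝ)))
  refine tendsto_of_tendsto_of_tendsto_of_le_of_le' h1 tendsto_const_nhds ?_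
    (Eventually.of_forall (hP.cum_le_one k))
  filter_upwards [eventually_ne_atTop 0] with n hn
  linarith [hP.one_sub_cum_le k hn]

theorem gen_one (hP : IsRenewalMeasure P) (hU : Tendsto (U P) atTop atTop) : gen P 1 = 1 := by
  have h1 := (hP.summable_pr 1).hasSum.tendsto_sum_nat
  have h2 : Tendsto (fun n => ∑ i ∈ Finset.range (n + 1), pr P 1 i) atTop (𝓝 1) := by
    simpa only [← hP.cum_eq_sum] using hP.tendsto_cum hU 1
  have := tendsto_nhds_unique ((tendsto_add_atTop_iff_nat 1).2 h1) h2
  simpa [gen] using this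

theorem continuousOn_gen (hP : IsRenewalMeasure P) : ContinuousOn (gen P) (Icc 0 1) := by
  refine continuousOn_tsum (u := pr P 1) (fun n => by fun_prop) (hP.summable_pr 1) ?_
  rintro n x ⟨h0, h1⟩
  rw [Real.norm_of_nonneg (mul_nonneg (pr_nonneg 1 n) (pow_nonneg h0 n))]
  exact pr_mul_pow_le h0 h1 1 n

theorem exists_pr_pos (hP : IsRenewalMeasure P) (hU : Tendsto (U P) atTop atTop) :
    ∃ n ≠ 0, 0 < pr P 1 n := by
  by_contra! h
  have h1 : ∀ n, pr P 1 n = 0 := fun n => by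
    rcases eq_or_ne n 0 with rfl | hn
    · exact pr_eq_zero_of_lt (by norm_num)
    · exact le_antisymm (h n hn) (pr_nonneg 1 n)
  have := hP.gen_one hU
  simp [gen, h1] at this

theorem gen_strictMonoOn (hP : IsRenewalMeasure P) (hU : Tendsto (U P) atTop atTop) :
    StrictMonoOn (gen P) (Icc 0 1) := by
  rintro x ⟨h0, h1⟩ y ⟨h0', h1'⟩ hxy
  obtain ⟨n, hn, hpos⟩ := hP.exists_pr_pos hU
  refine Summable.tsum_lt_tsum (i := n) (fun i => ?_) ?_ (hP.summable_pr_mul_pow h0 h1 1)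
    (hP.summable_pr_mul_pow h0' h1' 1)
  · exact mul_le_mul_of_nonneg_left (pow_le_pow_left₀ h0 hxy.le i) (pr_nonneg 1 i)
  · exact mul_lt_mul_of_pos_left (pow_lt_pow_left₀ hxy h0 hn) hpos

/-- Unless there is a renewal at every time, inter-arrival times of length at least `2` occur. This
makes the inequalities `u_1 x ≤ E[x ^ T_1] ≤ x` strict. -/
theorem exists_pr_pos_ge_two (hP : IsRenewalMeasure P) (hU : Tendsto (U P) atTop atTop)
    (h1 : u P 1 < 1) : ∃ n ≥ 2, 0 < pr P 1 n := by
  by_contra! h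
  have h2 : ∀ n, n ≠ 1 → pr P 1 n = 0 := fun n hn => by
    rcases Nat.lt_or_ge n 1 with h' | h'
    · exact pr_eq_zero_of_lt h'
    · exact le_antisymm (h n (by omega)) (pr_nonneg 1 n)
  have := hP.gen_one hU
  rw [gen, tsum_eq_single 1 fun n hn => by simp [h2 n hn]] at this
  rw [hP.u_one] at h1
  simp at this
  linarith

theorem u_one_mul_lt_gen (hP : IsRenewalMeasure P) (hU : Tendsto (U P) atTop atTop)
    (h1 : u P 1 < 1) {x : ℝ} (h0 : 0 < x) (hx : x ≤ 1) : u P 1 * x < gen P x := by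
  obtain ⟨n, hn, hpos⟩ := hP.exists_pr_pos_ge_two hU h1
  have := sum_le_hasSum {1, n} (fun i _ => mul_nonneg (pr_nonneg 1 i) (pow_nonneg h0.le i))
    (hP.hasSum_pr_mul_pow h0.le hx 1)
  rw [Finset.sum_pair (by omega), pow_one, pow_one, ← hP.u_one] at this
  have : 0 < pr P 1 n * x ^ n := by positivity
  linarith

theorem gen_lt (hP : IsRenewalMeasure P) (hU : Tendsto (U P) atTop atTop)
    (h1 : u P 1 < 1) {x : ℝ} (h0 : 0 < x) (hx : x < 1) : gen P x < x := by
  obtain ⟨n, hn, hpos⟩ := hP.exists_pr_pos_ge_two hU h1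
  have h2 : gen P x < ∑' n, pr P 1 n * x := by
    refine Summable.tsum_lt_tsum (i := n) (fun n => ?_) ?_ (hP.summable_pr_mul_pow h0.le hx.le 1)
      ((hP.summable_pr 1).mul_right x)
    · rcases n with _ | n
      · simp [pr_eq_zero_of_lt]
      · refine mul_le_mul_of_nonneg_left ?_ (pr_nonneg 1 _)
        exact pow_le_of_le_one h0.le hx.le (by simp)
    · exact mul_lt_mul_of_pos_left (by simpa using pow_lt_pow_right_of_lt_one₀ h0 hx hn) hpos
  rw [tsum_mul_right] at h2
  exact h2.trans_le (mul_le_of_le_one_left h0.le (hP.tsum_pr_le_one 1))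

/-- If the exponential moments `2^{φ k} P[S_k ≤ n]` grow at most like `2^{w n}`, then
`2^φ E[2^{-s T_1}] < 1` for all `s > w`. -/
theorem mul_gen_lt_one (hP : IsRenewalMeasure P) {φ w s : ℝ} (hs : 0 ≤ s) (hws : w < s)
    (h : ∀ k n : ℕ, 1 ≤ k → k ≤ n → (2 : ℝ) ^ (φ * k) * cum P k n ≤ 2 ^ (w * n)) :
    (2 : ℝ) ^ φ * gen P (2 ^ (-s)) < 1 := by
  set x : ℝ := 2 ^ (-s) with hx
  set y : ℝ := 2 ^ (w - s) with hy
  have h0 : 0 ≤ x := by positivity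
  have h1 : x ≤ 1 := Real.rpow_le_one_of_one_le_of_nonpos (by norm_num) (by linarith)
  have hy0 : 0 ≤ y := by positivity
  have hy1 : y < 1 := Real.rpow_lt_one_of_one_lt_of_neg (by norm_num) (by linarith)
  have hg0 := gen_nonneg (P := P) h0
  have hsum : Summable fun n : ℕ => (n : ℝ) * y ^ n := by
    simpa using summable_pow_mul_geometric_of_norm_lt_one 1 (r := y)
      (by rwa [Real.norm_of_nonneg hy0])
  by_contra! hc
  -- otherwise each term of `∑_k (2^φ E[2^{-s T_1}])^k` is at least `1`; but, summed over `S_k = n`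
  -- with `k ≤ n`, the series is dominated by the convergent `∑ n y^n`
  have key : ∀ K : ℕ, (K : ℝ) ≤ ∑' n : ℕ, (n : ℝ) * y ^ n := by
    intro K
    have hHS : HasSum (fun n => ∑ k ∈ Finset.Icc 1 K, (2 : ℝ) ^ (φ * k) * (pr P k n * x ^ n))
        (∑ k ∈ Finset.Icc 1 K, (2 : ℝ) ^ (φ * k) * gen P x ^ k) :=
      hasSum_sum fun k _ => (hP.hasSum_pr_mul_pow h0 h1 k).mul_left _
    calc (K : ℝ) = ∑ k ∈ Finset.Icc 1 K, (1 : ℝ) := by simp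
      _ ≤ ∑ k ∈ Finset.Icc 1 K, (2 : ℝ) ^ (φ * k) * gen P x ^ k := by
          refine Finset.sum_le_sum fun k _ => ?_
          rw [Real.rpow_mul (by norm_num), Real.rpow_natCast, ← mul_pow]
          exact one_le_pow₀ hc
      _ ≤ _ := by
          refine hasSum_le (fun n => ?_) hHS hsum.hasSum
          have hle : ∀ k ∈ Finset.Icc 1 K, (2 : ℝ) ^ (φ * k) * (pr P k n * x ^ n) ≤
              if k ∈ Finset.Icc 1 n then y ^ n else 0 := by
            intro k hk
            have hk1 := (Finset.mem_Icc.1 hk).1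
            by_cases hkn : k ≤ n
            · rw [if_pos (Finset.mem_Icc.2 ⟨hk1, hkn⟩)]
              have hle : pr P k n ≤ cum P k n := by
                rw [hP.cum_eq_sum]
                exact Finset.single_le_sum (f := fun i => pr P k i) (fun i _ => pr_nonneg k i)
                  (Finset.mem_range.2 (Nat.lt_succ_self n))
              calc (2 : ℝ) ^ (φ * k) * (pr P k n * x ^ n)
                  ≤ (2 : ℝ) ^ (φ * k) * (cum P k n * x ^ n) := by gcongr
                _ = ((2 : ℝ) ^ (φ * k) * cum P k n) * x ^ n := by ring
                _ ≤ 2 ^ (w * n) * x ^ n := by gcongr; exact h k n hk1 hkn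
                _ = y ^ n := by
                  rw [hx, hy, ← Real.rpow_natCast, ← Real.rpow_natCast, ← Real.rpow_mul
                    (by norm_num), ← Real.rpow_mul (by norm_num), ← Real.rpow_add (by norm_num)]
                  congr 1; ring
            · rw [if_neg (by simp [hkn]), pr_eq_zero_of_lt (by omega)]
              simp
          refine (Finset.sum_le_sum hle).trans ?_
          rw [← Finset.sum_filter]
          calc ∑ k ∈ Finset.Icc 1 K with k ∈ Finset.Icc 1 n, y ^ n
              ≤ ∑ k ∈ Finset.Icc 1 n, y ^ n :=
                Finset.sum_le_sum_of_subset_of_nonneg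
                  (fun k hk => (Finset.mem_filter.1 hk).2) fun _ _ _ => by positivity
            _ = (n : ℝ) * y ^ n := by simp
  obtain ⟨K, hK⟩ := exists_nat_gt (∑' n : ℕ, (n : ℝ) * y ^ n)
  exact absurd (key K) (not_le.2 hK)

end IsRenewalMeasure

/-- `Φ(s) = -log₂ E[2^{-s T_1}]`, which turns out to be the inverse function of `ψ`. -/
def logGen (P : Measure BinSeq) (s : ℝ) : ℝ := -Real.logb 2 (gen P (2 ^ (-s)))

theorem two_rpow_neg_mem {s : ℝ} (hs : 0 ≤ s) : (2 : ℝ) ^ (-s) ∈ Icc (0 : ℝ) 1 :=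
  ⟨by positivity, Real.rpow_le_one_of_one_le_of_nonpos (by norm_num) (by linarith)⟩

namespace IsRenewalMeasure

theorem gen_pos (hP : IsRenewalMeasure P) (hU : Tendsto (U P) atTop atTop) {x : ℝ} (h0 : 0 < x)
    (h1 : x ≤ 1) : 0 < gen P x :=
  (gen_nonneg le_rfl).trans_lt
    (hP.gen_strictMonoOn hU ⟨le_rfl, zero_le_one⟩ ⟨h0.le, h1⟩ h0)

theorem two_rpow_neg_logGen (hP : IsRenewalMeasure P) (hU : Tendsto (U P) atTop atTop) {s : ℝ}
    (hs : 0 ≤ s) : (2 : ℝ) ^ (-logGen P s) = gen P (2 ^ (-s)) := by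
  rw [logGen, neg_neg, Real.rpow_logb (by norm_num) (by norm_num)
    (hP.gen_pos hU (by positivity) (two_rpow_neg_mem hs).2)]

theorem logGen_zero (hP : IsRenewalMeasure P) (hU : Tendsto (U P) atTop atTop) :
    logGen P 0 = 0 := by simp [logGen, hP.gen_one hU]

theorem logGen_strictMonoOn (hP : IsRenewalMeasure P) (hU : Tendsto (U P) atTop atTop) :
    StrictMonoOn (logGen P) (Ici 0) := by
  intro s (hs : 0 ≤ s) t (ht : 0 ≤ t) hst
  refine neg_lt_neg (Real.logb_lt_logb (by norm_num)
    (hP.gen_pos hU (by positivity) (two_rpow_neg_mem ht).2) ?_)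
  exact hP.gen_strictMonoOn hU (two_rpow_neg_mem ht) (two_rpow_neg_mem hs)
    (Real.rpow_lt_rpow_of_exponent_lt (by norm_num) (by linarith))

theorem le_logGen (hP : IsRenewalMeasure P) (hU : Tendsto (U P) atTop atTop) {s : ℝ}
    (hs : 0 ≤ s) : s ≤ logGen P s := by
  have h := hP.gen_le (two_rpow_neg_mem hs).1 (two_rpow_neg_mem hs).2
  have := Real.logb_le_logb_of_le (b := 2) (by norm_num)
    (hP.gen_pos hU (by positivity) (two_rpow_neg_mem hs).2) h
  rw [Real.logb_rpow (by norm_num) (by norm_num)] at this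
  rw [logGen]; linarith

theorem continuousOn_logGen (hP : IsRenewalMeasure P) (hU : Tendsto (U P) atTop atTop) :
    ContinuousOn (logGen P) (Ici 0) := by
  have h1 : ContinuousOn (fun s : ℝ => gen P (2 ^ (-s))) (Ici 0) :=
    hP.continuousOn_gen.comp (Continuous.continuousOn (by
      exact Continuous.rpow continuous_const continuous_neg fun _ => .inl (by norm_num)))
      fun s hs => two_rpow_neg_mem hs
  have h2 : ContinuousOn (fun s : ℝ => Real.log (gen P (2 ^ (-s)))) (Ici 0) :=
    h1.log fun s hs => (hP.gen_pos hU (by positivity) (two_rpow_neg_mem hs).2).ne'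
  exact (h2.div_const _).neg

theorem exists_logGen_eq (hP : IsRenewalMeasure P) (hU : Tendsto (U P) atTop atTop) {φ : ℝ}
    (hφ : 0 ≤ φ) : ∃ s, 0 ≤ s ∧ logGen P s = φ := by
  have h := intermediate_value_Icc hφ ((hP.continuousOn_logGen hU).mono Icc_subset_Ici_self)
  rw [hP.logGen_zero hU] at h
  obtain ⟨s, hs, h⟩ := h ⟨hφ, hP.le_logGen hU hφ⟩
  exact ⟨s, hs.1, h⟩

end IsRenewalMeasure

end

/-! ### The rate function and its Legendre-type transform -/

section

variable {P : Measure BinSeq}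

theorem sum_T (δ : BinSeq) (m : ℕ) : ∑ k ∈ Finset.Icc 1 m, T δ k = S δ m := by
  induction m with
  | zero => simp [S]
  | succ m ih =>
    have hle : S δ m ≤ S δ (m + 1) := by
      refine le_iInf₂ fun n hn => hn.1.le
    rw [Finset.sum_Icc_succ_top (by omega), ih, T, Nat.add_sub_cancel, add_tsub_cancel_of_le hle]

theorem setOf_sum_T_le (m : ℕ) {r : ℝ} (hr : 0 ≤ r) :
    {δ | ((∑ k ∈ Finset.Icc 1 m, T δ k : ℕ∞) : ℝ≥0∞) ≤ ENNReal.ofReal r} =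
      {δ | m ≤ cnt δ ⌊r⌋₊} := by
  ext δ
  simp only [mem_ofPred_eq]
  rw [sum_T, ← S_le_iff]
  induction S δ m using ENat.recTopCoe with
  | top => simp
  | coe n =>
    rw [ENat.toENNReal_coe, Nat.cast_le, Nat.le_floor_iff hr, ← ENNReal.ofReal_natCast,
      ENNReal.ofReal_le_ofReal_iff hr]

namespace IsRenewalMeasure

theorem rateSeq_eq (hP : IsRenewalMeasure P) {a : ℝ} (ha : 0 ≤ a) (m : ℕ) :
    rateSeq P a m = -ENNReal.log (ENNReal.ofReal (cum P m ⌊m * a⌋₊)) /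
      (((m : ℝ) * Real.log 2 : ℝ) : EReal) := by
  have := hP.isProbabilityMeasure
  rw [rateSeq, setOf_sum_T_le m (by positivity), cum, measureReal_def,
    ENNReal.ofReal_toReal (measure_ne_top _ _)]

theorem rateSeq_of_pos (hP : IsRenewalMeasure P) {a : ℝ} (ha : 0 ≤ a) {m : ℕ}
    (h : 0 < cum P m ⌊m * a⌋₊) :
    rateSeq P a m = ((-Real.logb 2 (cum P m ⌊m * a⌋₊) / m : ℝ) : EReal) := by
  rw [hP.rateSeq_eq ha, ENNReal.log_ofReal_of_pos h, ← EReal.coe_neg, ← EReal.coe_div]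
  congr 1
  rw [Real.logb, neg_div, neg_div, div_div, mul_comm (Real.log 2)]

theorem rateSeq_of_eq_zero (hP : IsRenewalMeasure P) {a : ℝ} (ha : 0 ≤ a) {m : ℕ} (hm : m ≠ 0)
    (h : cum P m ⌊m * a⌋₊ = 0) : rateSeq P a m = ⊤ := by
  have : 0 < (m : ℝ) * Real.log 2 := by
    have := Real.log_pos (x := 2) (by norm_num)
    positivity
  rw [hP.rateSeq_eq ha, h]
  simp only [ENNReal.ofReal_zero, ENNReal.log_zero, EReal.neg_bot]
  exact EReal.top_div_of_pos_ne_top (by exact_mod_cast this) (EReal.coe_ne_top _)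

theorem floor_add_le {a : ℝ} (ha : 0 ≤ a) (m n : ℕ) :
    ⌊m * a⌋₊ + ⌊n * a⌋₊ ≤ ⌊((m + n : ℕ) : ℝ) * a⌋₊ := by
  refine Nat.le_floor ?_
  push_cast
  rw [add_mul]
  exact add_le_add (Nat.floor_le (by positivity)) (Nat.floor_le (by positivity))

theorem cum_floor_mul_le (hP : IsRenewalMeasure P) {a : ℝ} (ha : 0 ≤ a) (m n : ℕ) :
    cum P m ⌊m * a⌋₊ * cum P n ⌊n * a⌋₊ ≤ cum P (m + n) ⌊((m + n : ℕ) : ℝ) * a⌋₊ :=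
  (hP.cum_mul_cum_le m n _ _).trans (hP.cum_mono _ (floor_add_le ha m n))

theorem cum_zero (hP : IsRenewalMeasure P) (n : ℕ) : cum P 0 n = 1 := by
  have := hP.isProbabilityMeasure
  simp [cum]

theorem cum_floor_pos (hP : IsRenewalMeasure P) {a : ℝ} (ha : 0 ≤ a) (h : 0 < cum P 1 ⌊a⌋₊)
    (m : ℕ) : 0 < cum P m ⌊m * a⌋₊ := by
  induction m with
  | zero => simp [hP.cum_zero]
  | succ m ih =>
    refine lt_of_lt_of_le (mul_pos ih ?_) (hP.cum_floor_mul_le ha m 1)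
    simpa using h

/-- If all inter-arrival times exceed `A`, then `S_k ≥ k (A + 1)`. -/
theorem pr_eq_zero_of_cum_eq_zero (hP : IsRenewalMeasure P) {A : ℕ} (h : cum P 1 A = 0) (k : ℕ) :
    ∀ n < k * (A + 1), pr P k n = 0 := by
  have h1 : ∀ j ≤ A, pr P 1 j = 0 := fun j hj => by
    rw [hP.cum_eq_sum, Finset.sum_eq_zero_iff_of_nonneg fun i _ => pr_nonneg 1 i] at h
    exact h j (by simpa [Nat.lt_succ_iff] using hj)
  induction k with
  | zero => intro n hn; omega
  | succ k ih =>
    intro n hn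
    rw [hP.pr_add]
    refine Finset.sum_eq_zero fun i _ => ?_
    by_cases hi : i < k * (A + 1)
    · rw [ih i hi, zero_mul]
    · rw [h1 (n - i) (by rw [add_mul] at hn; omega), mul_zero]

theorem cum_floor_eq_zero (hP : IsRenewalMeasure P) {a : ℝ} (ha : 0 ≤ a)
    (h : cum P 1 ⌊a⌋₊ = 0) {m : ℕ} (hm : m ≠ 0) : cum P m ⌊m * a⌋₊ = 0 := by
  rw [hP.cum_eq_sum]
  refine Finset.sum_eq_zero fun i hi => hP.pr_eq_zero_of_cum_eq_zero h m i ?_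
  have h1 : (i : ℝ) ≤ m * a :=
    (Nat.le_floor_iff (by positivity)).1 (Nat.lt_succ_iff.1 (Finset.mem_range.1 hi))
  have h2 : (m : ℝ) * a < m * (⌊a⌋₊ + 1) :=
    mul_lt_mul_of_pos_left (Nat.lt_floor_add_one a) (by positivity)
  exact_mod_cast h1.trans_lt h2

/-- Fekete's lemma: the limit defining the rate exists, and is approached from above. -/
theorem tendsto_rateSeq_and_le (hP : IsRenewalMeasure P) {a : ℝ} (ha : 0 ≤ a) :
    Tendsto (rateSeq P a) atTop (𝓝 (rate P a)) ∧ ∀ m ≠ 0, rate P a ≤ rateSeq P a m := by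
  suffices h : ∃ L, Tendsto (rateSeq P a) atTop (𝓝 L) ∧ ∀ m ≠ 0, L ≤ rateSeq P a m by
    obtain ⟨L, hL, hle⟩ := h
    rw [rate, hL.limsup_eq]
    exact ⟨hL, hle⟩
  rcases (cum_nonneg (P := P) 1 ⌊a⌋₊).eq_or_lt' with h | h
  · have h1 : ∀ m ≠ 0, rateSeq P a m = ⊤ := fun m hm =>
      hP.rateSeq_of_eq_zero ha hm (hP.cum_floor_eq_zero ha h hm)
    refine ⟨⊤, tendsto_const_nhds.congr' ?_, fun m hm => (h1 m hm).ge⟩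
    filter_upwards [eventually_ne_atTop 0] with m hm
    exact (h1 m hm).symm
  · have hpos := hP.cum_floor_pos ha h
    have hsub : Subadditive fun m : ℕ => -Real.logb 2 (cum P m ⌊m * a⌋₊) := by
      intro m n
      have h2 := Real.logb_le_logb_of_le (b := 2) (by norm_num) (mul_pos (hpos m) (hpos n))
        (hP.cum_floor_mul_le ha m n)
      rw [Real.logb_mul (hpos m).ne' (hpos n).ne'] at h2
      dsimp only
      linarith
    have hbdd : BddBelow (range fun n : ℕ => -Real.logb 2 (cum P n ⌊n * a⌋₊) / n) := by
      refine ⟨0, ?_⟩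
      rintro _ ⟨n, rfl⟩
      have := Real.logb_nonpos (b := 2) (by norm_num) (hpos n).le (hP.cum_le_one n _)
      exact div_nonneg (by linarith) (by positivity)
    refine ⟨(hsub.lim : ℝ), ?_, fun m hm => ?_⟩
    · refine ((continuous_coe_real_ereal.tendsto _).comp (hsub.tendsto_lim hbdd)).congr fun m => ?_
      exact (hP.rateSeq_of_pos ha (hpos m)).symm
    · rw [hP.rateSeq_of_pos ha (hpos m)]
      exact_mod_cast hsub.lim_le_div hbdd hm

theorem tendsto_rateSeq (hP : IsRenewalMeasure P) {a : ℝ} (ha : 0 ≤ a) :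
    Tendsto (rateSeq P a) atTop (𝓝 (rate P a)) := (hP.tendsto_rateSeq_and_le ha).1

theorem rate_le_rateSeq (hP : IsRenewalMeasure P) {a : ℝ} (ha : 0 ≤ a) {m : ℕ} (hm : m ≠ 0) :
    rate P a ≤ rateSeq P a m := (hP.tendsto_rateSeq_and_le ha).2 m hm

/-- An upper bound for `ψ(φ)` bounds all the exponential moments `2^{φ k} P[S_k ≤ n]`. -/
theorem rpow_mul_cum_le_of_psiExt_le (hP : IsRenewalMeasure P) {φ w : ℝ}
    (h : psiExt P φ ≤ (w : EReal)) {k n : ℕ} (hk : 1 ≤ k) (hkn : k ≤ n) :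
    (2 : ℝ) ^ (φ * k) * cum P k n ≤ 2 ^ (w * n) := by
  rcases (cum_nonneg (P := P) k n).eq_or_lt' with h0 | h0
  · rw [h0, mul_zero]; positivity
  have hk0 : (0 : ℝ) < k := by exact_mod_cast hk
  have hn0 : (0 : ℝ) < n := by exact_mod_cast hk.trans hkn
  have hkn' : (k : ℝ) ≤ n := by exact_mod_cast hkn
  set ξ : ℝ := k / n with hξ
  have hξ0 : 0 < ξ := by positivity
  have hξ1 : ξ ≤ 1 := (div_le_one hn0).2 hkn'
  have hfl : ⌊(k : ℝ) * ξ⁻¹⌋₊ = n := by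
    rw [hξ, inv_div, mul_div_cancel₀ _ hk0.ne', Nat.floor_natCast]
  have h1 := hP.rate_le_rateSeq (a := ξ⁻¹) (by positivity) (m := k) (by omega)
  rw [hP.rateSeq_of_pos (by positivity) (by rw [hfl]; exact h0), hfl] at h1
  have h2 : psiHat P φ ξ ≤ (w : EReal) :=
    (le_iSup₂ (f := fun ξ (_ : ξ ∈ Ioc (0 : ℝ) 1) => psiHat P φ ξ) ξ ⟨hξ0, hξ1⟩).trans h
  have h3 : (ξ : EReal) * ((φ : EReal) - ((-Real.logb 2 (cum P k n) / k : ℝ) : EReal)) ≤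
      (w : EReal) :=
    (mul_le_mul_of_nonneg_left (EReal.sub_le_sub le_rfl h1) (by exact_mod_cast hξ0.le)).trans h2
  have h4 : ξ * (φ - -Real.logb 2 (cum P k n) / k) ≤ w := by exact_mod_cast h3
  have h5 : φ * k + Real.logb 2 (cum P k n) ≤ w * n := by
    have := mul_le_mul_of_nonneg_right h4 hn0.le
    have h6 : ξ * (φ - -Real.logb 2 (cum P k n) / k) * n = φ * k + Real.logb 2 (cum P k n) := by
      rw [hξ]; field_simp
      ring
    linarith
  calc (2 : ℝ) ^ (φ * k) * cum P k n = 2 ^ (φ * k + Real.logb 2 (cum P k n)) := by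
        rw [Real.rpow_add (by norm_num), Real.rpow_logb (by norm_num) (by norm_num) h0]
    _ ≤ _ := Real.rpow_le_rpow_of_exponent_le (by norm_num) h5

/-- The Chernoff bound gives `Λ*(1/ξ) ≥ Φ(s) - s/ξ`, that is, `ψ̂(Φ(s), ξ) ≤ s`. -/
theorem psiExt_logGen_le (hP : IsRenewalMeasure P) (hU : Tendsto (U P) atTop atTop) {s : ℝ}
    (hs : 0 ≤ s) : psiExt P (logGen P s) ≤ (s : EReal) := by
  refine iSup₂_le fun ξ hξ => ?_
  have hξ0 : (0 : ℝ) < ξ := hξ.1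
  have hrate : ((logGen P s - s * ξ⁻¹ : ℝ) : EReal) ≤ rate P ξ⁻¹ := by
    refine ge_of_tendsto (hP.tendsto_rateSeq (a := ξ⁻¹) (by positivity)) ?_
    filter_upwards [eventually_ne_atTop 0] with m hm
    rcases (cum_nonneg (P := P) m ⌊m * ξ⁻¹⌋₊).eq_or_lt' with h0 | h0
    · rw [hP.rateSeq_of_eq_zero (by positivity) hm h0]; exact le_top
    rw [hP.rateSeq_of_pos (by positivity) h0, EReal.coe_le_coe_iff]
    have hm0 : (0 : ℝ) < m := by positivity
    have h1 := hP.cum_mul_pow_le (two_rpow_neg_mem hs).1 (two_rpow_neg_mem hs).2 m ⌊m * ξ⁻¹⌋₊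
    rw [← hP.two_rpow_neg_logGen hU hs] at h1
    have h2 := Real.logb_le_logb_of_le (b := 2) (by norm_num) (by positivity) h1
    rw [Real.logb_mul h0.ne' (by positivity), ← Real.rpow_natCast, ← Real.rpow_natCast,
      ← Real.rpow_mul (by norm_num), ← Real.rpow_mul (by norm_num),
      Real.logb_rpow (by norm_num) (by norm_num), Real.logb_rpow (by norm_num) (by norm_num)] at h2
    have h3 : (⌊m * ξ⁻¹⌋₊ : ℝ) ≤ m * ξ⁻¹ := Nat.floor_le (by positivity)
    rw [le_div_iff₀ hm0]
    nlinarith [mul_le_mul_of_nonneg_left h3 hs]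
  calc psiHat P (logGen P s) ξ
      ≤ (ξ : EReal) * (((logGen P s : ℝ) : EReal) - ((logGen P s - s * ξ⁻¹ : ℝ) : EReal)) :=
        mul_le_mul_of_nonneg_left (EReal.sub_le_sub le_rfl hrate) (by exact_mod_cast hξ0.le)
    _ = ((ξ * (logGen P s - (logGen P s - s * ξ⁻¹)) : ℝ) : EReal) := by push_cast; rfl
    _ = (s : EReal) := by
        congr 1
        field_simp
        ring

/-- `ψ` is the inverse function of `Φ(s) = -log₂ E[2^{-s T_1}]`. If some `w < s` bounded `ψ(Φ(s))`,
then all exponential moments `2^{Φ(s) k} P[S_k ≤ n]` would be at most `2^{w n}`, which forces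
`2^{Φ(s)} E[2^{-s T_1}] < 1`; but this product is `1`. -/
theorem psiExt_logGen (hP : IsRenewalMeasure P) (hU : Tendsto (U P) atTop atTop) {s : ℝ}
    (hs : 0 ≤ s) : psiExt P (logGen P s) = (s : EReal) := by
  refine le_antisymm (hP.psiExt_logGen_le hU hs) ?_
  by_contra! hc
  obtain ⟨w, hw, hws⟩ := EReal.lt_iff_exists_real_btwn.1 hc
  have h := hP.mul_gen_lt_one hs (EReal.coe_lt_coe_iff.1 hws)
    fun k n hk hkn => hP.rpow_mul_cum_le_of_psiExt_le hw.le hk hkn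
  rw [← hP.two_rpow_neg_logGen hU hs, ← Real.rpow_add (by norm_num), add_neg_cancel,
    Real.rpow_zero] at h
  exact lt_irrefl _ h

theorem psi_logGen (hP : IsRenewalMeasure P) (hU : Tendsto (U P) atTop atTop) {s : ℝ}
    (hs : 0 ≤ s) : psi P (logGen P s) = s := by
  rw [psi, hP.psiExt_logGen hU hs, EReal.toReal_coe]

theorem logGen_psi (hP : IsRenewalMeasure P) (hU : Tendsto (U P) atTop atTop) {φ : ℝ}
    (hφ : 0 ≤ φ) : logGen P (psi P φ) = φ := by
  obtain ⟨s, hs, rfl⟩ := hP.exists_logGen_eq hU hφ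
  rw [hP.psi_logGen hU hs]

theorem psi_nonneg (hP : IsRenewalMeasure P) (hU : Tendsto (U P) atTop atTop) {φ : ℝ}
    (hφ : 0 ≤ φ) : 0 ≤ psi P φ := by
  obtain ⟨s, hs, rfl⟩ := hP.exists_logGen_eq hU hφ
  rwa [hP.psi_logGen hU hs]

theorem coe_psi (hP : IsRenewalMeasure P) (hU : Tendsto (U P) atTop atTop) {φ : ℝ}
    (hφ : 0 ≤ φ) : ((psi P φ : ℝ) : EReal) = psiExt P φ := by
  obtain ⟨s, hs, rfl⟩ := hP.exists_logGen_eq hU hφ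
  rw [hP.psi_logGen hU hs, hP.psiExt_logGen hU hs]

theorem logGen_nonneg (hP : IsRenewalMeasure P) (hU : Tendsto (U P) atTop atTop) {s : ℝ}
    (hs : 0 ≤ s) : 0 ≤ logGen P s := hs.trans (hP.le_logGen hU hs)

theorem psi_strictMonoOn (hP : IsRenewalMeasure P) (hU : Tendsto (U P) atTop atTop) :
    StrictMonoOn (psi P) (Ici 0) := by
  intro φ (hφ : 0 ≤ φ) φ' (hφ' : 0 ≤ φ') h
  rw [← hP.logGen_psi hU hφ, ← hP.logGen_psi hU hφ'] at h
  exact ((hP.logGen_strictMonoOn hU).lt_iff_lt (hP.psi_nonneg hU hφ) (hP.psi_nonneg hU hφ')).1 h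

theorem psi_bijOn (hP : IsRenewalMeasure P) (hU : Tendsto (U P) atTop atTop) :
    BijOn (psi P) (Ici 0) (Ici 0) :=
  ⟨fun _ hφ => hP.psi_nonneg hU hφ, (hP.psi_strictMonoOn hU).injOn,
    fun s hs => ⟨logGen P s, hP.logGen_nonneg hU hs, hP.psi_logGen hU hs⟩⟩

theorem psiInv_eq (hP : IsRenewalMeasure P) (hU : Tendsto (U P) atTop atTop) {s : ℝ}
    (hs : 0 ≤ s) : psiInv P s = logGen P s := by
  have hex : ∃ φ ∈ Ici (0 : ℝ), psi P φ = s := ⟨_, hP.logGen_nonneg hU hs, hP.psi_logGen hU hs⟩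
  have h := hP.logGen_psi hU (Function.invFunOn_mem hex : psiInv P s ∈ Ici (0 : ℝ))
  rw [Function.invFunOn_eq hex] at h
  exact h.symm

theorem psi_lt_one (hP : IsRenewalMeasure P) (hU : Tendsto (U P) atTop atTop) (h1 : u P 1 < 1)
    {φ : ℝ} (hφ : 0 ≤ φ) (hφ1 : φ ≤ 1) : psi P φ < 1 := by
  rw [← (hP.logGen_strictMonoOn hU).lt_iff_lt (hP.psi_nonneg hU hφ) (show (0 : ℝ) ≤ 1 by simp),
    hP.logGen_psi hU hφ]
  refine hφ1.trans_lt ?_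
  have h2 := hP.gen_lt hU h1 (x := 2 ^ (-1 : ℝ)) (by positivity)
    (Real.rpow_lt_one_of_one_lt_of_neg (by norm_num) (by norm_num))
  have h3 := Real.logb_lt_logb (b := 2) (by norm_num) (hP.gen_pos hU (by positivity)
    (two_rpow_neg_mem zero_le_one).2) h2
  rw [Real.logb_rpow (by norm_num) (by norm_num)] at h3
  rw [logGen]; linarith

/-- The bound `E[2^{-s T_1}] > u_1 2^{-s}`, restated for `Φ`. -/
theorem two_rpow_logGen_lt (hP : IsRenewalMeasure P) (hU : Tendsto (U P) atTop atTop)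
    (h1 : u P 1 < 1) (h0 : 0 < u P 1) {s : ℝ} (hs : 0 ≤ s) :
    (2 : ℝ) ^ logGen P s < 2 ^ s / u P 1 := by
  have h2 := hP.u_one_mul_lt_gen hU h1 (x := 2 ^ (-s)) (by positivity) (two_rpow_neg_mem hs).2
  rw [← hP.two_rpow_neg_logGen hU hs, Real.rpow_neg (by norm_num), Real.rpow_neg (by norm_num),
    ← div_eq_mul_inv] at h2
  have h3 := (lt_inv_comm₀ (by positivity) (by positivity)).1 h2
  rwa [inv_div] at h3

/-- Along a fixed `w < ψ(φ)`, the largest exponential moment `2^{φ k} P[S_k ≤ n]` is at least of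
order `2^{w n}`. -/
theorem exists_rpow_le_rpow_mul_cum (hP : IsRenewalMeasure P) (hU : Tendsto (U P) atTop atTop)
    {φ w : ℝ} (hφ : 0 ≤ φ) (hw : 0 ≤ w) (hwψ : w < psi P φ) :
    ∃ C > 0, ∀ n : ℕ, ∃ k ≤ n, C * 2 ^ (w * n) ≤ (2 : ℝ) ^ (φ * k) * cum P k n := by
  obtain ⟨k₀, n₀, hk₀, hkn₀, h⟩ : ∃ k n : ℕ, 1 ≤ k ∧ k ≤ n ∧
      (2 : ℝ) ^ (w * n) < 2 ^ (φ * k) * cum P k n := by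
    by_contra! hc
    have h := hP.mul_gen_lt_one (hP.psi_nonneg hU hφ) hwψ hc
    rw [← hP.two_rpow_neg_logGen hU (hP.psi_nonneg hU hφ), hP.logGen_psi hU hφ,
      ← Real.rpow_add (by norm_num), add_neg_cancel, Real.rpow_zero] at h
    exact lt_irrefl _ h
  -- supermultiplicativity propagates the inequality from `(k₀, n₀)` to its multiples
  have hj : ∀ j : ℕ, (2 : ℝ) ^ (w * ((j * n₀ : ℕ) : ℝ)) ≤
      2 ^ (φ * ((j * k₀ : ℕ) : ℝ)) * cum P (j * k₀) (j * n₀) := by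
    intro j
    induction j with
    | zero => simp [hP.cum_zero]
    | succ j ih =>
      calc (2 : ℝ) ^ (w * (((j + 1) * n₀ : ℕ) : ℝ))
          = 2 ^ (w * ((j * n₀ : ℕ) : ℝ)) * 2 ^ (w * n₀) := by
            rw [← Real.rpow_add (by norm_num)]; congr 1; push_cast; ring
        _ ≤ (2 ^ (φ * ((j * k₀ : ℕ) : ℝ)) * cum P (j * k₀) (j * n₀)) *
            (2 ^ (φ * k₀) * cum P k₀ n₀) :=
            mul_le_mul ih h.le (by positivity) (mul_nonneg (by positivity) (cum_nonneg _ _))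
        _ = 2 ^ (φ * (((j + 1) * k₀ : ℕ) : ℝ)) * (cum P (j * k₀) (j * n₀) * cum P k₀ n₀) := by
            rw [show φ * (((j + 1) * k₀ : ℕ) : ℝ) = φ * ((j * k₀ : ℕ) : ℝ) + φ * k₀ by
              push_cast; ring, Real.rpow_add (by norm_num)]
            ring
        _ ≤ _ := by
            refine mul_le_mul_of_nonneg_left ?_ (by positivity)
            rw [add_mul, add_mul, one_mul, one_mul]
            exact hP.cum_mul_cum_le _ _ _ _
  refine ⟨2 ^ (-(w * n₀)), by positivity, fun n => ⟨n / n₀ * k₀, ?_, ?_⟩⟩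
  · exact (Nat.mul_le_mul_left _ hkn₀).trans (Nat.div_mul_le_self n n₀)
  · calc (2 : ℝ) ^ (-(w * n₀)) * 2 ^ (w * n) ≤ 2 ^ (w * ((n / n₀ * n₀ : ℕ) : ℝ)) := by
          rw [← Real.rpow_add (by norm_num)]
          refine Real.rpow_le_rpow_of_exponent_le (by norm_num) ?_
          have h1 : n ≤ n / n₀ * n₀ + n₀ := by
            have := Nat.lt_div_mul_add (a := n) (b := n₀) (by omega)
            omega
          have h2 : (n : ℝ) ≤ ((n / n₀ * n₀ : ℕ) : ℝ) + n₀ := by exact_mod_cast h1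
          nlinarith
      _ ≤ _ := (hj _).trans (mul_le_mul_of_nonneg_left
          (hP.cum_mono _ (Nat.div_mul_le_self n n₀)) (by positivity))

end IsRenewalMeasure

end

/-! ### Growth of the renewal mass -/

/-- `U_n = n^{1-γ+o(1)}`, stated along powers of two. -/
def HasIndex (P : Measure BinSeq) (γ : ℝ) : Prop :=
  Tendsto (fun k : ℕ => Real.logb 2 (U P (2 ^ k)) / k) atTop (𝓝 (1 - γ))

/-- A slowly varying function is sub-exponential along powers of two. -/
theorem SlowlyVarying.tendsto_logb_div {ℓ : ℝ → ℝ} (hℓ : SlowlyVarying ℓ) :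
    Tendsto (fun k : ℕ => Real.logb 2 (ℓ (2 ^ k)) / k) atTop (𝓝 0) := by
  have hpow : Tendsto (fun k : ℕ => (2 : ℝ) ^ k) atTop atTop :=
    tendsto_pow_atTop_atTop_of_one_lt (by norm_num)
  have h1 : Tendsto (fun k : ℕ => ℓ (2 * 2 ^ k) / ℓ (2 ^ k)) atTop (𝓝 1) :=
    (hℓ.tendsto 2 (by norm_num)).comp hpow
  have h2 : Tendsto (fun k : ℕ => Real.logb 2 (ℓ (2 * 2 ^ k) / ℓ (2 ^ k))) atTop (𝓝 0) := by
    have := (Real.continuousAt_log one_ne_zero).tendsto.comp h1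
    simpa [Real.logb] using this.div_const (Real.log 2)
  have h3 : Tendsto (fun k : ℕ => Real.logb 2 (ℓ (2 ^ (k + 1))) - Real.logb 2 (ℓ (2 ^ k)))
      atTop (𝓝 0) := by
    refine h2.congr' ?_
    have hpos := hpow.eventually hℓ.pos
    filter_upwards [hpos, (tendsto_add_atTop_nat 1).eventually hpos] with k hk hk'
    rw [pow_succ'] at hk' ⊢
    rw [Real.logb_div hk'.ne' hk.ne']
  -- the Cesàro means of the increments telescope
  have h4 := h3.cesaro
  simp only [Finset.sum_range_sub (fun k => Real.logb 2 (ℓ (2 ^ k)))] at h4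
  have h5 : Tendsto (fun n : ℕ => (n : ℝ)⁻¹ * Real.logb 2 (ℓ (2 ^ 0))) atTop (𝓝 0) := by
    have := (tendsto_inv_atTop_nhds_zero_nat (𝕜 := ℝ)).mul_const (Real.logb 2 (ℓ (2 ^ 0)))
    rwa [zero_mul] at this
  have h6 := h4.add h5
  rw [add_zero] at h6
  refine h6.congr fun n => ?_
  rw [← mul_add, sub_add_cancel, inv_mul_eq_div]

section

variable {P : Measure BinSeq}

theorem IsRenewalMeasure.hasIndex (hP : IsRenewalMeasure P) {γ : ℝ} {ℓ : ℝ → ℝ}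
    (hℓ : SlowlyVarying ℓ) (hU : Asymp (U P) fun n => (n : ℝ) ^ (1 - γ) * ℓ n) :
    HasIndex P γ := by
  obtain ⟨C₁, C₂, hC₁, hC₂, h⟩ := hU
  have hpow : Tendsto (fun k : ℕ => (2 : ℝ) ^ k) atTop atTop :=
    tendsto_pow_atTop_atTop_of_one_lt (by norm_num)
  have hlim : ∀ c : ℝ, Tendsto (fun k : ℕ => c / k + (1 - γ) + Real.logb 2 (ℓ (2 ^ k)) / k) atTop
      (𝓝 (1 - γ)) := fun c => by
    simpa using ((tendsto_const_div_atTop_nhds_zero_nat c).add_const (1 - γ)).add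
      hℓ.tendsto_logb_div
  have key : ∀ᶠ k : ℕ in atTop, Real.logb 2 C₁ / k + (1 - γ) + Real.logb 2 (ℓ (2 ^ k)) / k ≤
      Real.logb 2 (U P (2 ^ k)) / k ∧ Real.logb 2 (U P (2 ^ k)) / k ≤
      Real.logb 2 C₂ / k + (1 - γ) + Real.logb 2 (ℓ (2 ^ k)) / k := by
    filter_upwards [hpow.eventually hℓ.pos, eventually_ne_atTop 0] with k hk hk0
    have hk0' : (0 : ℝ) < k := by positivity
    have hUp : 0 < U P (2 ^ k) := by linarith [hP.one_le_U (2 ^ k)]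
    obtain ⟨h1, h2⟩ := h (2 ^ k) Nat.one_le_two_pow
    push_cast at h1 h2
    have hb : 0 < ((2 : ℝ) ^ k) ^ (1 - γ) * ℓ (2 ^ k) := by positivity
    have hlog : Real.logb 2 (((2 : ℝ) ^ k) ^ (1 - γ) * ℓ (2 ^ k)) =
        k * (1 - γ) + Real.logb 2 (ℓ (2 ^ k)) := by
      rw [Real.logb_mul (by positivity) hk.ne', ← Real.rpow_natCast, ← Real.rpow_mul (by norm_num),
        Real.logb_rpow (by norm_num) (by norm_num)]
    have h3 := Real.logb_le_logb_of_le (b := 2) (by norm_num) hC₁ h1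
    have h4 := Real.logb_le_logb_of_le (b := 2) (by norm_num) (by positivity) h2
    rw [Real.logb_div hUp.ne' hb.ne', hlog] at h3 h4
    rw [le_div_iff₀ hk0', div_le_iff₀ hk0', add_mul, add_mul, add_mul, add_mul,
      div_mul_cancel₀ _ hk0'.ne', div_mul_cancel₀ _ hk0'.ne', div_mul_cancel₀ _ hk0'.ne']
    constructor <;> linarith
  exact tendsto_of_tendsto_of_tendsto_of_le_of_le' (hlim _) (hlim _)
    (key.mono fun _ h => h.1) (key.mono fun _ h => h.2)

namespace IsRenewalMeasure

theorem eventually_U_le (hP : IsRenewalMeasure P) {γ a : ℝ} (hγ : HasIndex P γ) (ha : 1 - γ < a) :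
    ∀ᶠ k : ℕ in atTop, U P (2 ^ k) ≤ 2 ^ (a * k) := by
  filter_upwards [hγ.eventually_lt_const ha, eventually_ne_atTop 0] with k hk hk0
  have hk0' : (0 : ℝ) < k := by positivity
  have hUp : 0 < U P (2 ^ k) := by linarith [hP.one_le_U (2 ^ k)]
  rw [div_lt_iff₀ hk0', Real.logb_lt_iff_lt_rpow (by norm_num) hUp] at hk
  exact hk.le

theorem eventually_le_U (hP : IsRenewalMeasure P) {γ a : ℝ} (hγ : HasIndex P γ) (ha : a < 1 - γ) :
    ∀ᶠ k : ℕ in atTop, 2 ^ (a * k) ≤ U P (2 ^ k) := by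
  filter_upwards [hγ.eventually_const_lt ha, eventually_ne_atTop 0] with k hk hk0
  have hk0' : (0 : ℝ) < k := by positivity
  have hUp : 0 < U P (2 ^ k) := by linarith [hP.one_le_U (2 ^ k)]
  rw [lt_div_iff₀ hk0', Real.lt_logb_iff_rpow_lt (by norm_num) hUp] at hk
  exact hk.le

theorem tendsto_U (hP : IsRenewalMeasure P) {γ : ℝ} (hγ : HasIndex P γ) (hγ1 : γ < 1) :
    Tendsto (U P) atTop atTop := by
  refine tendsto_atTop_atTop_of_monotone (fun _ _ => U_mono) fun b => ?_
  have h1 := hP.eventually_le_U hγ (a := (1 - γ) / 2) (by linarith)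
  have h2 : Tendsto (fun k : ℕ => (2 : ℝ) ^ ((1 - γ) / 2 * (k : ℝ))) atTop atTop := by
    have h3 : Tendsto (fun k : ℕ => (1 - γ) / 2 * (k : ℝ)) atTop atTop :=
      tendsto_natCast_atTop_atTop.const_mul_atTop (by linarith)
    exact (tendsto_rpow_atTop_of_base_gt_one 2 (by norm_num)).comp h3
  obtain ⟨k, hk, hk'⟩ := (h1.and (h2.eventually_ge_atTop b)).exists
  exact ⟨2 ^ k, hk'.trans hk⟩

theorem u_mul_u_le (hP : IsRenewalMeasure P) (a b : ℕ) : u P a * u P b ≤ u P (a + b) := by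
  have := hP.isProbabilityMeasure
  have h := hP.regeneration a MeasurableSet.univ (measurableSet_renewalAt b) (by simp)
  rw [univ_inter] at h
  rw [u, u, measureReal_def, measureReal_def, ← ENNReal.toReal_mul, ← h, ← measureReal_def]
  refine measureReal_mono ?_
  rintro δ ⟨-, h⟩
  exact h

theorem u_le_one (hP : IsRenewalMeasure P) (n : ℕ) : u P n ≤ 1 := by
  have := hP.isProbabilityMeasure
  exact measureReal_le_one

/-- Since `U_n` grows slower than linearly, renewals do not occur at every time. -/
theorem u_one_lt_one (hP : IsRenewalMeasure P) {γ : ℝ} (hγ : HasIndex P γ) (hγ0 : 0 < γ) :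
    u P 1 < 1 := by
  refine lt_of_le_of_ne (hP.u_le_one 1) fun h1 => ?_
  have h2 : ∀ n, 1 ≤ u P n := fun n => by
    induction n with
    | zero => exact hP.u_zero.ge
    | succ n ih =>
      have := hP.u_mul_u_le n 1
      rw [h1, mul_one] at this
      exact ih.trans this
  have h3 := hP.eventually_U_le hγ (a := 1) (by linarith)
  obtain ⟨k, hk⟩ := h3.exists
  have h4 : ((2 ^ k + 1 : ℕ) : ℝ) ≤ U P (2 ^ k) := by
    rw [U]
    calc ((2 ^ k + 1 : ℕ) : ℝ) = ∑ i ∈ Finset.range (2 ^ k + 1), (1 : ℝ) := by simp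
      _ ≤ _ := Finset.sum_le_sum fun i _ => h2 i
  rw [one_mul, Real.rpow_natCast] at hk
  push_cast at h4
  linarith

end IsRenewalMeasure

end

/-! ### The observations given the renewal process -/

theorem measurable_X : Measurable X := by
  refine measurable_pi_lambda _ fun n => ?_
  refine Measurable.ite ?_ ((measurable_pi_apply n).comp measurable_snd.fst)
    ((measurable_pi_apply n).comp measurable_fst)
  exact measurable_snd.snd (measurableSet_renewalAt n)

/-- The bias of the `n`-th observation given the renewal process. -/
def bias (θ : ℝ) (δ : BinSeq) (n : ℕ) : ℝ := if δ n = true then θ else 0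

/-- The law of the observations given the renewal process. -/
def coinLaw (θ : ℝ) (δ : BinSeq) : Measure (ℕ → ℝ) := Measure.infinitePi fun n => coin (bias θ δ n)

theorem isProbabilityMeasure_coin_bias {θ : ℝ} (hθ : θ ∈ Icc (0 : ℝ) 1) (δ : BinSeq) (n : ℕ) :
    IsProbabilityMeasure (coin (bias θ δ n)) := by
  refine isProbabilityMeasure_coin ?_
  rw [bias]
  split_ifs
  · exact ⟨by linarith [hθ.1], hθ.2⟩
  · constructor <;> norm_num

theorem isProbabilityMeasure_coinLaw {θ : ℝ} (hθ : θ ∈ Icc (0 : ℝ) 1) (δ : BinSeq) :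
    IsProbabilityMeasure (coinLaw θ δ) := by
  have := isProbabilityMeasure_coin_bias hθ δ
  rw [coinLaw]; infer_instance

theorem isProbabilityMeasure_coin_of_mem {θ : ℝ} (hθ : θ ∈ Icc (0 : ℝ) 1) :
    IsProbabilityMeasure (coin θ) :=
  isProbabilityMeasure_coin ⟨by linarith [hθ.1], hθ.2⟩

/-- Given the renewal process, the observations are independent coins of bias `θ` at the renewals
and `0` elsewhere. -/
theorem map_X_eq_coinLaw {θ : ℝ} (hθ : θ ∈ Icc (0 : ℝ) 1) (δ : BinSeq) :
    ((Measure.infinitePi fun _ : ℕ => coin 0).prod (Measure.infinitePi fun _ : ℕ => coin θ)).map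
      (fun p => X (p.1, p.2, δ)) = coinLaw θ δ := by
  have := isProbabilityMeasure_coin_bias hθ δ
  have h0 := isProbabilityMeasure_coin_of_mem (θ := 0) (by simp)
  have h1 := isProbabilityMeasure_coin_of_mem hθ
  have hm : Measurable fun p : (ℕ → ℝ) × (ℕ → ℝ) => X (p.1, p.2, δ) :=
    measurable_X.comp (by fun_prop)
  refine Measure.eq_infinitePi _ fun s t ht => ?_
  rw [Measure.map_apply hm (MeasurableSet.pi s.countable_toSet fun i _ => ht i)]
  have hpre : (fun p : (ℕ → ℝ) × (ℕ → ℝ) => X (p.1, p.2, δ)) ⁻¹' (s : Set ℕ).pi t =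
      ((s.filter fun i => ¬ δ i = true : Finset ℕ) : Set ℕ).pi t ×ˢ
        ((s.filter fun i => δ i = true : Finset ℕ) : Set ℕ).pi t := by
    ext p
    simp only [mem_preimage, Set.mem_pi, mem_prod, Finset.coe_filter, mem_ofPred_eq,
      Finset.mem_coe]
    constructor
    · intro h
      exact ⟨fun i hi => by simpa [X, hi.2] using h i hi.1,
        fun i hi => by simpa [X, hi.2] using h i hi.1⟩
    · rintro ⟨h, h'⟩ i hi
      by_cases hd : δ i = true
      · simpa [X, hd] using h' i ⟨hi, hd⟩
      · simpa [X, hd] using h i ⟨hi, hd⟩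
  rw [hpre, Measure.prod_prod, Measure.infinitePi_pi _ fun i _ => ht i,
    Measure.infinitePi_pi _ fun i _ => ht i, mul_comm,
    ← Finset.prod_filter_mul_prod_filter_not s (fun i => δ i = true)]
  congr 1
  · exact Finset.prod_congr rfl fun i hi => by simp [bias, (Finset.mem_filter.1 hi).2]
  · exact Finset.prod_congr rfl fun i hi => by simp [bias, (Finset.mem_filter.1 hi).2]

/-- The joint law of the observations and the renewal process, disintegrated along the latter. -/
theorem Q_apply {P : Measure BinSeq} [IsProbabilityMeasure P] {θ : ℝ} (hθ : θ ∈ Icc (0 : ℝ) 1)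
    {E : Set ((ℕ → ℝ) × BinSeq)} (hE : MeasurableSet E) :
    Q P θ {ω | (X ω, ω.2.2) ∈ E} = ∫⁻ δ, coinLaw θ δ {x | (x, δ) ∈ E} ∂P := by
  have h0 := isProbabilityMeasure_coin_of_mem (θ := 0) (by simp)
  have h1 := isProbabilityMeasure_coin_of_mem hθ
  have hX : Measurable fun ω : Sample => (X ω, ω.2.2) :=
    measurable_X.prodMk measurable_snd.snd
  have hA : MeasurableSet {ω : Sample | (X ω, ω.2.2) ∈ E} := hX hE
  rw [Q, ← Measure.prodAssoc_prod, Measure.map_apply (MeasurableEquiv.measurable _) hA,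
    Measure.prod_apply_symm (MeasurableEquiv.measurable _ hA)]
  refine lintegral_congr fun δ => ?_
  have hXδ : Measurable fun p : (ℕ → ℝ) × (ℕ → ℝ) => X (p.1, p.2, δ) :=
    measurable_X.comp (by fun_prop)
  have hEδ : MeasurableSet {x | (x, δ) ∈ E} := measurable_prodMk_right hE
  rw [← map_X_eq_coinLaw hθ δ, Measure.map_apply hXδ hEδ]
  rfl

theorem isProbabilityMeasure_Q {P : Measure BinSeq} [IsProbabilityMeasure P] {θ : ℝ}
    (hθ : θ ∈ Icc (0 : ℝ) 1) : IsProbabilityMeasure (Q P θ) := by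
  have h0 := isProbabilityMeasure_coin_of_mem (θ := 0) (by simp)
  have h1 := isProbabilityMeasure_coin_of_mem hθ
  rw [Q]; infer_instance

/-- The event that all observations in `F` are heads. -/
def heads (F : Finset ℕ) : Set (ℕ → ℝ) := {x | ∀ i ∈ F, x i = 1}

theorem heads_eq_pi (F : Finset ℕ) : heads F = (F : Set ℕ).pi fun _ => {1} := by
  ext x; simp [heads]

theorem measurableSet_heads (F : Finset ℕ) : MeasurableSet (heads F) := by
  rw [heads_eq_pi]
  exact MeasurableSet.pi F.countable_toSet fun i _ => measurableSet_singleton 1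

theorem coin_one (θ : ℝ) : coin θ {1} = ENNReal.ofReal ((1 + θ) / 2) := by
  have : (-1 : ℝ) ≠ 1 := by norm_num
  simp [coin, this]

theorem coinLaw_heads {θ : ℝ} (hθ : θ ∈ Icc (0 : ℝ) 1) (δ : BinSeq) (F : Finset ℕ) :
    coinLaw θ δ (heads F) = ∏ i ∈ F, ENNReal.ofReal ((1 + bias θ δ i) / 2) := by
  have := isProbabilityMeasure_coin_bias hθ δ
  rw [coinLaw, heads_eq_pi, Measure.infinitePi_pi _ fun i _ => measurableSet_singleton 1]
  simp [coin_one]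

/-- Given the renewal process, a window of length `m` with `k` renewals consists of heads with
probability `2^{-m} (1+θ)^k`. -/
theorem coinLaw_heads_Ioc {θ : ℝ} (hθ : θ ∈ Icc (0 : ℝ) 1) (δ : BinSeq) (n m : ℕ) :
    coinLaw θ δ (heads (Finset.Ioc n (n + m))) =
      ENNReal.ofReal ((1 / 2) ^ m * (1 + θ) ^ cnt (shift n δ) m) := by
  have hθ0 := hθ.1
  rw [coinLaw_heads hθ]
  induction m with
  | zero => simp
  | succ m ih =>
    rw [← add_assoc, ← Finset.insert_Ioc_right_eq_Ioc_add_one (by omega),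
      Finset.prod_insert (by simp), ih, cnt_succ, ← ENNReal.ofReal_mul]
    · congr 1
      have h1 : shift n δ (m + 1) = δ (n + m + 1) := rfl
      rw [h1, bias]
      split_ifs
      · ring
      · ring
    · rw [bias]; split_ifs <;> linarith

/-- Runs of heads in disjoint windows are independent given the renewal process. -/
theorem coinLaw_biInter_heads_compl {θ : ℝ} (hθ : θ ∈ Icc (0 : ℝ) 1) (δ : BinSeq)
    (F : ℕ → Finset ℕ) (s : Finset ℕ) (hF : Pairwise (Function.onFun Disjoint F)) :
    coinLaw θ δ (⋂ i ∈ s, (heads (F i))ᶜ) = ∏ i ∈ s, (1 - coinLaw θ δ (heads (F i))) := by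
  have := isProbabilityMeasure_coinLaw hθ δ
  have hind : ProbabilityTheory.iIndepSet (fun i => heads (F i)) (coinLaw θ δ) := by
    rw [ProbabilityTheory.iIndepSet_iff_meas_biInter fun i => measurableSet_heads (F i)]
    intro s
    have h1 : ⋂ i ∈ s, heads (F i) = heads (s.biUnion F) := by
      ext x
      simp only [heads, mem_iInter, mem_ofPred_eq, Finset.mem_biUnion]
      exact ⟨fun h i ⟨j, hj, hi⟩ => h j hj i hi, fun h j hj i hi => h i ⟨j, hj, hi⟩⟩
    rw [h1, coinLaw_heads hθ, Finset.prod_biUnion fun i _ j _ hij => hF hij]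
    exact Finset.prod_congr rfl fun i _ => (coinLaw_heads hθ δ (F i)).symm
  have h2 := ProbabilityTheory.iIndep.meas_biInter (S := s)
    (s := fun i => (heads (F i))ᶜ) hind fun i _ =>
      (MeasurableSpace.measurableSet_generateFrom (mem_singleton _)).compl
  rw [h2]
  exact Finset.prod_congr rfl fun i _ => prob_compl_eq_one_sub (measurableSet_heads (F i))

/-! ### Runs -/

theorem le_R_iff (x : ℕ → ℝ) (n m : ℕ) :
    (m : ℕ∞) ≤ R x n ↔ x ∈ heads (Finset.Ioc n (n + m)) := by
  have h1 : x ∈ heads (Finset.Ioc n (n + m)) ↔ ∀ j ∈ Finset.Icc 1 m, x (n + j) = 1 := by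
    simp only [heads, mem_ofPred_eq, Finset.mem_Ioc, Finset.mem_Icc]
    constructor
    · intro h j hj
      exact h _ ⟨by omega, by omega⟩
    · intro h i hi
      have := h (i - n) ⟨by omega, by omega⟩
      rwa [Nat.add_sub_cancel' hi.1.le] at this
  rw [h1]
  constructor
  · intro h
    by_contra hc
    push Not at hc
    obtain ⟨j, hj, hx⟩ := hc
    have hj' := Finset.mem_Icc.1 hj
    have h2 : R x n ≤ ((j - 1 : ℕ) : ℕ∞) := by
      refine iSup₂_le fun k hk => ?_
      rw [Nat.cast_le]
      by_contra hkj
      exact hx (hk j (Finset.mem_Icc.2 ⟨hj'.1, by omega⟩))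
    have h3 := h.trans h2
    rw [Nat.cast_le] at h3
    omega
  · intro h
    exact le_iSup₂ (f := fun (m : ℕ) (_ : ∀ j ∈ Finset.Icc 1 m, x (n + j) = 1) => (m : ℕ∞)) m h

theorem le_R_of_le {x : ℕ → ℝ} {n n' m : ℕ} (h : (m : ℕ∞) ≤ R x n) (hn : n ≤ n') :
    ((m - (n' - n) : ℕ) : ℕ∞) ≤ R x n' := by
  rw [le_R_iff] at h ⊢
  intro i hi
  rw [Finset.mem_Ioc] at hi
  exact h i (Finset.mem_Ioc.2 ⟨by omega, by omega⟩)

theorem measurable_R (n : ℕ) : Measurable fun x => R x n := by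
  have hle : ∀ m : ℕ, {x | (m : ℕ∞) ≤ R x n} = heads (Finset.Ioc n (n + m)) := fun m => by
    ext x; exact le_R_iff x n m
  refine measurable_to_countable' fun m => ?_
  induction m using ENat.recTopCoe with
  | top =>
    have : (fun x => R x n) ⁻¹' {⊤} = ⋂ m : ℕ, {x | (m : ℕ∞) ≤ R x n} := by
      ext x
      simp only [mem_preimage, mem_singleton_iff, mem_iInter, mem_ofPred_eq]
      exact ⟨fun h m => h ▸ le_top, fun h => ENat.eq_top_iff_forall_ge.2 h⟩
    rw [this]
    exact MeasurableSet.iInter fun m => hle m ▸ measurableSet_heads _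
  | coe m =>
    have : (fun x => R x n) ⁻¹' {(m : ℕ∞)} =
        {x | (m : ℕ∞) ≤ R x n} \ {x | ((m + 1 : ℕ) : ℕ∞) ≤ R x n} := by
      ext x
      simp only [mem_preimage, mem_singleton_iff, Set.mem_sdiff, mem_ofPred_eq, not_le, Nat.cast_add,
        Nat.cast_one, ENat.lt_natCast_add_one_iff]
      exact ⟨fun h => ⟨h.ge, h.le⟩, fun h => le_antisymm h.2 h.1⟩
    rw [this, hle, hle]
    exact (measurableSet_heads _).diff (measurableSet_heads _)

theorem measurable_Rhat : Measurable Rhat := by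
  refine Measurable.limsup fun n => ?_
  refine Measurable.div_const ?_ _
  exact (measurable_of_countable (fun k : ℕ∞ => (k : ℝ≥0∞))).comp (measurable_R n)

/-- If for all large `m` a run of length `m` starts before time `2^{m/c}`, then `R̂ ≥ c`. -/
theorem le_Rhat_of_eventually {x : ℕ → ℝ} {c : ℝ} (hc : 0 < c)
    (h : ∀ᶠ m : ℕ in atTop, ∃ n : ℕ, (n : ℝ) ≤ 2 ^ (m / c) ∧ (m : ℕ∞) ≤ R x n) :
    ENNReal.ofReal c ≤ Rhat x := by
  by_contra! hlt
  have h1 := eventually_lt_of_limsup_lt hlt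
  obtain ⟨n₀, hn₀, h2⟩ : ∃ n₀ ≥ 2, ∀ n ≥ n₀,
      ((R x n : ℕ∞) : ℝ≥0∞) < ENNReal.ofReal (c * Real.logb 2 n) := by
    obtain ⟨n₁, hn₁⟩ := eventually_atTop.1 h1
    refine ⟨max n₁ 2, le_max_right _ _, fun n hn => ?_⟩
    have hn2 : 2 ≤ n := (le_max_right _ _).trans hn
    have hlog : 0 < Real.logb 2 n :=
      Real.logb_pos (by norm_num) (by exact_mod_cast hn2)
    have h3 := hn₁ n ((le_max_left _ _).trans hn)
    rw [ENNReal.div_lt_iff (.inl (by simpa using hlog)) (.inl ENNReal.ofReal_ne_top)] at h3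
    rwa [ENNReal.ofReal_mul hc.le]
  have h4 : ∀ {m n : ℕ}, n₀ ≤ n → (m : ℕ∞) ≤ R x n → (m : ℝ) < c * Real.logb 2 n := by
    intro m n hn hm
    have h5 : ((m : ℕ∞) : ℝ≥0∞) ≤ ((R x n : ℕ∞) : ℝ≥0∞) := ENat.toENNReal_le.2 hm
    have h6 := h5.trans_lt (h2 n hn)
    rwa [ENat.toENNReal_coe, ENNReal.natCast_lt_ofReal] at h6
  obtain ⟨M, hM⟩ := exists_nat_gt (c * Real.logb 2 n₀)
  obtain ⟨m, hm, n, hn, hR⟩ := ((eventually_ge_atTop (M + n₀)).and h).exists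
  rcases le_or_gt n₀ n with hnn | hnn
  · have h5 := h4 hnn hR
    have hn0 : (0 : ℝ) < n := by
      have : 0 < n := by omega
      exact_mod_cast this
    have h6 : Real.logb 2 n ≤ m / c := by
      rw [Real.logb_le_iff_le_rpow (by norm_num) hn0]; exact hn
    rw [le_div_iff₀ hc] at h6
    linarith
  · have h5 := h4 le_rfl (le_R_of_le hR hnn.le)
    have h6 : (M : ℝ) ≤ ((m - (n₀ - n) : ℕ) : ℝ) := by
      have : M ≤ m - (n₀ - n) := by omega
      exact_mod_cast this
    linarith

/-! ### The upper bound for the longest runs -/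

/-- Borel–Cantelli, for real bounds on the probabilities that hold eventually. -/
theorem ae_eventually_notMem_of_le {α : Type*} [MeasurableSpace α] {μ : Measure α}
    [IsFiniteMeasure μ] {B : ℕ → Set α} {b : ℕ → ℝ} (hb : Summable b)
    (h : ∀ᶠ k in atTop, μ (B k) ≤ ENNReal.ofReal (b k)) :
    ∀ᵐ x ∂μ, ∀ᶠ k in atTop, x ∉ B k := by
  refine ae_eventually_notMem ?_
  obtain ⟨K, hK⟩ := eventually_atTop.1 h
  have h1 : ∑' k, μ (B (k + K)) ≠ ∞ := by
    refine ne_top_of_le_ne_top ?_ (ENNReal.tsum_le_tsum fun k => hK (k + K) (by omega))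
    exact ((summable_nat_add_iff K).2 hb).tsum_ofReal_ne_top
  rw [← ENNReal.summable.sum_add_tsum_nat_add' (k := K)]
  exact ENNReal.add_ne_top.2 ⟨ENNReal.sum_ne_top.2 fun k _ => measure_ne_top _ _, h1⟩

section

variable {P : Measure BinSeq}

theorem logb_one_add_mem {θ : ℝ} (hθ : θ ∈ Icc (0 : ℝ) 1) :
    Real.logb 2 (1 + θ) ∈ Icc (0 : ℝ) 1 := by
  have h0 := hθ.1
  have h1 := hθ.2
  refine ⟨Real.logb_nonneg (by norm_num) (by linarith), ?_⟩
  rw [Real.logb_le_iff_le_rpow (by norm_num) (by linarith), Real.rpow_one]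
  linarith

theorem two_rpow_logb_mul {θ : ℝ} (hθ : θ ∈ Icc (0 : ℝ) 1) (k : ℕ) :
    (2 : ℝ) ^ (Real.logb 2 (1 + θ) * k) = (1 + θ) ^ k := by
  have h0 := hθ.1
  rw [Real.rpow_mul (by norm_num), Real.rpow_logb (by norm_num) (by norm_num) (by linarith),
    Real.rpow_natCast]

theorem measurable_ofReal_pow_cnt (θ : ℝ) (m : ℕ) :
    Measurable fun δ : BinSeq => ENNReal.ofReal ((1 + θ) ^ cnt δ m) :=
  (measurable_of_countable fun k : ℕ => ENNReal.ofReal ((1 + θ) ^ k)).comp (measurable_cnt m)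

/-- Either there is no renewal in `(n, n + m]`, or there is a first one, after which the renewals
are counted by a shifted process. -/
theorem ofReal_pow_cnt_shift_le {θ : ℝ} (hθ : 0 ≤ θ) (δ : BinSeq) (n m : ℕ) :
    ENNReal.ofReal ((1 + θ) ^ cnt (shift n δ) m) ≤ 1 + ∑ j ∈ Finset.Icc 1 m,
      (renewalAt (n + j)).indicator (fun δ => ENNReal.ofReal (1 + θ) *
        ENNReal.ofReal ((1 + θ) ^ cnt (shift (n + j) δ) m)) δ := by
  rcases Nat.eq_zero_or_pos (cnt (shift n δ) m) with h | h
  · rw [h, pow_zero, ENNReal.ofReal_one]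
    exact le_self_add
  · obtain ⟨j, hjm, hj, hd⟩ := exists_cnt_eq (δ := shift n δ) (k := 1) (by simp) h
    have hj1 : 1 ≤ j := by
      rcases Nat.eq_zero_or_pos j with rfl | h'
      · simp at hj
      · exact h'
    refine le_trans ?_ le_add_self
    refine le_trans ?_ (Finset.single_le_sum (f := fun j => (renewalAt (n + j)).indicator
      (fun δ => ENNReal.ofReal (1 + θ) * ENNReal.ofReal ((1 + θ) ^ cnt (shift (n + j) δ) m)) δ)
      (fun _ _ => zero_le) (Finset.mem_Icc.2 ⟨hj1, hjm⟩))
    have hmem : δ ∈ renewalAt (n + j) := hd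
    rw [indicator_of_mem hmem, ← ENNReal.ofReal_mul (by linarith), ← pow_succ']
    refine ENNReal.ofReal_le_ofReal (pow_le_pow_right₀ (by linarith) ?_)
    have h1 := cnt_add (shift n δ) j (m - j)
    rw [Nat.add_sub_cancel' hjm, hj] at h1
    have h2 : shift j (shift n δ) = shift (n + j) δ := by
      funext i; simp [shift, add_assoc]
    rw [h1, h2, add_comm]
    exact Nat.add_le_add_right (cnt_mono _ (by omega)) 1

namespace IsRenewalMeasure

/-- The exponential moments of the renewal count are governed by `ψ(φ)`, `φ = log₂ (1 + θ)`. -/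
theorem one_add_pow_mul_cum_le (hP : IsRenewalMeasure P) (hU : Tendsto (U P) atTop atTop)
    {θ : ℝ} (hθ : θ ∈ Icc (0 : ℝ) 1) {k m : ℕ} (hk : k ≤ m) :
    (1 + θ) ^ k * cum P k m ≤ 2 ^ (psi P (Real.logb 2 (1 + θ)) * m) := by
  have hφ := (logb_one_add_mem hθ).1
  rcases Nat.eq_zero_or_pos k with rfl | hk0
  · rw [pow_zero, one_mul, hP.cum_zero]
    exact Real.one_le_rpow (by norm_num) (mul_nonneg (hP.psi_nonneg hU hφ) (by positivity))
  · rw [← two_rpow_logb_mul hθ]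
    exact hP.rpow_mul_cum_le_of_psiExt_le (hP.coe_psi hU hφ).ge hk0 hk

theorem measure_eq_ofReal (hP : IsRenewalMeasure P) (A : Set BinSeq) :
    P A = ENNReal.ofReal (P.real A) := by
  have := hP.isProbabilityMeasure
  rw [measureReal_def, ENNReal.ofReal_toReal (measure_ne_top _ _)]

/-- `E[(1+θ)^N] ≤ (m + 1) 2^{ψ(φ) m}`, where `N` is the number of renewals in `[1, m]`. -/
theorem lintegral_pow_cnt_le (hP : IsRenewalMeasure P) (hU : Tendsto (U P) atTop atTop)
    {θ : ℝ} (hθ : θ ∈ Icc (0 : ℝ) 1) (m : ℕ) :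
    ∫⁻ δ, ENNReal.ofReal ((1 + θ) ^ cnt δ m) ∂P ≤
      ENNReal.ofReal ((m + 1) * 2 ^ (psi P (Real.logb 2 (1 + θ)) * m)) := by
  have h0 := hθ.1
  calc ∫⁻ δ, ENNReal.ofReal ((1 + θ) ^ cnt δ m) ∂P
      ≤ ∫⁻ δ, ∑ k ∈ Finset.range (m + 1), ENNReal.ofReal ((1 + θ) ^ k) *
          {δ | k ≤ cnt δ m}.indicator 1 δ ∂P := by
        refine lintegral_mono fun δ => ?_
        have hmem : δ ∈ {δ' | cnt δ m ≤ cnt δ' m} := le_refl (cnt δ m)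
        refine le_trans ?_ (Finset.single_le_sum (f := fun k => ENNReal.ofReal ((1 + θ) ^ k) *
          {δ | k ≤ cnt δ m}.indicator 1 δ) (fun _ _ => zero_le)
          (Finset.mem_range.2 (Nat.lt_succ_of_le (cnt_le δ m))))
        dsimp only
        rw [indicator_of_mem hmem, Pi.one_apply, mul_one]
    _ = ∑ k ∈ Finset.range (m + 1), ENNReal.ofReal ((1 + θ) ^ k * cum P k m) := by
        rw [lintegral_finsetSum _ fun k _ =>
          (measurable_one.indicator (measurableSet_le_cnt k m)).const_mul _]
        refine Finset.sum_congr rfl fun k _ => ?_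
        rw [lintegral_const_mul _ (measurable_one.indicator (measurableSet_le_cnt k m)),
          lintegral_indicator_one (measurableSet_le_cnt k m), hP.measure_eq_ofReal,
          ← ENNReal.ofReal_mul (by positivity)]
        rfl
    _ ≤ ∑ k ∈ Finset.range (m + 1),
          ENNReal.ofReal (2 ^ (psi P (Real.logb 2 (1 + θ)) * m)) := by
        refine Finset.sum_le_sum fun k hk => ENNReal.ofReal_le_ofReal ?_
        exact hP.one_add_pow_mul_cum_le hU hθ (Nat.lt_succ_iff.1 (Finset.mem_range.1 hk))
    _ = _ := by
        rw [Finset.sum_const, Finset.card_range, nsmul_eq_mul, ENNReal.ofReal_mul (by positivity)]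
        congr 1
        rw [← Nat.cast_add_one, ENNReal.ofReal_natCast]

theorem Q_le_R_eq (hP : IsRenewalMeasure P) {θ : ℝ} (hθ : θ ∈ Icc (0 : ℝ) 1) (n m : ℕ) :
    Q P θ {ω | (m : ℕ∞) ≤ R (X ω) n} =
      ∫⁻ δ, ENNReal.ofReal ((1 / 2) ^ m * (1 + θ) ^ cnt (shift n δ) m) ∂P := by
  have := hP.isProbabilityMeasure
  have hE : MeasurableSet {p : (ℕ → ℝ) × BinSeq | p.1 ∈ heads (Finset.Ioc n (n + m))} :=
    measurable_fst (measurableSet_heads _)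
  have h := Q_apply (P := P) hθ hE
  simp only [mem_ofPred_eq, ← le_R_iff] at h
  rw [h]
  refine lintegral_congr fun δ => ?_
  simp only [le_R_iff]
  exact coinLaw_heads_Ioc hθ δ n m

/-- A run of length `m` after time `n` costs `2^{-m}`, unless there is a renewal close to `n`, in
which case the factor `2^{ψ(φ) m}` is gained. -/
theorem Q_le_R_le (hP : IsRenewalMeasure P) (hU : Tendsto (U P) atTop atTop) {θ : ℝ}
    (hθ : θ ∈ Icc (0 : ℝ) 1) (n m : ℕ) :
    Q P θ {ω | (m : ℕ∞) ≤ R (X ω) n} ≤ ENNReal.ofReal ((1 / 2) ^ m * (1 +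
      2 * ((m + 1) * 2 ^ (psi P (Real.logb 2 (1 + θ)) * m)) *
        ∑ j ∈ Finset.Icc 1 m, u P (n + j))) := by
  have hθ0 := hθ.1
  have hθ1 := hθ.2
  have := hP.isProbabilityMeasure
  set H : ℝ := (m + 1) * 2 ^ (psi P (Real.logb 2 (1 + θ)) * m) with hH
  have hH0 : 0 ≤ H := by positivity
  have hmeas : ∀ j, Measurable fun δ : BinSeq => ENNReal.ofReal (1 + θ) *
      ENNReal.ofReal ((1 + θ) ^ cnt (shift (n + j) δ) m) := fun j =>
    ((measurable_ofReal_pow_cnt θ m).comp (measurable_shift (n + j))).const_mul _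
  have hmeas' : Measurable fun δ : BinSeq => ENNReal.ofReal ((1 + θ) ^ cnt (shift n δ) m) :=
    (measurable_ofReal_pow_cnt θ m).comp (measurable_shift n)
  rw [hP.Q_le_R_eq hθ]
  calc ∫⁻ δ, ENNReal.ofReal ((1 / 2) ^ m * (1 + θ) ^ cnt (shift n δ) m) ∂P
      = ENNReal.ofReal ((1 / 2) ^ m) *
          ∫⁻ δ, ENNReal.ofReal ((1 + θ) ^ cnt (shift n δ) m) ∂P := by
        rw [← lintegral_const_mul _ hmeas']
        exact lintegral_congr fun δ => ENNReal.ofReal_mul (by positivity)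
    _ ≤ ENNReal.ofReal ((1 / 2) ^ m) * ∫⁻ δ, (1 + ∑ j ∈ Finset.Icc 1 m,
          (renewalAt (n + j)).indicator (fun δ => ENNReal.ofReal (1 + θ) *
            ENNReal.ofReal ((1 + θ) ^ cnt (shift (n + j) δ) m)) δ) ∂P := by
        gcongr with δ
        exact ofReal_pow_cnt_shift_le hθ0 δ n m
    _ = ENNReal.ofReal ((1 / 2) ^ m) * (1 + ∑ j ∈ Finset.Icc 1 m,
          ENNReal.ofReal (1 + θ) * ENNReal.ofReal (u P (n + j)) *
            ∫⁻ δ, ENNReal.ofReal ((1 + θ) ^ cnt δ m) ∂P) := by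
        congr 1
        rw [lintegral_add_left measurable_const, lintegral_const, measure_univ, one_mul,
          lintegral_finsetSum _ fun j _ => (hmeas j).indicator (measurableSet_renewalAt _)]
        congr 1
        refine Finset.sum_congr rfl fun j _ => ?_
        rw [lintegral_indicator (measurableSet_renewalAt _),
          hP.lintegral_regeneration (n + j) (a := fun _ => ENNReal.ofReal (1 + θ))
          measurable_const (measurable_ofReal_pow_cnt θ m) (fun _ => rfl), setLIntegral_const,
          hP.measure_eq_ofReal]
        rfl
    _ ≤ ENNReal.ofReal ((1 / 2) ^ m) * (1 + ∑ j ∈ Finset.Icc 1 m,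
          ENNReal.ofReal 2 * ENNReal.ofReal (u P (n + j)) * ENNReal.ofReal H) := by
        gcongr with j
        · linarith
        · exact hP.lintegral_pow_cnt_le hU hθ m
    _ = _ := by
        rw [ENNReal.ofReal_mul (p := (1 / 2) ^ m) (by positivity), ENNReal.ofReal_add (by norm_num)
          (mul_nonneg (by positivity) (Finset.sum_nonneg fun _ _ => u_nonneg _)),
          ENNReal.ofReal_one, Finset.mul_sum, ENNReal.ofReal_sum_of_nonneg
          fun j _ => mul_nonneg (by positivity) (u_nonneg _)]
        congr 2
        refine Finset.sum_congr rfl fun j _ => ?_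
        rw [← ENNReal.ofReal_mul (by norm_num),
          ← ENNReal.ofReal_mul (mul_nonneg (by norm_num) (u_nonneg _))]
        congr 1
        ring

theorem sum_sum_u_le (N m : ℕ) :
    ∑ n ∈ Finset.range N, ∑ j ∈ Finset.Icc 1 m, u P (n + j) ≤ m * U P (N + m) := by
  rw [Finset.sum_comm]
  calc ∑ j ∈ Finset.Icc 1 m, ∑ n ∈ Finset.range N, u P (n + j)
      ≤ ∑ j ∈ Finset.Icc 1 m, U P (N + m) := by
        refine Finset.sum_le_sum fun j hj => ?_
        have h1 : ∑ n ∈ Finset.range N, u P (n + j) = ∑ n ∈ Finset.Ico j (N + j), u P n := by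
          rw [Finset.sum_Ico_eq_sum_range, Nat.add_sub_cancel]
          exact Finset.sum_congr rfl fun i _ => by rw [add_comm]
        rw [h1, U]
        refine Finset.sum_le_sum_of_subset_of_nonneg (fun i hi => ?_) fun _ _ _ => u_nonneg _
        rw [Finset.mem_Ico] at hi
        rw [Finset.mem_Icc] at hj
        rw [Finset.mem_range]
        omega
    _ = m * U P (N + m) := by simp

theorem Q_exists_le_R_le (hP : IsRenewalMeasure P) (hU : Tendsto (U P) atTop atTop) {θ : ℝ}
    (hθ : θ ∈ Icc (0 : ℝ) 1) (N m : ℕ) :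
    Q P θ {ω | ∃ n < N, (m : ℕ∞) ≤ R (X ω) n} ≤ ENNReal.ofReal ((1 / 2) ^ m * (N +
      2 * ((m + 1) * 2 ^ (psi P (Real.logb 2 (1 + θ)) * m)) * (m * U P (N + m)))) := by
  have h1 : {ω | ∃ n < N, (m : ℕ∞) ≤ R (X ω) n} =
      ⋃ n ∈ Finset.range N, {ω | (m : ℕ∞) ≤ R (X ω) n} := by
    ext ω; simp
  rw [h1]
  refine (measure_biUnion_finset_le _ _).trans
    ((Finset.sum_le_sum fun n _ => hP.Q_le_R_le hU hθ n m).trans ?_)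
  rw [← ENNReal.ofReal_sum_of_nonneg fun n _ => mul_nonneg (by positivity)
    (add_nonneg zero_le_one (mul_nonneg (by positivity) (Finset.sum_nonneg fun _ _ => u_nonneg _)))]
  refine ENNReal.ofReal_le_ofReal ?_
  rw [← Finset.mul_sum, Finset.sum_add_distrib, ← Finset.mul_sum]
  have := sum_sum_u_le (P := P) N m
  simp only [Finset.sum_const, Finset.card_range, nsmul_eq_mul, mul_one]
  gcongr

/-- The upper bound for the runs, by Borel–Cantelli along dyadic blocks of starting times: the
expected number of runs of length `c k` before `2^{k+1}` is of order
`2^{(1-c) k} + 2^{(1-γ) k} 2^{-c (1-ψ) k}`, up to subexponential factors. -/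
theorem ae_Rhat_le (hP : IsRenewalMeasure P) {γ : ℝ} (hγ : HasIndex P γ) (hγ1 : γ < 1) {θ : ℝ}
    (hθ : θ ∈ Icc (0 : ℝ) 1) {c : ℝ} (hc : 1 < c)
    (hcψ : 1 - γ < c * (1 - psi P (Real.logb 2 (1 + θ)))) (hψ : psi P (Real.logb 2 (1 + θ)) < 1) :
    ∀ᵐ ω ∂(Q P θ), Rhat (X ω) ≤ ENNReal.ofReal c := by
  have hU := hP.tendsto_U hγ hγ1
  set ψ := psi P (Real.logb 2 (1 + θ)) with hψdef
  obtain ⟨a, ha, hac⟩ := exists_between hcψ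
  have ha0 : 0 < a := by linarith
  -- the run length `c k` for starting times of order `2^k`
  let m : ℕ → ℕ := fun k => ⌈c * k⌉₊
  have hm1 : ∀ k, c * k ≤ m k := fun k => Nat.le_ceil _
  have hm2 : ∀ k, (m k : ℝ) ≤ c * k + 1 := fun k =>
    (Nat.ceil_lt_add_one (by positivity)).le
  let B : ℕ → Set Sample := fun k => {ω | ∃ n < 2 ^ (k + 1), ((m k : ℕ) : ℕ∞) ≤ R (X ω) n}
  let r₁ : ℝ := 2 ^ (1 - c)
  let r₂ : ℝ := 2 ^ (a - c * (1 - ψ))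
  have hr₁ : r₁ < 1 := Real.rpow_lt_one_of_one_lt_of_neg (by norm_num) (by linarith)
  have hr₂ : r₂ < 1 := Real.rpow_lt_one_of_one_lt_of_neg (by norm_num) (by linarith)
  have hr₁0 : 0 < r₁ := by positivity
  have hr₂0 : 0 < r₂ := by positivity
  let b : ℕ → ℝ := fun k => 2 * r₁ ^ k + (2 * 2 ^ (2 * a)) * ((2 * c ^ 2) * ((k : ℝ) ^ 2 * r₂ ^ k) +
    8 * r₂ ^ k)
  have hb : Summable b := by
    have h1 := summable_geometric_of_lt_one hr₁0.le hr₁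
    have h2 := summable_geometric_of_lt_one hr₂0.le hr₂
    have h3 : Summable fun k : ℕ => (k : ℝ) ^ 2 * r₂ ^ k :=
      summable_pow_mul_geometric_of_norm_lt_one 2 (by rwa [Real.norm_of_nonneg hr₂0.le])
    exact (h1.mul_left _).add (((h3.mul_left _).add (h2.mul_left _)).mul_left _)
  have hQ : ∀ᶠ k in atTop, Q P θ (B k) ≤ ENNReal.ofReal (b k) := by
    have hlarge : ∀ᶠ k : ℕ in atTop, c * k + 1 ≤ (2 : ℝ) ^ (k + 1) := by
      have h1 : Tendsto (fun k : ℕ => (k : ℝ) ^ 1 / 2 ^ k) atTop (𝓝 0) :=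
        tendsto_pow_const_div_const_pow_of_one_lt 1 (by norm_num)
      have h2 : Tendsto (fun k : ℕ => c * ((k : ℝ) ^ 1 / 2 ^ k)) atTop (𝓝 0) := by
        simpa using h1.const_mul c
      filter_upwards [h2.eventually_le_const (show (0 : ℝ) < 1 by norm_num)] with k hk
      have hpos : (0 : ℝ) < 2 ^ k := by positivity
      have h3 : (1 : ℝ) ≤ 2 ^ k := one_le_pow₀ (by norm_num)
      rw [pow_one, ← mul_div_assoc, div_le_one hpos] at hk
      rw [pow_succ]; linarith
    have hUle := (tendsto_add_atTop_nat 2).eventually (hP.eventually_U_le hγ ha)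
    filter_upwards [hlarge, hUle] with k hk hUk
    refine (hP.Q_exists_le_R_le hU hθ (2 ^ (k + 1)) (m k)).trans (ENNReal.ofReal_le_ofReal ?_)
    have hmle : m k ≤ 2 ^ (k + 1) := by
      have := (hm2 k).trans hk
      exact_mod_cast this
    have hU1 : U P (2 ^ (k + 1) + m k) ≤ 2 ^ (a * (k + 2)) := by
      refine (U_mono ?_).trans (by exact_mod_cast hUk)
      rw [pow_succ 2 (k + 1)]
      omega
    have hhalf : (1 / 2 : ℝ) ^ m k = 2 ^ (-(m k : ℝ)) := by
      rw [one_div, inv_pow, Real.rpow_neg (by norm_num), Real.rpow_natCast]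
    have hp1 : (1 / 2 : ℝ) ^ m k * 2 ^ (k + 1) ≤ 2 * r₁ ^ k := by
      rw [hhalf, pow_succ, ← Real.rpow_natCast 2 k, ← Real.rpow_natCast r₁ k,
        ← Real.rpow_mul (by norm_num)]
      calc (2 : ℝ) ^ (-(m k : ℝ)) * (2 ^ (k : ℝ) * 2) = 2 * 2 ^ (-(m k : ℝ) + k) := by
            rw [Real.rpow_add (by norm_num)]; ring
        _ ≤ 2 * 2 ^ ((1 - c) * k) := by
            gcongr
            · norm_num
            · linarith [hm1 k]
    have hp2 : (1 / 2 : ℝ) ^ m k * (2 ^ (ψ * m k) * 2 ^ (a * (k + 2))) ≤ 2 ^ (2 * a) * r₂ ^ k := by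
      rw [hhalf, ← Real.rpow_natCast r₂ k, ← Real.rpow_mul (by norm_num),
        ← Real.rpow_add (by norm_num), ← Real.rpow_add (by norm_num), ← Real.rpow_add (by norm_num)]
      refine Real.rpow_le_rpow_of_exponent_le (by norm_num) ?_
      nlinarith [mul_le_mul_of_nonneg_left (hm1 k) (show 0 ≤ 1 - ψ by linarith)]
    have hp3 : ((m k : ℝ) + 1) * m k ≤ 2 * c ^ 2 * k ^ 2 + 8 := by
      have h1 := hm2 k
      have h2 : (0 : ℝ) ≤ m k := by positivity
      nlinarith [sq_nonneg (c * k - 2)]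
    have hUnn : 0 ≤ U P (2 ^ (k + 1) + m k) := by linarith [hP.one_le_U (2 ^ (k + 1) + m k)]
    calc (1 / 2 : ℝ) ^ m k * (((2 ^ (k + 1) : ℕ) : ℝ) + 2 * ((m k + 1) * 2 ^ (ψ * m k)) *
          (m k * U P (2 ^ (k + 1) + m k)))
        ≤ (1 / 2 : ℝ) ^ m k * (((2 ^ (k + 1) : ℕ) : ℝ) + 2 * ((m k + 1) * 2 ^ (ψ * m k)) *
          (m k * 2 ^ (a * (k + 2)))) := by gcongr
      _ = (1 / 2 : ℝ) ^ m k * 2 ^ (k + 1) + 2 * (((m k : ℝ) + 1) * m k) *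
          ((1 / 2 : ℝ) ^ m k * (2 ^ (ψ * m k) * 2 ^ (a * (k + 2)))) := by push_cast; ring
      _ ≤ 2 * r₁ ^ k + 2 * (2 * c ^ 2 * k ^ 2 + 8) * (2 ^ (2 * a) * r₂ ^ k) := by gcongr
      _ = b k := by simp only [b]; ring
  have := hP.isProbabilityMeasure
  have := isProbabilityMeasure_Q (P := P) hθ
  filter_upwards [ae_eventually_notMem_of_le hb hQ] with ω hω
  refine limsup_le_of_le (by isBoundedDefault) ?_
  have hlog : Tendsto (fun n : ℕ => Nat.log 2 n) atTop atTop :=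
    tendsto_atTop.2 fun b => by
      filter_upwards [eventually_ge_atTop (2 ^ b)] with n hn
      exact Nat.le_log_of_pow_le (by norm_num) hn
  filter_upwards [hlog.eventually hω, eventually_ge_atTop 2] with n hn hn2
  have hlt : n < 2 ^ (Nat.log 2 n + 1) := Nat.lt_pow_succ_log_self (by norm_num) n
  have h1 : R (X ω) n < (m (Nat.log 2 n) : ℕ∞) := by
    by_contra! hc'
    exact hn ⟨n, hlt, hc'⟩
  obtain ⟨l, hl⟩ := ENat.ne_top_iff_exists.1 (h1.trans_le le_top).ne
  rw [← hl, Nat.cast_lt, Nat.lt_ceil] at h1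
  have hn0 : (0 : ℝ) < n := by positivity
  have hlogpos : 0 < Real.logb 2 n := Real.logb_pos (by norm_num) (by exact_mod_cast hn2)
  have h2 : (Nat.log 2 n : ℝ) ≤ Real.logb 2 n := by
    rw [Real.le_logb_iff_rpow_le (by norm_num) hn0, Real.rpow_natCast]
    exact_mod_cast Nat.pow_log_le_self 2 (by omega)
  have h3 : (l : ℝ) ≤ c * Real.logb 2 n := h1.le.trans (by gcongr)
  rw [← hl, ENat.toENNReal_coe]
  refine ENNReal.div_le_of_le_mul ?_
  rw [← ENNReal.ofReal_mul (by linarith), ← ENNReal.ofReal_natCast]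
  exact ENNReal.ofReal_le_ofReal h3

end IsRenewalMeasure

end

/-! ### The lower bound for the longest runs -/

/-- The `j`-th renewal time, as a natural number (`0` if it is infinite). -/
def pos (δ : BinSeq) (j : ℕ) : ℕ := (S δ j).toNat

/-- There is a renewal at time `0`, and there are infinitely many renewals. -/
def Recurrent (δ : BinSeq) : Prop := δ 0 = true ∧ ∀ j, ∃ n, j ≤ cnt δ n

theorem pos_eq {δ : BinSeq} (h0 : δ 0 = true) {j n : ℕ} (h : cnt δ n = j) (hn : δ n = true) :
    pos δ j = n := by
  rw [pos, (S_eq_iff h0 j n).2 ⟨h, hn⟩, ENat.toNat_natCast]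

theorem pos_zero (δ : BinSeq) : pos δ 0 = 0 := rfl

theorem pos_le {δ : BinSeq} {j n : ℕ} (h : j ≤ cnt δ n) : pos δ j ≤ n :=
  ENat.toNat_le_of_le_natCast ((S_le_iff δ j n).2 h)

theorem Recurrent.cnt_pos {δ : BinSeq} (h : Recurrent δ) (j : ℕ) :
    cnt δ (pos δ j) = j ∧ δ (pos δ j) = true := by
  obtain ⟨n, hn⟩ := h.2 j
  obtain ⟨i, -, h1, h2⟩ := exists_cnt_eq (fun _ => h.1) hn
  rw [pos_eq h.1 h1 h2]
  exact ⟨h1, h2⟩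

theorem Recurrent.shift {δ : BinSeq} (h : Recurrent δ) {n : ℕ} (hn : δ n = true) :
    Recurrent (shift n δ) := by
  refine ⟨hn, fun j => ?_⟩
  obtain ⟨N, hN⟩ := h.2 (n + j)
  refine ⟨N, ?_⟩
  have h1 := cnt_add δ n N
  have h2 := cnt_mono δ (show N ≤ n + N by omega)
  have h3 := cnt_le δ n
  omega

theorem Recurrent.pos_add {δ : BinSeq} (h : Recurrent δ) (a b : ℕ) :
    pos δ (a + b) = pos δ a + pos (RandomCoin.shift (pos δ a) δ) b := by
  obtain ⟨h1, h2⟩ := h.cnt_pos a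
  obtain ⟨h3, h4⟩ := (h.shift h2).cnt_pos b
  refine pos_eq h.1 ?_ h4
  rw [cnt_add, h1, h3]

theorem Recurrent.pos_add_le {δ : BinSeq} (h : Recurrent δ) {a b m : ℕ} (hab : a + m ≤ b) :
    pos δ a + m ≤ pos δ b := by
  obtain ⟨c, rfl⟩ := Nat.exists_eq_add_of_le ((Nat.le_add_right a m).trans hab)
  rw [h.pos_add]
  obtain ⟨h3, -⟩ := (h.shift (h.cnt_pos a).2).cnt_pos c
  have := cnt_le (RandomCoin.shift (pos δ a) δ) (pos (RandomCoin.shift (pos δ a) δ) c)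
  omega

theorem measurable_pos (j : ℕ) : Measurable fun δ => pos δ j := by
  have hle : ∀ n : ℕ, MeasurableSet {δ : BinSeq | S δ j ≤ n} := fun n => by
    simp only [S_le_iff]; exact measurableSet_le_cnt j n
  have hS : Measurable fun δ : BinSeq => S δ j := by
    refine measurable_to_countable' fun m => ?_
    induction m using ENat.recTopCoe with
    | top =>
      have : (fun δ => S δ j) ⁻¹' {⊤} = ⋂ n : ℕ, {δ | S δ j ≤ n}ᶜ := by
        ext δ
        simp only [mem_preimage, mem_singleton_iff, mem_iInter, mem_compl_iff, mem_ofPred_eq, not_le]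
        exact ENat.eq_top_iff_forall_gt
      rw [this]
      exact MeasurableSet.iInter fun n => (hle n).compl
    | coe m =>
      have : (fun δ => S δ j) ⁻¹' {(m : ℕ∞)} =
          {δ | S δ j ≤ m} \ ⋃ n < m, {δ : BinSeq | S δ j ≤ n} := by
        ext δ
        simp only [mem_preimage, mem_singleton_iff, Set.mem_sdiff, mem_iUnion, mem_ofPred_eq,
          not_exists, not_le]
        constructor
        · intro h; rw [h]; exact ⟨le_rfl, fun n hn => by exact_mod_cast hn⟩
        · rintro ⟨h, h'⟩
          obtain ⟨n, hn⟩ := ENat.ne_top_iff_exists.1 (ne_top_of_le_ne_top (ENat.natCast_ne_top m) h)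
          rw [← hn] at h h' ⊢
          rw [Nat.cast_le] at h
          rcases h.lt_or_eq with hlt | rfl
          · exact absurd (h' n hlt) (lt_irrefl _)
          · rfl
      rw [this]
      exact (hle m).diff (MeasurableSet.iUnion fun n => MeasurableSet.iUnion fun _ => hle n)
  exact (measurable_of_countable ENat.toNat).comp hS

theorem measurable_shift_pos (j : ℕ) : Measurable fun δ => shift (pos δ j) δ := by
  have h : Measurable fun p : ℕ × BinSeq => shift p.1 p.2 :=
    measurable_from_prod_countable_right fun n => measurable_shift n
  exact h.comp ((measurable_pos j).prodMk measurable_id)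

section

variable {P : Measure BinSeq}

namespace IsRenewalMeasure

theorem ae_recurrent (hP : IsRenewalMeasure P) (hU : Tendsto (U P) atTop atTop) :
    ∀ᵐ δ ∂P, Recurrent δ := by
  have := hP.isProbabilityMeasure
  refine hP.ae_zero.and (ae_all_iff.2 fun j => ?_)
  have hm : MeasurableSet {δ : BinSeq | ∃ n, j ≤ cnt δ n} := by
    rw [show {δ : BinSeq | ∃ n, j ≤ cnt δ n} = ⋃ n, {δ | j ≤ cnt δ n} by ext; simp]
    exact MeasurableSet.iUnion fun n => measurableSet_le_cnt j n
  have h1 : (1 : ℝ) ≤ P.real {δ | ∃ n, j ≤ cnt δ n} :=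
    le_of_tendsto' (hP.tendsto_cum hU j) fun n => measureReal_mono fun δ hδ => ⟨n, hδ⟩
  have h2 : P {δ | ∃ n, j ≤ cnt δ n} = 1 := by
    refine le_antisymm prob_le_one ?_
    rw [hP.measure_eq_ofReal, ← ENNReal.ofReal_one]
    exact ENNReal.ofReal_le_ofReal h1
  exact (prob_compl_eq_zero_iff hm).2 h2

/-- Functionals of successive stretches of `m` renewals multiply in expectation. -/
theorem lintegral_prod_shift_pos_le (hP : IsRenewalMeasure P) (hU : Tendsto (U P) atTop atTop)
    {m : ℕ} {h : BinSeq → ℝ≥0∞} (hm : Measurable h) (hh : ∀ n ≥ m, ∀ δ, h (trunc n δ) = h δ)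
    (I : ℕ) : ∫⁻ δ, ∏ i ∈ Finset.range I, h (shift (pos δ (i * m)) δ) ∂P ≤ (∫⁻ δ, h δ ∂P) ^ I := by
  have := hP.isProbabilityMeasure
  induction I with
  | zero => simp
  | succ I ih =>
    set V : BinSeq → ℝ≥0∞ := fun δ => ∏ i ∈ Finset.range I, h (shift (pos δ (i * m)) δ) with hV
    have hVm : Measurable V :=
      Finset.measurable_fun_prod _ fun i _ => hm.comp (measurable_shift_pos (i * m))
    have ham : ∀ n, Measurable ({δ : BinSeq | cnt δ n = m}.indicator h) := fun n =>
      hm.indicator (measurableSet_cnt_eq m n)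
    have han : ∀ n δ, {δ : BinSeq | cnt δ n = m}.indicator h (trunc n δ) =
        {δ : BinSeq | cnt δ n = m}.indicator h δ := by
      intro n δ
      by_cases hc : cnt δ n = m
      · have h1 : trunc n δ ∈ {δ : BinSeq | cnt δ n = m} := (cnt_trunc δ le_rfl).trans hc
        rw [indicator_of_mem h1, indicator_of_mem (show δ ∈ {δ : BinSeq | cnt δ n = m} from hc)]
        exact hh n (hc ▸ cnt_le δ n) δ
      · have h1 : trunc n δ ∉ {δ : BinSeq | cnt δ n = m} := fun h' =>
          hc ((cnt_trunc δ le_rfl).symm.trans h')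
        rw [indicator_of_notMem h1,
          indicator_of_notMem (show δ ∉ {δ : BinSeq | cnt δ n = m} from hc)]
    calc ∫⁻ δ, ∏ i ∈ Finset.range (I + 1), h (shift (pos δ (i * m)) δ) ∂P
        ≤ ∫⁻ δ, ∑' n, (renewalAt n).indicator
            (fun δ => {δ : BinSeq | cnt δ n = m}.indicator h δ * V (shift n δ)) δ ∂P := by
          refine lintegral_mono_ae ?_
          filter_upwards [hP.ae_recurrent hU] with δ hδ
          obtain ⟨h1, h2⟩ := hδ.cnt_pos m
          refine le_trans (le_of_eq ?_) (ENNReal.le_tsum (pos δ m))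
          rw [indicator_of_mem (show δ ∈ renewalAt (pos δ m) from h2),
            indicator_of_mem (show δ ∈ {δ' : BinSeq | cnt δ' (pos δ m) = m} from h1),
            Finset.prod_range_succ', zero_mul, pos_zero, mul_comm]
          congr 1
          · congr 1; funext i; simp [shift]
          · refine Finset.prod_congr rfl fun i _ => ?_
            rw [add_mul, one_mul, add_comm (i * m), hδ.pos_add]
            congr 1
            funext l
            simp [shift, add_assoc]
      _ = ∑' n, (∫⁻ δ in hit m n, h δ ∂P) * ∫⁻ δ, V δ ∂P := by
          have hprod : ∀ n, Measurable ((renewalAt n).indicator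
              fun δ => {δ : BinSeq | cnt δ n = m}.indicator h δ * V (shift n δ)) := fun n =>
            ((ham n).mul (hVm.comp (measurable_shift n))).indicator (measurableSet_renewalAt n)
          rw [lintegral_tsum fun n => (hprod n).aemeasurable]
          refine tsum_congr fun n => ?_
          rw [lintegral_indicator (measurableSet_renewalAt n),
            hP.lintegral_regeneration n (ham n) hVm (han n),
            lintegral_indicator (measurableSet_cnt_eq m n),
            Measure.restrict_restrict (measurableSet_cnt_eq m n)]
          rfl
      _ = (∫⁻ δ in ⋃ n, hit m n, h δ ∂P) * ∫⁻ δ, V δ ∂P := by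
          rw [ENNReal.tsum_mul_right, lintegral_iUnion (measurableSet_hit m)
            fun i j hij => disjoint_hit m hij]
      _ ≤ (∫⁻ δ, h δ ∂P) * (∫⁻ δ, h δ ∂P) ^ I := by
          gcongr
          exact Measure.restrict_le_self
      _ = _ := (pow_succ' _ _).symm

end IsRenewalMeasure

theorem measurableSet_forall_notMem_heads {s : ℕ → BinSeq → ℕ} (hs : ∀ i, Measurable (s i))
    (I m : ℕ) : MeasurableSet {p : (ℕ → ℝ) × BinSeq |
      ∀ i ∈ Finset.range I, p.1 ∉ heads (Finset.Ioc (s i p.2) (s i p.2 + m))} := by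
  have h1 : ∀ i, MeasurableSet {p : (ℕ → ℝ) × BinSeq |
      p.1 ∈ heads (Finset.Ioc (s i p.2) (s i p.2 + m))} := by
    intro i
    have : {p : (ℕ → ℝ) × BinSeq | p.1 ∈ heads (Finset.Ioc (s i p.2) (s i p.2 + m))} =
        ⋃ n, {p | s i p.2 = n} ∩ {p | p.1 ∈ heads (Finset.Ioc n (n + m))} := by
      ext p; simp
    rw [this]
    exact MeasurableSet.iUnion fun n =>
      (((hs i).comp measurable_snd) (measurableSet_singleton n)).inter
      (measurable_fst (measurableSet_heads _))
  have : {p : (ℕ → ℝ) × BinSeq |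
      ∀ i ∈ Finset.range I, p.1 ∉ heads (Finset.Ioc (s i p.2) (s i p.2 + m))} =
      ⋂ i ∈ Finset.range I, {p | p.1 ∈ heads (Finset.Ioc (s i p.2) (s i p.2 + m))}ᶜ := by
    ext p; simp
  rw [this]
  exact Finset.measurableSet_biInter _ fun i _ => (h1 i).compl

/-- The probability that none of the windows `(s_i, s_i + m]`, `i < I`, is a run of heads, where
the windows are disjoint and their starting points depend on the renewal process only. -/
theorem Q_forall_not_le_R {θ : ℝ} (hθ : θ ∈ Icc (0 : ℝ) 1) [IsProbabilityMeasure P]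
    {s : ℕ → BinSeq → ℕ} (hs : ∀ i, Measurable (s i)) {m : ℕ}
    (hsm : ∀ᵐ δ ∂P, ∀ i j, i < j → s i δ + m ≤ s j δ) (I : ℕ) :
    Q P θ {ω | ∀ i ∈ Finset.range I, ¬ (m : ℕ∞) ≤ R (X ω) (s i ω.2.2)} =
      ∫⁻ δ, ∏ i ∈ Finset.range I,
        (1 - ENNReal.ofReal ((1 / 2) ^ m * (1 + θ) ^ cnt (shift (s i δ) δ) m)) ∂P := by
  have h := Q_apply (P := P) hθ (measurableSet_forall_notMem_heads hs I m)
  simp only [mem_ofPred_eq, ← le_R_iff] at h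
  rw [h]
  refine lintegral_congr_ae ?_
  filter_upwards [hsm] with δ hδ
  have hdisj : Pairwise (Function.onFun Disjoint
      fun i => Finset.Ioc (s i δ) (s i δ + m)) := by
    intro i j hij
    rw [Function.onFun, Finset.disjoint_left]
    intro a ha hb
    rw [Finset.mem_Ioc] at ha hb
    rcases hij.lt_or_gt with hij | hij
    · have := hδ i j hij; omega
    · have := hδ j i hij; omega
  have h1 := coinLaw_biInter_heads_compl hθ δ _ (Finset.range I) hdisj
  simp only [coinLaw_heads_Ioc hθ] at h1
  rw [← h1]
  congr 1
  ext x
  simp [le_R_iff]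

/-- `I` independent trials with success probability `p` all fail with probability at most
`e^{-p I} ≤ 1 / (p I)`. -/
theorem one_sub_ofReal_pow_le {p : ℝ} (hp : 0 < p) {I : ℕ} (hI : 0 < I) :
    (1 - ENNReal.ofReal p) ^ I ≤ ENNReal.ofReal (1 / (p * I)) := by
  have h1 : 1 - ENNReal.ofReal p ≤ ENNReal.ofReal (Real.exp (-p)) := by
    rw [← ENNReal.ofReal_one, ← ENNReal.ofReal_sub _ hp.le]
    exact ENNReal.ofReal_le_ofReal (Real.one_sub_le_exp_neg p)
  have hpI : 0 < p * I := by positivity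
  refine (pow_le_pow_left' h1 I).trans ?_
  rw [← ENNReal.ofReal_pow (Real.exp_pos _).le, ← Real.exp_nat_mul]
  refine ENNReal.ofReal_le_ofReal ?_
  rw [show (I : ℝ) * -p = -(p * I) by ring, Real.exp_neg, one_div]
  refine inv_anti₀ hpI ?_
  linarith [Real.add_one_le_exp (p * I)]

theorem eventually_natCast_le_two_rpow {ε : ℝ} (hε : 0 < ε) :
    ∀ᶠ m : ℕ in atTop, (m : ℝ) ≤ 2 ^ (ε * m) := by
  have hr : (1 : ℝ) < 2 ^ ε := Real.one_lt_rpow (by norm_num) hε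
  have h1 := tendsto_pow_const_div_const_pow_of_one_lt 1 hr
  filter_upwards [h1.eventually_le_const (show (0 : ℝ) < 1 by norm_num)] with m hm
  have hpos : (0 : ℝ) < (2 ^ ε) ^ m := by positivity
  rw [pow_one, div_le_one hpos, ← Real.rpow_natCast, ← Real.rpow_mul (by norm_num)] at hm
  exact hm

theorem summable_two_rpow_neg {ε : ℝ} (hε : 0 < ε) :
    Summable fun m : ℕ => (2 : ℝ) ^ (-ε * m) := by
  have h := summable_geometric_of_lt_one (r := (2 : ℝ) ^ (-ε)) (by positivity)
    (Real.rpow_lt_one_of_one_lt_of_neg (by norm_num) (by linarith))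
  refine h.congr fun m => ?_
  rw [← Real.rpow_natCast, ← Real.rpow_mul (by norm_num)]

namespace IsRenewalMeasure

/-- Fair or favourable coins have runs of length `c log₂ n` for every `c < 1`. -/
theorem ae_le_Rhat_of_lt_one (hP : IsRenewalMeasure P) {θ : ℝ} (hθ : θ ∈ Icc (0 : ℝ) 1) {c : ℝ}
    (hc0 : 0 < c) (hc : c < 1) : ∀ᵐ ω ∂(Q P θ), ENNReal.ofReal c ≤ Rhat (X ω) := by
  have hθ0 := hθ.1
  have := hP.isProbabilityMeasure
  have := isProbabilityMeasure_Q (P := P) hθ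
  -- `2^{β m}` disjoint windows: `β > 1` makes one of them succeed, `β < 1/c` keeps them early
  obtain ⟨β, hβ1, hβ⟩ := exists_between ((one_lt_div hc0).2 hc)
  let I : ℕ → ℕ := fun m => ⌈(2 : ℝ) ^ (β * m)⌉₊
  let B : ℕ → Set Sample := fun m =>
    {ω | ∀ i ∈ Finset.range (I m), ¬ (m : ℕ∞) ≤ R (X ω) (i * m)}
  have hB : ∀ m, Q P θ (B m) ≤ ENNReal.ofReal (2 ^ (-(β - 1) * m)) := by
    intro m
    have hI : (2 : ℝ) ^ (β * m) ≤ I m := Nat.le_ceil _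
    have hI0 : 0 < I m := Nat.ceil_pos.2 (by positivity)
    have h1 := Q_forall_not_le_R (P := P) hθ (s := fun i _ => i * m) (m := m)
      (fun i => measurable_const)
      (Eventually.of_forall fun δ i j hij => by
        have := Nat.mul_le_mul_right m (Nat.succ_le_of_lt hij)
        rw [Nat.succ_mul] at this
        exact this) (I m)
    rw [h1]
    calc _ ≤ ∫⁻ δ, (1 - ENNReal.ofReal ((1 / 2) ^ m)) ^ I m ∂P := by
          refine lintegral_mono fun δ => ?_
          dsimp only
          conv_rhs => rw [← Finset.card_range (I m), ← Finset.prod_const]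
          refine Finset.prod_le_prod' fun i _ => tsub_le_tsub_left (ENNReal.ofReal_le_ofReal ?_) _
          exact le_mul_of_one_le_right (by positivity) (one_le_pow₀ (by linarith))
      _ = (1 - ENNReal.ofReal ((1 / 2) ^ m)) ^ I m := by
          rw [lintegral_const, measure_univ, mul_one]
      _ ≤ ENNReal.ofReal (1 / ((1 / 2) ^ m * I m)) :=
          one_sub_ofReal_pow_le (by positivity) hI0
      _ ≤ _ := by
          refine ENNReal.ofReal_le_ofReal ?_
          rw [div_le_iff₀ (by positivity)]
          calc (1 : ℝ) = 2 ^ (-(β - 1) * m) * ((1 / 2) ^ m * 2 ^ (β * m)) := by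
                rw [one_div, inv_pow, ← Real.rpow_natCast, ← Real.rpow_neg (by norm_num),
                  ← Real.rpow_add (by norm_num), ← Real.rpow_add (by norm_num)]
                ring_nf
                simp
            _ ≤ _ := by gcongr
  filter_upwards [ae_eventually_notMem_of_le (summable_two_rpow_neg (sub_pos.2 hβ1))
    (Eventually.of_forall hB)] with ω hω
  refine le_Rhat_of_eventually hc0 ?_
  filter_upwards [hω, eventually_natCast_le_two_rpow (sub_pos.2 hβ)] with m hm hm2
  simp only [B, mem_ofPred_eq, not_forall, not_not, Finset.mem_range] at hm
  obtain ⟨i, hi, hR⟩ := hm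
  refine ⟨i * m, ?_, hR⟩
  have hi' : (i : ℝ) < 2 ^ (β * m) := Nat.lt_ceil.1 hi
  push_cast
  calc (i : ℝ) * m ≤ 2 ^ (β * m) * 2 ^ ((1 / c - β) * m) := by gcongr
    _ = 2 ^ (m / c) := by
      rw [← Real.rpow_add (by norm_num)]; congr 1; ring

theorem Q_renewal (hP : IsRenewalMeasure P) {θ : ℝ} (hθ : θ ∈ Icc (0 : ℝ) 1) {A : Set BinSeq}
    (hA : MeasurableSet A) : Q P θ {ω | ω.2.2 ∈ A} = P A := by
  have := hP.isProbabilityMeasure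
  have h := Q_apply (P := P) hθ (E := {p | p.2 ∈ A}) (measurable_snd hA)
  simp only [mem_ofPred_eq] at h
  rw [h, ← lintegral_indicator_one hA]
  refine lintegral_congr fun δ => ?_
  have := isProbabilityMeasure_coinLaw hθ δ
  by_cases hδ : δ ∈ A <;> simp [hδ]

/-- The windows of length `m` starting at every `m`-th renewal are independent trials, each of
which succeeds with probability at least `2^{-m} (1+θ)^k P[S_k ≤ m]`. -/
theorem Q_forall_not_le_R_pos (hP : IsRenewalMeasure P) (hU : Tendsto (U P) atTop atTop)
    {θ : ℝ} (hθ : θ ∈ Icc (0 : ℝ) 1) (k m I : ℕ) :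
    Q P θ {ω | ∀ i ∈ Finset.range I, ¬ (m : ℕ∞) ≤ R (X ω) (pos ω.2.2 (i * m))} ≤
      (1 - ENNReal.ofReal ((1 / 2) ^ m * ((1 + θ) ^ k * cum P k m))) ^ I := by
  have hθ0 := hθ.1
  have hθ1 := hθ.2
  have := hP.isProbabilityMeasure
  have h1 := Q_forall_not_le_R (P := P) hθ (s := fun i δ => pos δ (i * m)) (m := m)
      (fun i => measurable_pos _)
      ((hP.ae_recurrent hU).mono fun δ hδ i j hij => hδ.pos_add_le (by
        have := Nat.mul_le_mul_right m (Nat.succ_le_of_lt hij)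
        rw [Nat.succ_mul] at this
        exact this)) I
  rw [h1]
  let g : BinSeq → ℝ≥0∞ := fun δ => ENNReal.ofReal ((1 / 2) ^ m * (1 + θ) ^ cnt δ m)
  have hg : Measurable g :=
    (measurable_of_countable fun k : ℕ => ENNReal.ofReal ((1 / 2) ^ m * (1 + θ) ^ k)).comp
      (measurable_cnt m)
  have hg1 : ∀ δ, g δ ≤ 1 := fun δ => by
    rw [← ENNReal.ofReal_one]
    refine ENNReal.ofReal_le_ofReal ?_
    calc (1 / 2 : ℝ) ^ m * (1 + θ) ^ cnt δ m ≤ (1 / 2) ^ m * 2 ^ m := by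
          gcongr
          exact (pow_le_pow_left₀ (by linarith) (by linarith) _).trans
            (pow_le_pow_right₀ (by norm_num) (cnt_le δ m))
      _ = 1 := by rw [← mul_pow]; norm_num
  have h2 := hP.lintegral_prod_shift_pos_le hU (m := m) (h := fun δ => 1 - g δ)
    (measurable_const.sub hg) (fun n hn δ => by simp only [g, cnt_trunc δ hn]) I
  refine h2.trans (pow_le_pow_left' ?_ I)
  rw [lintegral_sub hg (ne_top_of_le_ne_top ENNReal.one_ne_top
    ((lintegral_mono hg1).trans (by simp))) (Eventually.of_forall hg1), lintegral_const,
    measure_univ, mul_one]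
  refine tsub_le_tsub_left ?_ _
  calc ENNReal.ofReal ((1 / 2) ^ m * ((1 + θ) ^ k * cum P k m))
      = ENNReal.ofReal ((1 / 2) ^ m * (1 + θ) ^ k) * P {δ | k ≤ cnt δ m} := by
        rw [hP.measure_eq_ofReal, ← ENNReal.ofReal_mul (by positivity), ← mul_assoc]; rfl
    _ = ∫⁻ δ in {δ | k ≤ cnt δ m}, ENNReal.ofReal ((1 / 2) ^ m * (1 + θ) ^ k) ∂P :=
        (setLIntegral_const _ _).symm
    _ ≤ ∫⁻ δ in {δ | k ≤ cnt δ m}, g δ ∂P := by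
        refine setLIntegral_mono hg fun δ hδ => ENNReal.ofReal_le_ofReal ?_
        have hδ : k ≤ cnt δ m := hδ
        gcongr
        linarith
    _ ≤ ∫⁻ δ, g δ ∂P := setLIntegral_le_lintegral _ _

/-- The lower bound for the runs: among `2^{β m}` windows of length `m` that start at renewals, each
succeeding with probability of order `2^{-(1-w) m}`, one succeeds if `β > 1 - w`; and so many
renewals take place before `2^{m/c}` if `β < (1 - γ) / c`. -/
theorem ae_le_Rhat (hP : IsRenewalMeasure P) {γ : ℝ} (hγ : HasIndex P γ) (hγ1 : γ < 1) {θ : ℝ}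
    (hθ : θ ∈ Icc (0 : ℝ) 1) {c w : ℝ} (hc : 0 < c) (hw : 0 ≤ w)
    (hwψ : w < psi P (Real.logb 2 (1 + θ))) (hw1 : w < 1) (hcw : c * (1 - w) < 1 - γ) :
    ∀ᵐ ω ∂(Q P θ), ENNReal.ofReal c ≤ Rhat (X ω) := by
  have hθ0 := hθ.1
  have hU := hP.tendsto_U hγ hγ1
  have := hP.isProbabilityMeasure
  have := isProbabilityMeasure_Q (P := P) hθ
  obtain ⟨a, hac, ha⟩ := exists_between hcw
  have ha0 : 0 < a := (mul_pos hc (by linarith)).trans hac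
  obtain ⟨β, hβ1, hβ⟩ := exists_between ((lt_div_iff₀ hc).2 (by linarith : (1 - w) * c < a))
  have hβ0 : 0 < β := by linarith
  obtain ⟨C, hC, hk⟩ := hP.exists_rpow_le_rpow_mul_cum hU (logb_one_add_mem hθ).1 hw hwψ
  choose k hkm hkC using hk
  let I : ℕ → ℕ := fun m => ⌈(2 : ℝ) ^ (β * m)⌉₊
  let K : ℕ → ℕ := fun m => ⌊m / c⌋₊
  have hK1 : ∀ m : ℕ, (K m : ℝ) ≤ m / c := fun m => Nat.floor_le (by positivity)
  have hK2 : ∀ m : ℕ, m / c - 1 ≤ (K m : ℝ) := fun m => (Nat.sub_one_lt_floor _).le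
  have hKlim : Tendsto K atTop atTop :=
    tendsto_nat_floor_atTop.comp (tendsto_natCast_atTop_atTop.atTop_div_const hc)
  have hI : ∀ m : ℕ, (2 : ℝ) ^ (β * m) ≤ I m := fun m => Nat.le_ceil _
  have hI0 : ∀ m : ℕ, 0 < I m := fun m => Nat.ceil_pos.2 (by positivity)
  have hI2 : ∀ m : ℕ, (I m : ℝ) ≤ 2 * 2 ^ (β * m) := fun m => by
    have h1 : (1 : ℝ) ≤ 2 ^ (β * m) := Real.one_le_rpow (by norm_num) (by positivity)
    have h2 := (Nat.ceil_lt_add_one (show (0 : ℝ) ≤ 2 ^ (β * m) by positivity)).le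
    linarith
  -- no window is a run of heads
  let B : ℕ → Set Sample := fun m =>
    {ω | ∀ i ∈ Finset.range (I m), ¬ (m : ℕ∞) ≤ R (X ω) (pos ω.2.2 (i * m))}
  -- the windows start too late
  let D : ℕ → Set Sample := fun m => {ω | ω.2.2 ∈ {δ | I m * m ≤ cnt δ (2 ^ K m)}ᶜ}
  have hB : ∀ m, Q P θ (B m) ≤ ENNReal.ofReal (C⁻¹ * 2 ^ (-(β - (1 - w)) * m)) := by
    intro m
    have hI0' := hI0 m
    have hp : C * 2 ^ ((w - 1) * m) ≤ (1 / 2) ^ m * ((1 + θ) ^ k m * cum P (k m) m) := by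
      have h1 := hkC m
      rw [two_rpow_logb_mul hθ] at h1
      calc C * 2 ^ ((w - 1) * m) = (1 / 2) ^ m * (C * 2 ^ (w * m)) := by
            rw [one_div, inv_pow, ← Real.rpow_natCast, ← Real.rpow_neg (by norm_num),
              mul_left_comm, ← Real.rpow_add (by norm_num)]
            ring_nf
        _ ≤ _ := by gcongr
    calc Q P θ (B m) ≤ (1 - ENNReal.ofReal ((1 / 2) ^ m * ((1 + θ) ^ k m * cum P (k m) m))) ^ I m :=
          hP.Q_forall_not_le_R_pos hU hθ (k m) m (I m)
      _ ≤ (1 - ENNReal.ofReal (C * 2 ^ ((w - 1) * m))) ^ I m := by gcongr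
      _ ≤ ENNReal.ofReal (1 / (C * 2 ^ ((w - 1) * m) * I m)) :=
          one_sub_ofReal_pow_le (by positivity) (hI0 m)
      _ ≤ _ := by
          refine ENNReal.ofReal_le_ofReal ?_
          rw [div_le_iff₀ (by positivity)]
          calc (1 : ℝ) = C⁻¹ * 2 ^ (-(β - (1 - w)) * m) * (C * 2 ^ ((w - 1) * m) * 2 ^ (β * m)) := by
                rw [show C⁻¹ * 2 ^ (-(β - (1 - w)) * m) * (C * 2 ^ ((w - 1) * m) * 2 ^ (β * m)) =
                  (C⁻¹ * C) * (2 ^ (-(β - (1 - w)) * m) * (2 ^ ((w - 1) * m) * 2 ^ (β * m))) by ring,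
                  inv_mul_cancel₀ hC.ne', ← Real.rpow_add (by norm_num),
                  ← Real.rpow_add (by norm_num)]
                ring_nf
                simp
            _ ≤ _ := by gcongr; exact hI m
  let ε := (a / c - β) / 2
  have hε : 0 < ε := by simp only [ε]; linarith
  have hD : ∀ᶠ m in atTop, Q P θ (D m) ≤ ENNReal.ofReal (8 * 2 ^ a * 2 ^ (-ε * m)) := by
    filter_upwards [eventually_natCast_le_two_rpow hε, hKlim.eventually (hP.eventually_le_U hγ ha)]
      with m hm hUm
    have h1 : Q P θ (D m) = ENNReal.ofReal (1 - cum P (I m * m) (2 ^ K m)) := by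
      rw [hP.Q_renewal hθ (measurableSet_le_cnt _ _).compl, hP.measure_eq_ofReal,
        probReal_compl_eq_one_sub (measurableSet_le_cnt _ _)]
      rfl
    rw [h1]
    refine ENNReal.ofReal_le_ofReal ((hP.one_sub_cum_le _ (by positivity)).trans ?_)
    rw [div_le_iff₀ (by linarith [hP.one_le_U (2 ^ K m)])]
    push_cast
    have h3 : (2 : ℝ) ^ (a * (m / c - 1)) ≤ U P (2 ^ K m) :=
      (Real.rpow_le_rpow_of_exponent_le (by norm_num)
        (mul_le_mul_of_nonneg_left (hK2 m) ha0.le)).trans hUm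
    calc 4 * ((I m : ℝ) * m) ≤ 4 * ((2 * 2 ^ (β * m)) * 2 ^ (ε * m)) := by
          gcongr; exact hI2 m
      _ = 8 * 2 ^ a * 2 ^ (-ε * m) * 2 ^ (a * (m / c - 1)) := by
          have h4 : (2 : ℝ) ^ a * (2 ^ (-ε * m) * 2 ^ (a * (m / c - 1))) =
              2 ^ (β * m) * 2 ^ (ε * m) := by
            rw [← Real.rpow_add (by norm_num), ← Real.rpow_add (by norm_num),
              ← Real.rpow_add (by norm_num)]
            congr 1
            simp only [ε]
            ring
          linear_combination (-8) * h4
      _ ≤ _ := by gcongr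
  filter_upwards [ae_eventually_notMem_of_le
      ((summable_two_rpow_neg (sub_pos.2 hβ1)).mul_left C⁻¹) (Eventually.of_forall hB),
    ae_eventually_notMem_of_le ((summable_two_rpow_neg hε).mul_left _) hD] with ω hωB hωD
  refine le_Rhat_of_eventually hc ?_
  filter_upwards [hωB, hωD] with m hmB hmD
  simp only [B, mem_ofPred_eq, not_forall, not_not, Finset.mem_range] at hmB
  simp only [D, mem_ofPred_eq, mem_compl_iff, not_not] at hmD
  obtain ⟨i, hi, hR⟩ := hmB
  refine ⟨_, ?_, hR⟩
  have h1 : pos ω.2.2 (i * m) ≤ 2 ^ K m :=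
    pos_le ((Nat.mul_le_mul_right m hi.le).trans hmD)
  calc (pos ω.2.2 (i * m) : ℝ) ≤ ((2 ^ K m : ℕ) : ℝ) := by exact_mod_cast h1
    _ = 2 ^ (K m : ℝ) := by rw [Real.rpow_natCast]; push_cast; rfl
    _ ≤ 2 ^ (m / c) := Real.rpow_le_rpow_of_exponent_le (by norm_num) (hK1 m)

end IsRenewalMeasure

end

/-! ### The almost sure growth of runs and the estimators -/

section

variable {P : Measure BinSeq}

namespace IsRenewalMeasure

/-- The almost sure value of `R̂`, from the upper and lower bounds applied to the
constants `v ± 1/(j+1)` around the value `v`. -/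
theorem ae_Rhat_eq (hP : IsRenewalMeasure P) {γ : ℝ} (hγ : HasIndex P γ) (hγ0 : 0 < γ)
    (hγ1 : γ < 1) {θ : ℝ} (hθ : θ ∈ Icc (0 : ℝ) 1) :
    ∀ᵐ ω ∂(Q P θ), Rhat (X ω) =
      ENNReal.ofReal (max ((1 - γ) / (1 - psi P (Real.logb 2 (1 + θ)))) 1) := by
  have hU := hP.tendsto_U hγ hγ1
  have hφ := logb_one_add_mem hθ
  have hψ1 := hP.psi_lt_one hU (hP.u_one_lt_one hγ hγ0) hφ.1 hφ.2
  set ψ := psi P (Real.logb 2 (1 + θ)) with hψ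
  set v : ℝ := max ((1 - γ) / (1 - ψ)) 1 with hv
  have hv1 : 1 ≤ v := le_max_right _ _
  have hvψ : 1 - γ ≤ v * (1 - ψ) := (div_le_iff₀ (by linarith)).1 (le_max_left _ _)
  have hupper : ∀ j : ℕ, ∀ᵐ ω ∂(Q P θ), Rhat (X ω) ≤ ENNReal.ofReal (v + 1 / ((j : ℝ) + 1)) := by
    intro j
    have hj : (0 : ℝ) < 1 / ((j : ℝ) + 1) := by positivity
    exact hP.ae_Rhat_le hγ hγ1 hθ (by linarith) (by nlinarith) hψ1
  have hlower : ∀ j : ℕ, ∀ᵐ ω ∂(Q P θ), ENNReal.ofReal (v - 1 / ((j : ℝ) + 1)) ≤ Rhat (X ω) := by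
    intro j
    have hj : (0 : ℝ) < 1 / ((j : ℝ) + 1) := by positivity
    set c : ℝ := v - 1 / ((j : ℝ) + 1) with hc
    rcases le_or_gt c 0 with hc0 | hc0
    · filter_upwards with ω
      rw [ENNReal.ofReal_of_nonpos hc0]; exact zero_le
    rcases lt_or_ge c 1 with hc1 | hc1
    · exact hP.ae_le_Rhat_of_lt_one hθ hc0 hc1
    · have hcv : c < (1 - γ) / (1 - ψ) := by
        rcases lt_max_iff.1 (show c < v by linarith) with h | h
        · exact h
        · linarith
      rw [lt_div_iff₀ (by linarith)] at hcv
      have hψ0 : 0 < ψ := by nlinarith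
      have h1 : 1 - (1 - γ) / c < ψ := by
        rw [sub_lt_comm, lt_div_iff₀ hc0]; linarith
      obtain ⟨w, hw, hwψ⟩ := exists_between (max_lt hψ0 h1)
      have hw2 := (le_max_right _ _).trans_lt hw
      refine hP.ae_le_Rhat hγ hγ1 hθ hc0 ((le_max_left _ _).trans hw.le) hwψ (by linarith) ?_
      rw [sub_lt_comm, lt_div_iff₀ hc0] at hw2
      linarith
  filter_upwards [ae_all_iff.2 hupper, ae_all_iff.2 hlower] with ω h1 h2
  have hlim : Tendsto (fun j : ℕ => 1 / ((j : ℝ) + 1)) atTop (𝓝 0) :=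
    tendsto_one_div_add_atTop_nhds_zero_nat
  have h3 : Tendsto (fun j : ℕ => v + 1 / ((j : ℝ) + 1)) atTop (𝓝 v) := by
    simpa using hlim.const_add v
  have h4 : Tendsto (fun j : ℕ => v - 1 / ((j : ℝ) + 1)) atTop (𝓝 v) := by
    simpa using hlim.const_sub v
  exact le_antisymm (ge_of_tendsto' (ENNReal.tendsto_ofReal h3) h1)
    (le_of_tendsto' (ENNReal.tendsto_ofReal h4) h2)

/-- Almost surely the estimator of `φ` returns the maximum of `φ` and the threshold `ψ⁻¹(γ)`. -/
theorem ae_phiEstimator_eq (hP : IsRenewalMeasure P) {γ : ℝ} (hγ : HasIndex P γ) (hγ0 : 0 < γ)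
    (hγ1 : γ < 1) {θ : ℝ} (hθ : θ ∈ Icc (0 : ℝ) 1) :
    ∀ᵐ ω ∂(Q P θ), phiEstimator P γ (X ω) = max (Real.logb 2 (1 + θ)) (psiInv P γ) := by
  have hU := hP.tendsto_U hγ hγ1
  have hφ := logb_one_add_mem hθ
  have hψ1 := hP.psi_lt_one hU (hP.u_one_lt_one hγ hγ0) hφ.1 hφ.2
  have hψ0 := hP.psi_nonneg hU hφ.1
  filter_upwards [hP.ae_Rhat_eq hγ hγ0 hγ1 hθ] with ω hω
  have hmono := (hP.logGen_strictMonoOn hU).monotoneOn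
  rw [phiEstimator, hω, ENNReal.toReal_ofReal (zero_le_one.trans (le_max_right _ _)),
    hP.psiInv_eq hU hγ0.le]
  conv_rhs => rw [← hP.logGen_psi hU hφ.1]
  set ψ := psi P (Real.logb 2 (1 + θ))
  have h1ψ : 0 < 1 - ψ := by linarith
  rcases le_total ψ γ with h | h
  · rw [max_eq_right (hmono hψ0 hγ0.le h), max_eq_right ((div_le_one h1ψ).2 (by linarith)),
      div_one, sub_sub_cancel, hP.psiInv_eq hU hγ0.le]
  · rw [max_eq_left (hmono hγ0.le hψ0 h), max_eq_left ((one_le_div h1ψ).2 (by linarith)),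
      div_div_cancel₀ (by linarith), sub_sub_cancel, hP.psiInv_eq hU hψ0]

theorem measurable_psiInv (hP : IsRenewalMeasure P) (hU : Tendsto (U P) atTop atTop) :
    Measurable (psiInv P) := by
  classical
  -- negative arguments are not values of `ψ`, and there `psiInv` takes a fixed default value `d`
  obtain ⟨d, hd⟩ : ∃ d : ℝ, ∀ s < 0, psiInv P s = d := by
    refine ⟨Classical.choice inferInstance, fun s hs => ?_⟩
    refine Function.invFunOn_neg ?_
    rintro ⟨φ, hφ, rfl⟩
    exact absurd hs (not_lt.2 (hP.psi_nonneg hU hφ))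
  have h1 : psiInv P = (Ici (0 : ℝ)).piecewise (logGen P) fun _ => d := by
    funext s
    by_cases hs : s ∈ Ici (0 : ℝ)
    · rw [piecewise_eq_of_mem _ _ _ hs, hP.psiInv_eq hU hs]
    · rw [piecewise_eq_of_notMem _ _ _ hs, hd s (not_le.1 hs)]
  rw [h1]
  exact (hP.continuousOn_logGen hU).measurable_piecewise continuousOn_const measurableSet_Ici

theorem measurable_phiEstimator (hP : IsRenewalMeasure P) (hU : Tendsto (U P) atTop atTop)
    (γ : ℝ) : Measurable (phiEstimator P γ) :=
  (hP.measurable_psiInv hU).comp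
    (measurable_const.sub (measurable_const.div measurable_Rhat.ennreal_toReal))

theorem exists_u_pos (hP : IsRenewalMeasure P) (hU : Tendsto (U P) atTop atTop) :
    ∃ i, 0 < u P (i + 1) := by
  obtain ⟨n, hn, hpos⟩ := hP.exists_pr_pos hU
  obtain ⟨i, rfl⟩ := Nat.exists_eq_succ_of_ne_zero hn
  refine ⟨i, hpos.trans_le ?_⟩
  rw [hP.u_eq_sum le_rfl]
  exact Finset.single_le_sum (f := fun k => pr P k (i + 1)) (fun k _ => pr_nonneg k _)
    (Finset.mem_range.2 (by omega))

theorem two_rpow_psiInv_lt (hP : IsRenewalMeasure P) {γ : ℝ} (hγ : HasIndex P γ) (hγ0 : 0 < γ)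
    (hγ1 : γ < 1) (h1 : 0 < u P 1) : (2 : ℝ) ^ psiInv P γ < 2 ^ γ / u P 1 := by
  have hU := hP.tendsto_U hγ hγ1
  rw [hP.psiInv_eq hU hγ0.le]
  exact hP.two_rpow_logGen_lt hU (hP.u_one_lt_one hγ hγ0) h1 hγ0.le

end IsRenewalMeasure

/-! ### Decimation -/

/-- The renewal process observed at multiples of `d`. -/
def decimate (d : ℕ) (δ : BinSeq) : BinSeq := fun n => δ (d * n)

theorem measurable_decimate (d : ℕ) : Measurable (decimate d) :=
  measurable_pi_lambda _ fun n => measurable_pi_apply (d * n)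

theorem u_map_decimate (d n : ℕ) : u (P.map (decimate d)) n = u P (d * n) :=
  map_measureReal_apply (measurable_decimate d) (measurableSet_renewalAt n)

namespace IsRenewalMeasure

/-- The decimated process is again a renewal process, with `u_{d n}` in place of `u_n`. -/
theorem map_decimate (hP : IsRenewalMeasure P) {d : ℕ} (hd : 0 < d) :
    IsRenewalMeasure (P.map (decimate d)) := by
  have := hP.isProbabilityMeasure
  refine ⟨Measure.isProbabilityMeasure_map (measurable_decimate d).aemeasurable,
    fun m t h0 ht => ?_⟩
  rw [map_measureReal_apply (measurable_decimate d)
    (Finset.measurableSet_biInter _ fun i _ => measurableSet_renewalAt _)]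
  have h := hP.renewal m (fun i => d * t i) (by simp [h0])
    fun i j hij => Nat.mul_lt_mul_of_pos_left (ht hij) hd
  simp only [u_map_decimate, Nat.mul_sub]
  rw [← h]
  congr 1
  ext δ
  simp [decimate, renewalAt]

theorem u_pow_le (hP : IsRenewalMeasure P) (k j : ℕ) : u P k ^ j ≤ u P (j * k) := by
  induction j with
  | zero => simp [hP.u_zero]
  | succ j ih =>
    rw [pow_succ, Nat.succ_mul]
    exact (mul_le_mul_of_nonneg_right ih (u_nonneg k)).trans (hP.u_mul_u_le _ _)

theorem U_map_decimate_le (d n : ℕ) (hd : 0 < d) : U (P.map (decimate d)) n ≤ U P (d * n) := by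
  simp only [U, u_map_decimate]
  rw [← Finset.sum_image (f := u P) (g := fun k => d * k)
    fun a _ b _ h => Nat.eq_of_mul_eq_mul_left hd h]
  refine Finset.sum_le_sum_of_subset_of_nonneg (fun x hx => ?_) fun _ _ _ => u_nonneg _
  obtain ⟨k, hk, rfl⟩ := Finset.mem_image.1 hx
  rw [Finset.mem_range, Nat.lt_succ_iff] at hk ⊢
  exact Nat.mul_le_mul_left d hk

/-- The renewal mass in one residue class mod `d` is at most a constant times that of the class
of `0`, up to a bounded shift: from a time `k` in the class, `d - 1` further steps of length `k`
lead to a multiple of `d`. -/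
theorem exists_sum_filter_mod_le (hP : IsRenewalMeasure P) {d : ℕ} (hd : 0 < d) (r : ℕ) :
    ∃ (C : ℝ) (c : ℕ), 0 ≤ C ∧ ∀ N, ∑ n ∈ Finset.range (N + 1) with n % d = r, u P n ≤
      C * U (P.map (decimate d)) (N + c) := by
  by_cases hk : ∃ k, k % d = r ∧ 0 < u P k
  · obtain ⟨k, hkr, hk0⟩ := hk
    set e := (d - 1) * k with he
    have hC : 0 < u P k ^ (d - 1) := pow_pos hk0 _
    refine ⟨(u P k ^ (d - 1))⁻¹, e, by positivity, fun N => ?_⟩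
    rw [inv_mul_eq_div, le_div_iff₀ hC, Finset.sum_mul]
    have hdvd : ∀ n, n % d = r → d * ((n + e) / d) = n + e := by
      intro n hn
      refine Nat.mul_div_cancel' ((Nat.modEq_zero_iff_dvd).1 ?_)
      have h1 : n + e ≡ k + e [MOD d] := Nat.ModEq.add_right e (hn.trans hkr.symm)
      have h2 : k + e = d * k := by
        rw [he]
        obtain ⟨d', rfl⟩ : ∃ d', d = d' + 1 := ⟨d - 1, by omega⟩
        simp; ring
      rw [h2] at h1
      exact h1.trans (Nat.modEq_zero_iff_dvd.2 (Dvd.intro k rfl))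
    calc ∑ n ∈ Finset.range (N + 1) with n % d = r, u P n * u P k ^ (d - 1)
        ≤ ∑ n ∈ Finset.range (N + 1) with n % d = r, u (P.map (decimate d)) ((n + e) / d) := by
          refine Finset.sum_le_sum fun n hn => ?_
          rw [u_map_decimate, hdvd n (Finset.mem_filter.1 hn).2]
          exact (mul_le_mul_of_nonneg_left (hP.u_pow_le k (d - 1)) (u_nonneg n)).trans
            (hP.u_mul_u_le _ _)
      _ = ∑ l ∈ ((Finset.range (N + 1)).filter (· % d = r)).image (fun n => (n + e) / d),
            u (P.map (decimate d)) l := by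
          rw [Finset.sum_image]
          intro a ha b hb hab
          have h1 := hdvd a (Finset.mem_filter.1 ha).2
          have h2 := hdvd b (Finset.mem_filter.1 hb).2
          dsimp only at hab
          rw [hab] at h1
          omega
      _ ≤ U (P.map (decimate d)) (N + e) := by
          refine Finset.sum_le_sum_of_subset_of_nonneg (fun x hx => ?_) fun _ _ _ => u_nonneg _
          obtain ⟨n, hn, rfl⟩ := Finset.mem_image.1 hx
          have := Finset.mem_range.1 (Finset.mem_filter.1 hn).1
          rw [Finset.mem_range]
          have := Nat.div_le_self (n + e) d
          omega
  · push Not at hk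
    refine ⟨0, 0, le_rfl, fun N => ?_⟩
    rw [zero_mul]
    exact Finset.sum_nonpos fun n hn => hk n (Finset.mem_filter.1 hn).2

theorem exists_U_le_mul_U_map_decimate (hP : IsRenewalMeasure P) {d : ℕ} (hd : 0 < d) :
    ∃ C > 0, ∃ c : ℕ, ∀ N, U P N ≤ C * U (P.map (decimate d)) (N + c) := by
  choose C c hC h using hP.exists_sum_filter_mod_le hd
  refine ⟨∑ r ∈ Finset.range d, C r + 1, by
    have := Finset.sum_nonneg fun r (_ : r ∈ Finset.range d) => hC r
    linarith, ∑ r ∈ Finset.range d, c r, fun N => ?_⟩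
  have hU0 := (hP.map_decimate hd).one_le_U (N + ∑ r ∈ Finset.range d, c r)
  calc U P N = ∑ r ∈ Finset.range d, ∑ n ∈ Finset.range (N + 1) with n % d = r, u P n :=
        (Finset.sum_fiberwise_of_maps_to (fun n _ => Finset.mem_range.2 (Nat.mod_lt n hd)) _).symm
    _ ≤ ∑ r ∈ Finset.range d, C r * U (P.map (decimate d)) (N + ∑ r ∈ Finset.range d, c r) := by
        refine Finset.sum_le_sum fun r hr => (h r N).trans (mul_le_mul_of_nonneg_left ?_ (hC r))
        exact U_mono (Nat.add_le_add_left (Finset.single_le_sum (fun _ _ => Nat.zero_le _) hr) N)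
    _ ≤ _ := by
        rw [← Finset.sum_mul]
        nlinarith

/-- Decimation does not change the index `γ`, because `U_n` and its decimated version are comparable
up to constants and bounded changes of scale. -/
theorem hasIndex_map_decimate (hP : IsRenewalMeasure P) {γ : ℝ} (hγ : HasIndex P γ) {d : ℕ}
    (hd : 0 < d) : HasIndex (P.map (decimate d)) γ := by
  have hP' := hP.map_decimate hd
  obtain ⟨C, hC, c, hUC⟩ := hP.exists_U_le_mul_U_map_decimate hd
  obtain ⟨r, hr⟩ : ∃ r, d ≤ 2 ^ r := ⟨d, Nat.lt_two_pow_self.le⟩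
  have hUpos : ∀ n, 0 < U P n := fun n => by linarith [hP.one_le_U n]
  have hUpos' : ∀ n, 0 < U (P.map (decimate d)) n := fun n => by linarith [hP'.one_le_U n]
  have hinv := tendsto_inv_atTop_nhds_zero_nat (𝕜 := ℝ)
  have hup : Tendsto (fun k : ℕ => Real.logb 2 (U P (2 ^ (k + r))) / ((k + r : ℕ) : ℝ) *
      (1 + r * (k : ℝ)⁻¹)) atTop (𝓝 (1 - γ)) := by
    simpa using (hγ.comp (tendsto_add_atTop_nat r)).mul ((hinv.const_mul (r : ℝ)).const_add 1)
  have hlo : Tendsto (fun k : ℕ => Real.logb 2 (U P (2 ^ (k - 1))) / ((k - 1 : ℕ) : ℝ) *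
      (1 - (k : ℝ)⁻¹) - Real.logb 2 C * (k : ℝ)⁻¹) atTop (𝓝 (1 - γ)) := by
    simpa using ((hγ.comp (tendsto_sub_atTop_nat 1)).mul (hinv.const_sub 1)).sub
      (hinv.const_mul (Real.logb 2 C))
  refine tendsto_of_tendsto_of_tendsto_of_le_of_le' hlo hup ?_ ?_
  · filter_upwards [eventually_ge_atTop 2, eventually_ge_atTop (c + 1)] with k hk hkc
    obtain ⟨l, rfl⟩ : ∃ l, k = l + 1 := ⟨k - 1, by omega⟩
    have hl : (0 : ℝ) < l := by
      have : 0 < l := by omega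
      exact_mod_cast this
    have hle : U P (2 ^ l) ≤ C * U (P.map (decimate d)) (2 ^ (l + 1)) := by
      refine (hUC _).trans (mul_le_mul_of_nonneg_left (U_mono ?_) hC.le)
      have : c < 2 ^ c := Nat.lt_two_pow_self
      have : 2 ^ c ≤ 2 ^ l := Nat.pow_le_pow_right (by norm_num) (by omega)
      rw [pow_succ]; omega
    have h1 := Real.logb_le_logb_of_le (b := 2) (by norm_num) (hUpos _) hle
    rw [Real.logb_mul hC.ne' (hUpos' _).ne'] at h1
    rw [Nat.add_sub_cancel, Nat.cast_add, Nat.cast_one, le_div_iff₀ (by positivity)]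
    have h2 : (Real.logb 2 (U P (2 ^ l)) / l * (1 - ((l : ℝ) + 1)⁻¹) -
        Real.logb 2 C * ((l : ℝ) + 1)⁻¹) * (l + 1) = Real.logb 2 (U P (2 ^ l)) - Real.logb 2 C := by
      field_simp
      ring
    linarith
  · filter_upwards [eventually_ge_atTop 1] with k hk
    have hk0 : (0 : ℝ) < k := by exact_mod_cast hk
    have hle : U (P.map (decimate d)) (2 ^ k) ≤ U P (2 ^ (k + r)) := by
      refine (U_map_decimate_le d _ hd).trans (U_mono ?_)
      rw [pow_add, mul_comm]
      exact Nat.mul_le_mul_left _ hr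
    have h1 := Real.logb_le_logb_of_le (b := 2) (by norm_num) (hUpos' _) hle
    have h2 : Real.logb 2 (U P (2 ^ (k + r))) / ((k + r : ℕ) : ℝ) * (1 + r * (k : ℝ)⁻¹) =
        Real.logb 2 (U P (2 ^ (k + r))) / k := by
      push_cast
      field_simp
    rw [h2]
    gcongr

/-- The joint law of the decimated process and coins. -/
theorem map_Q_decimate (hP : IsRenewalMeasure P) {θ : ℝ} (hθ : θ ∈ Icc (0 : ℝ) 1) {d : ℕ}
    (hd : 0 < d) : (Q P θ).map (fun ω => (fun n => ω.1 (d * n), fun n => ω.2.1 (d * n),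
      decimate d ω.2.2)) = Q (P.map (decimate d)) θ := by
  have := hP.isProbabilityMeasure
  have := (hP.map_decimate hd).isProbabilityMeasure
  have h0 := isProbabilityMeasure_coin_of_mem (θ := 0) (by simp)
  have h1 := isProbabilityMeasure_coin_of_mem hθ
  have hinj : Function.Injective fun n => d * n := fun a b h => Nat.eq_of_mul_eq_mul_left hd h
  have hm : Measurable fun (y : ℕ → ℝ) (n : ℕ) => y (d * n) :=
    measurable_pi_lambda _ fun n => measurable_pi_apply (d * n)
  have hi0 := Measure.map_infinitePi_infinitePi_of_inj (P := fun _ : ℕ => coin 0) hinj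
  have hi1 := Measure.map_infinitePi_infinitePi_of_inj (P := fun _ : ℕ => coin θ) hinj
  rw [Q, Q]
  conv_rhs => rw [← hi0, ← hi1]
  rw [Measure.map_prod_map _ _ hm (measurable_decimate d),
    Measure.map_prod_map _ _ hm (hm.prodMap (measurable_decimate d))]
  rfl

/-- The estimator based on the observations at multiples of `d`. -/
theorem ae_phiEstimator_decimate_eq (hP : IsRenewalMeasure P) {γ : ℝ} (hγ : HasIndex P γ)
    (hγ0 : 0 < γ) (hγ1 : γ < 1) {θ : ℝ} (hθ : θ ∈ Icc (0 : ℝ) 1) {d : ℕ} (hd : 0 < d) :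
    ∀ᵐ ω ∂(Q P θ), phiEstimator (P.map (decimate d)) γ (fun n => X ω (d * n)) =
      max (Real.logb 2 (1 + θ)) (psiInv (P.map (decimate d)) γ) := by
  have hm : Measurable fun ω : Sample => ((fun n => ω.1 (d * n), fun n => ω.2.1 (d * n),
      decimate d ω.2.2) : Sample) :=
    (measurable_pi_lambda _ fun n => (measurable_pi_apply (d * n)).comp measurable_fst).prodMk
      ((measurable_pi_lambda _ fun n => (measurable_pi_apply (d * n)).comp measurable_snd.fst).prodMk
        ((measurable_decimate d).comp measurable_snd.snd))
  have h := (hP.map_decimate hd).ae_phiEstimator_eq (hP.hasIndex_map_decimate hγ hd) hγ0 hγ1 hθ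
  rw [← hP.map_Q_decimate hθ hd] at h
  exact ae_of_ae_map hm.aemeasurable h

/-- A single function of the observations recovers `θ` above the threshold `2^γ / sup u - 1`: it is
the infimum of the estimators based on all the decimated processes. Each of them is almost surely
at least `φ`, with equality if `φ` is above its own threshold. -/
theorem exists_measurable_ae_eq (hP : IsRenewalMeasure P) {γ : ℝ} (hγ : HasIndex P γ)
    (hγ0 : 0 < γ) (hγ1 : γ < 1) :
    ∃ g : (ℕ → ℝ) → ℝ, Measurable g ∧
      ∀ θ ∈ Icc (0 : ℝ) 1, 2 ^ γ / (⨆ i : ℕ, u P (i + 1)) - 1 < θ →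
        ∀ᵐ ω ∂(Q P θ), g (X ω) = θ := by
  have hU := hP.tendsto_U hγ hγ1
  let ι : Type := {i : ℕ // 0 < u P (i + 1)}
  let P' : ι → Measure BinSeq := fun i => P.map (decimate (i.1 + 1))
  let e : ι → (ℕ → ℝ) → ℝ := fun i x => phiEstimator (P' i) γ fun n => x ((i.1 + 1) * n)
  have hP' : ∀ i, IsRenewalMeasure (P' i) := fun i => hP.map_decimate (Nat.succ_pos _)
  have hγ' : ∀ i, HasIndex (P' i) γ := fun i => hP.hasIndex_map_decimate hγ (Nat.succ_pos _)
  have he : ∀ i, Measurable (e i) := fun i =>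
    ((hP' i).measurable_phiEstimator ((hP' i).tendsto_U (hγ' i) hγ1) γ).comp
      (measurable_pi_lambda _ fun n => measurable_pi_apply ((i.1 + 1) * n))
  refine ⟨fun x => 2 ^ (⨅ i, e i x) - 1,
    ((measurable_const.pow (Measurable.iInf he)).sub_const 1), fun θ hθ hlt => ?_⟩
  have hθ0 : 0 < 1 + θ := by linarith [hθ.1]
  have hbdd : BddAbove (range fun i => u P (i + 1)) := by
    refine ⟨1, ?_⟩
    rintro _ ⟨i, rfl⟩
    exact hP.u_le_one _
  have hsup : 0 < ⨆ i : ℕ, u P (i + 1) := by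
    obtain ⟨i, hi⟩ := hP.exists_u_pos hU
    exact hi.trans_le (le_ciSup hbdd i)
  have h1 : 2 ^ γ / (1 + θ) < ⨆ i : ℕ, u P (i + 1) := by
    rw [div_lt_iff₀ hθ0]
    have : 2 ^ γ / (⨆ i : ℕ, u P (i + 1)) < 1 + θ := by linarith
    rw [div_lt_iff₀ hsup] at this
    linarith
  obtain ⟨i, hi⟩ := exists_lt_of_lt_ciSup h1
  have hi0 : 0 < u P (i + 1) := lt_trans (by positivity) hi
  let i₀ : ι := ⟨i, hi0⟩
  have hthr : psiInv (P' i₀) γ ≤ Real.logb 2 (1 + θ) := by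
    have hu : u (P' i₀) 1 = u P (i + 1) := by
      rw [u_map_decimate, mul_one]
    have h2 := (hP' i₀).two_rpow_psiInv_lt (hγ' i₀) hγ0 hγ1 (hu ▸ hi0)
    rw [hu] at h2
    rw [Real.le_logb_iff_rpow_le (by norm_num) hθ0]
    refine h2.le.trans ?_
    rw [div_lt_iff₀ hθ0] at hi
    rw [div_le_iff₀ hi0]
    linarith
  have hall : ∀ i : ι, ∀ᵐ ω ∂(Q P θ), e i (X ω) =
      max (Real.logb 2 (1 + θ)) (psiInv (P' i) γ) := fun i =>
    hP.ae_phiEstimator_decimate_eq hγ hγ0 hγ1 hθ (Nat.succ_pos _)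
  filter_upwards [ae_all_iff.2 hall] with ω hω
  have hinf : ⨅ i, e i (X ω) = Real.logb 2 (1 + θ) := by
    simp only [hω]
    have : Nonempty ι := ⟨i₀⟩
    refine le_antisymm ((ciInf_le ⟨Real.logb 2 (1 + θ), ?_⟩ i₀).trans (max_eq_left hthr).le)
      (le_ciInf fun i => le_max_left _ _)
    rintro _ ⟨i, rfl⟩
    exact le_max_left _ _
  simp only [hinf]
  rw [Real.rpow_logb (by norm_num) (by norm_num) hθ0]
  ring

end IsRenewalMeasure

end

end RandomCoin

end

theorem theorem5p1
    (P : MeasureTheory.Measure RandomCoin.BinSeq) (hP : RandomCoin.IsRenewalMeasure P)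
    (γ : ℝ) (hγ : 1 / 2 < γ) (hγ1 : γ < 1)
    (ℓ : ℝ → ℝ) (hℓ : RandomCoin.SlowlyVarying ℓ)
    (hU : RandomCoin.Asymp (RandomCoin.U P) (fun n => (n : ℝ) ^ (1 - γ) * ℓ n)) :
    -- the limit defining `Λ*(a)` exists for all `a ≥ 1`
    (∀ a : ℝ, 1 ≤ a →
      Tendsto (RandomCoin.rateSeq P a) atTop (𝓝 (RandomCoin.rate P a))) ∧
    -- on `[0,∞)` the supremum defining `ψ` is finite, and `ψ` is a strictly increasing bijection of
    -- `[0,∞)`; moreover `ψ(φ) < 1` for the values `φ = log₂ (1 + θ)`, `0 ≤ θ ≤ 1`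
    (∀ φ : ℝ, 0 ≤ φ → ((RandomCoin.psi P φ : ℝ) : EReal) = RandomCoin.psiExt P φ) ∧
    StrictMonoOn (RandomCoin.psi P) (Ici 0) ∧
    BijOn (RandomCoin.psi P) (Ici 0) (Ici 0) ∧
    (∀ θ ∈ Icc (0 : ℝ) 1, RandomCoin.psi P (Real.logb 2 (1 + θ)) < 1) ∧
    -- the almost sure value of `R̂(X)`
    (∀ θ ∈ Icc (0 : ℝ) 1, ∀ᵐ ω ∂(RandomCoin.Q P θ),
      RandomCoin.Rhat (RandomCoin.X ω) =
        ENNReal.ofReal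
          (max ((1 - γ) / (1 - RandomCoin.psi P (Real.logb 2 (1 + θ)))) 1)) ∧
    -- recovery of `φ = log₂ (1 + θ)` and of `θ` from `X`, by an explicit measurable function
    Measurable (RandomCoin.phiEstimator P γ) ∧
    (∀ θ ∈ Icc (0 : ℝ) 1, RandomCoin.psiInv P γ ≤ Real.logb 2 (1 + θ) →
      ∀ᵐ ω ∂(RandomCoin.Q P θ),
        RandomCoin.phiEstimator P γ (RandomCoin.X ω) = Real.logb 2 (1 + θ) ∧
        (2 : ℝ) ^ RandomCoin.phiEstimator P γ (RandomCoin.X ω) - 1 = θ) ∧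
    -- strict improvement of the bound `2^γ / max {u_i : i ≥ 1} - 1` when `u_1` is the maximum
    ((∀ i : ℕ, 1 ≤ i → RandomCoin.u P i ≤ RandomCoin.u P 1) →
      (2 : ℝ) ^ RandomCoin.psiInv P γ - 1 < 2 ^ γ / RandomCoin.u P 1 - 1) ∧
    -- reconstruction of `θ` above the bound `2^γ / max {u_i : i ≥ 1} - 1`, in general
    (∃ g : (ℕ → ℝ) → ℝ, Measurable g ∧
      ∀ θ ∈ Icc (0 : ℝ) 1, 2 ^ γ / (⨆ i : ℕ, RandomCoin.u P (i + 1)) - 1 < θ →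
        ∀ᵐ ω ∂(RandomCoin.Q P θ), g (RandomCoin.X ω) = θ) := by
  have hγ0 : 0 < γ := by linarith
  have hidx : RandomCoin.HasIndex P γ := hP.hasIndex hℓ hU
  have hUt := hP.tendsto_U hidx hγ1
  refine ⟨fun a ha => hP.tendsto_rateSeq (by linarith), fun φ hφ => hP.coe_psi hUt hφ,
    hP.psi_strictMonoOn hUt, hP.psi_bijOn hUt, fun θ hθ => ?_,
    fun θ hθ => hP.ae_Rhat_eq hidx hγ0 hγ1 hθ, hP.measurable_phiEstimator hUt γ,
    fun θ hθ hle => ?_, fun hmax => ?_, hP.exists_measurable_ae_eq hidx hγ0 hγ1⟩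
  · exact hP.psi_lt_one hUt (hP.u_one_lt_one hidx hγ0) (RandomCoin.logb_one_add_mem hθ).1
      (RandomCoin.logb_one_add_mem hθ).2
  · filter_upwards [hP.ae_phiEstimator_eq hidx hγ0 hγ1 hθ] with ω hω
    rw [hω, max_eq_left hle, Real.rpow_logb (by norm_num) (by norm_num) (by linarith [hθ.1])]
    exact ⟨rfl, by ring⟩
  · obtain ⟨i, hi⟩ := hP.exists_u_pos hUt
    have h1 : 0 < RandomCoin.u P 1 := hi.trans_le (hmax (i + 1) (by omega))
    exact sub_lt_sub_right (hP.two_rpow_psiInv_lt hidx hγ0 hγ1 h1) 1
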